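/- Let $\alpha,A,A_1\in\mathbb R$ with $A\notin\mathbb Z$. Let $\Gamma$ be the infinite chain of rings of circumference $2\pi$: ring $j\in\mathbb Z$ consists of an upper and a lower half-circle, each identified with $[0,\pi]$, and the points $x=\pi$ of ring $j-1$ are glued to the points $x=0$ of ring $j$ at the $j$-th vertex. For a real sequence $\mathbf A=(\mathsf A_j)_{j\in\mathbb Z}$ let $H_{\alpha,\mathbf A}$ be the operator in $L^2(\Gamma)$ acting on the functions $\psi_j$ (upper half-circle) and $\varphi_j$ (lower half-circle) by $(\psi_j,\varphi_j)\mapsto(-\mathscr D^2\psi_j,-\mathscr D^2\varphi_j)$, where $\mathscr D\psi_j=\psi_j'+i\mathsf A_j\psi_j$ and $\mathscr D\varphi_j=\varphi_j'-i\mathsf A_j\varphi_j$. Its domain consists of all functions in $L^2(\Gamma)$ that are in $H^2$ on each half-circle, whose image is in $L^2(\Gamma)$, and which satisfy at each vertex the $\delta$-coupling conditions $$\psi_j(0)=\varphi_j(0)=\psi_{j-1}(\pi)=\varphi_{j-1}(\pi),$$ $$\mathscr D\psi_j(0)+\mathscr D\varphi_j(0)-\mathscr D\psi_{j-1}(\pi)-\mathscr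 D\varphi_{j-1}(\pi)=\alpha\,\psi_j(0).$$ Let $-\Delta_{\alpha,A}$ be this operator with $\mathsf A_j=A$ for all $j$, and let $-\Delta_{A_1}:=-\Delta_{A_1,A}$ be the operator with $\mathsf A_1=A_1$ and $\mathsf A_j=A$ for $j\ne1$ (the magnetic flux is changed on a single ring). If $|\cos A_1\pi|\le|\cos A\pi|$, then $\sigma(-\Delta_{A_1})=\sigma(-\Delta_{\alpha,A})$. If $|\cos A_1\pi|>|\cos A\pi|$, then $\sigma_{\mathrm{ess}}(-\Delta_{A_1})=\sigma(-\Delta_{\alpha,A})$ and, moreover, $-\Delta_{A_1}$ has precisely one eigenvalue in every gap of its essential spectrum (that is, in every connected component of $\mathbb R\setminus\sigma_{\mathrm{ess}}(-\Delta_{A_1})$, including the one below the bottom of the essential spectrum), and this eigenvalue is simple. -/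

import Mathlib

open MeasureTheory Set

noncomputable section

/-! # Spectral notions for unbounded operators -/

namespace UnboundedOp

variable {H : Type*} [NormedAddCommGroup H] [NormedSpace ℂ H]

/-- `z` is in the resolvent set of `T` if `T - z : D(T) → H` is bijective with bounded inverse. -/
def resolventSet (T : H →ₗ.[ℂ] H) : Set ℂ :=
  {z | ∃ R : H →L[ℂ] H,
    (∀ h : H, ∃ f : T.domain, (f : H) = R h ∧ T f - z • (f : H) = h) ∧
    (∀ f : T.domain, R (T f - z • (f : H)) = f)}

/-- The spectrum of `T`. -/
def spectrum (T : H →ₗ.[ℂ] H) : Set ℂ := (resolventSet T)ᶜ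

/-- The eigenspace `ker (T - z)`. -/
def eigenspace (T : H →ₗ.[ℂ] H) (z : ℂ) : Submodule ℂ H :=
  (LinearMap.ker (T.toFun - z • T.domain.subtype)).map T.domain.subtype

/-- `z` is an eigenvalue of `T`. -/
def IsEigenvalue (T : H →ₗ.[ℂ] H) (z : ℂ) : Prop := eigenspace T z ≠ ⊥

/-- `z` is a simple eigenvalue of `T`: the eigenspace is one-dimensional. -/
def IsSimpleEigenvalue (T : H →ₗ.[ℂ] H) (z : ℂ) : Prop :=
  Module.finrank ℂ (eigenspace T z) = 1

/-- The discrete spectrum (of a self-adjoint operator): the isolated points of the spectrum that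
are eigenvalues of finite multiplicity. -/
def discreteSpectrum (T : H →ₗ.[ℂ] H) : Set ℂ :=
  {z | z ∈ spectrum T ∧ (∃ ε > 0, ∀ z' ∈ spectrum T, dist z' z < ε → z' = z) ∧
    IsEigenvalue T z ∧ FiniteDimensional ℂ (eigenspace T z)}

/-- The essential spectrum (of a self-adjoint operator): the complement of the discrete spectrum
in the spectrum. -/
def essentialSpectrum (T : H →ₗ.[ℂ] H) : Set ℂ := spectrum T \ discreteSpectrum T

/-- `G` is a gap of the essential spectrum of `T`: a connected component of the set of real
energies outside of it. The unbounded component below the bottom of the spectrum is included. -/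
def IsEssentialGap (T : H →ₗ.[ℂ] H) (G : Set ℝ) : Prop :=
  ∃ E₀ : ℝ, (E₀ : ℂ) ∉ essentialSpectrum T ∧
    G = connectedComponentIn {E : ℝ | (E : ℂ) ∉ essentialSpectrum T} E₀

end UnboundedOp

/-! # The ring chain -/

namespace RingChain

/-- The two half-circles of a ring. -/
inductive Arc
  | upper
  | lower

/-- Square-integrable functions on a half-circle, parametrized by `(0, π)` from its left end
to its right end. -/
abbrev ArcL2 : Type := Lp ℂ 2 (volume.restrict (Ioo (0 : ℝ) Real.pi))

/-- The Hilbert space `L²(Γ)`: the Hilbert sum of `L²(0, π)` over all half-circles. The index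
`(j, s)` stands for the half-circle `s` of the `j`-th ring. -/
abbrev ChainL2 : Type := lp (fun _ : ℤ × Arc => ArcL2) 2

/-- `f` belongs to the Sobolev space `H²(0, π)`, its continuous representative on `[0, π]` is `u`,
with the (absolutely continuous) derivative `u'` and the weak second derivative `w ∈ L²(0, π)`. -/
structure IsH2 (f : ArcL2) (u u' : ℝ → ℂ) (w : ArcL2) : Prop where
  repr : ∀ᵐ x ∂(volume.restrict (Ioo (0 : ℝ) Real.pi)), f x = u x
  deriv : ∀ x ∈ Icc (0 : ℝ) Real.pi, HasDerivWithinAt u (u' x) (Icc 0 Real.pi) x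
  deriv₂ : ∀ x ∈ Icc (0 : ℝ) Real.pi, u' x = u' 0 + ∫ t in (0 : ℝ)..x, w t

/-- The real constant `a` in the quasiderivative `𝒟 = d/dx + i a` on a half-circle of a ring with
magnetic potential `A`: it is `A` on the upper half-circle and `-A` on the lower one, so that
`-𝒟² = (i d/dx - A)²` and `-𝒟² = (i d/dx + A)²`, respectively. -/
def arcPotential (A : ℝ) : Arc → ℝ
  | Arc.upper => A
  | Arc.lower => -A

/-- The quasiderivative `𝒟 u = u' + i a u`. -/
def quasiDeriv (a : ℝ) (u u' : ℝ → ℂ) (x : ℝ) : ℂ := u' x + Complex.I * a * u x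

/-- `f` is in the domain of the chain Hamiltonian with `δ` coupling constant `α` at each vertex
and potential `A j` on the `j`-th ring, and the Hamiltonian maps `f` to `g`. Here `u j s`, `u' j s`,
`w j s` are the function on the half-circle `s` of the `j`-th ring, its derivative and its second
derivative. The `j`-th vertex joins the right end of ring `j - 1` to the left end of ring `j`. -/
structure ActsAs (α : ℝ) (A : ℤ → ℝ) (f g : ChainL2)
    (u u' : ℤ → Arc → ℝ → ℂ) (w : ℤ → Arc → ArcL2) : Prop where
  /-- the function is in `H²` on each half-circle -/
  sobolev : ∀ j s, IsH2 (f (j, s)) (u j s) (u' j s) (w j s)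
  /-- continuity at the vertices -/
  cont_right : ∀ j s, u j s 0 = u j Arc.upper 0
  cont_left : ∀ j s, u (j - 1) s Real.pi = u j Arc.upper 0
  /-- the `δ` condition at the vertices -/
  delta : ∀ j,
    quasiDeriv (arcPotential (A j) Arc.upper) (u j Arc.upper) (u' j Arc.upper) 0
      + quasiDeriv (arcPotential (A j) Arc.lower) (u j Arc.lower) (u' j Arc.lower) 0
      - quasiDeriv (arcPotential (A (j - 1)) Arc.upper) (u (j - 1) Arc.upper) (u' (j - 1) Arc.upper)
          Real.pi
      - quasiDeriv (arcPotential (A (j - 1)) Arc.lower) (u (j - 1) Arc.lower) (u' (j - 1) Arc.lower)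
          Real.pi
      = α * u j Arc.upper 0
  /-- the action `-𝒟² u = -u'' - 2 i a u' + a² u` on each half-circle -/
  action : ∀ j s, ∀ᵐ x ∂(volume.restrict (Ioo (0 : ℝ) Real.pi)),
    (g (j, s) : ArcL2) x = -(w j s x) - 2 * Complex.I * (arcPotential (A j) s) * u' j s x
      + (arcPotential (A j) s : ℂ) ^ 2 * u j s x

lemma ArcL2.intervalIntegrable (w : ArcL2) {x : ℝ} (hx : x ∈ Icc (0 : ℝ) Real.pi) :
    IntervalIntegrable (fun t => w t) volume 0 x := by
  have h1 : Integrable (fun t => w t) (volume.restrict (Ioo (0 : ℝ) Real.pi)) :=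
    (Lp.memLp w).integrable (by norm_num)
  rw [intervalIntegrable_iff_integrableOn_Ioo_of_le hx.1]
  exact IntegrableOn.mono_set h1 (Ioo_subset_Ioo_right hx.2)

lemma ArcL2.integral_congr {w w' : ℝ → ℂ}
    (h : ∀ᵐ t ∂(volume.restrict (Ioo (0 : ℝ) Real.pi)), w t = w' t)
    {x : ℝ} (hx : x ∈ Icc (0 : ℝ) Real.pi) :
    ∫ t in (0 : ℝ)..x, w t = ∫ t in (0 : ℝ)..x, w' t := by
  rw [intervalIntegral.integral_of_le hx.1, intervalIntegral.integral_of_le hx.1,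
    integral_Ioc_eq_integral_Ioo, integral_Ioc_eq_integral_Ioo]
  exact integral_congr_ae (ae_restrict_of_ae_restrict_of_subset (Ioo_subset_Ioo_right hx.2) h)

lemma IsH2.add {f₁ f₂ w₁ w₂ : ArcL2} {u₁ u₂ v₁ v₂ : ℝ → ℂ}
    (h₁ : IsH2 f₁ u₁ v₁ w₁) (h₂ : IsH2 f₂ u₂ v₂ w₂) :
    IsH2 (f₁ + f₂) (u₁ + u₂) (v₁ + v₂) (w₁ + w₂) where
  repr := by
    filter_upwards [Lp.coeFn_add f₁ f₂, h₁.repr, h₂.repr] with x e e1 e2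
    rw [e, Pi.add_apply, Pi.add_apply, e1, e2]
  deriv := fun x hx => (h₁.deriv x hx).add (h₂.deriv x hx)
  deriv₂ := fun x hx => by
    rw [ArcL2.integral_congr (Lp.coeFn_add w₁ w₂) hx]
    simp only [Pi.add_apply]
    rw [intervalIntegral.integral_add (w₁.intervalIntegrable hx) (w₂.intervalIntegrable hx),
      h₁.deriv₂ x hx, h₂.deriv₂ x hx]
    ring

lemma IsH2.smul {f w : ArcL2} {u v : ℝ → ℂ} (c : ℂ) (h : IsH2 f u v w) :
    IsH2 (c • f) (c • u) (c • v) (c • w) where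
  repr := by
    filter_upwards [Lp.coeFn_smul c f, h.repr] with x e e1
    simp [e, e1]
  deriv := fun x hx => (h.deriv x hx).const_smul c
  deriv₂ := fun x hx => by
    rw [ArcL2.integral_congr (Lp.coeFn_smul c w) hx]
    simp only [Pi.smul_apply]
    rw [intervalIntegral.integral_smul, h.deriv₂ x hx, smul_add]

/-- A function that vanishes almost everywhere has vanishing derivatives. -/
lemma IsH2.eq_zero {w : ArcL2} {u v : ℝ → ℂ} (h : IsH2 0 u v w) :
    (∀ x ∈ Icc (0 : ℝ) Real.pi, u x = 0) ∧ (∀ x ∈ Icc (0 : ℝ) Real.pi, v x = 0) ∧ w = 0 := by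
  have hu : ∀ x ∈ Icc (0 : ℝ) Real.pi, u x = 0 := by
    have hc : ContinuousOn u (Icc 0 Real.pi) := fun x hx => (h.deriv x hx).continuousWithinAt
    have h0 : u =ᵐ[volume.restrict (Ioo (0 : ℝ) Real.pi)] fun _ => (0 : ℂ) := by
      filter_upwards [h.repr, Lp.coeFn_zero ℂ 2 (volume.restrict (Ioo (0 : ℝ) Real.pi))]
        with x e1 e2
      rw [← e1, e2, Pi.zero_apply]
    rw [restrict_Ioo_eq_restrict_Icc] at h0
    exact Measure.eqOn_Icc_of_ae_eq volume Real.pi_pos.ne h0 hc continuousOn_const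
  have hv : ∀ x ∈ Icc (0 : ℝ) Real.pi, v x = 0 := fun x hx =>
    (uniqueDiffOn_Icc Real.pi_pos x hx).eq_deriv _ (h.deriv x hx)
      ((hasDerivWithinAt_const x _ (0 : ℂ)).congr hu (hu x hx))
  refine ⟨hu, hv, ?_⟩
  have hI : ∀ x ∈ Icc (0 : ℝ) Real.pi, ∫ t in (0 : ℝ)..x, w t = 0 := fun x hx => by
    have := h.deriv₂ x hx
    rw [hv x hx, hv 0 ⟨le_rfl, Real.pi_pos.le⟩, zero_add] at this
    exact this.symm
  rw [Lp.eq_zero_iff_ae_eq_zero]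
  have hd := (w.intervalIntegrable (x := Real.pi)
    ⟨Real.pi_pos.le, le_rfl⟩).ae_hasDerivAt_integral
  refine (ae_restrict_iff' measurableSet_Ioo).2 ?_
  filter_upwards [hd] with x hx hxm
  rw [uIcc_of_le Real.pi_pos.le] at hx
  have h1 := hx (Ioo_subset_Icc_self hxm) 0 ⟨le_rfl, Real.pi_pos.le⟩
  refine h1.unique ((hasDerivAt_const x (0 : ℂ)).congr_of_eventuallyEq ?_)
  filter_upwards [isOpen_Ioo.mem_nhds hxm] with y hy
  exact hI y (Ioo_subset_Icc_self hy)

/-- The graph of the chain Hamiltonian. -/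
def chainGraph (α : ℝ) (A : ℤ → ℝ) : Submodule ℂ (ChainL2 × ChainL2) where
  carrier := {p | ∃ u u' w, ActsAs α A p.1 p.2 u u' w}
  add_mem' := by
    rintro p q ⟨u₁, v₁, w₁, h₁⟩ ⟨u₂, v₂, w₂, h₂⟩
    refine ⟨u₁ + u₂, v₁ + v₂, w₁ + w₂, ?_, ?_, ?_, ?_, ?_⟩
    · exact fun j s => (h₁.sobolev j s).add (h₂.sobolev j s)
    · intro j s
      simp only [Pi.add_apply]
      rw [h₁.cont_right, h₂.cont_right]
    · intro j s
      simp only [Pi.add_apply]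
      rw [h₁.cont_left, h₂.cont_left]
    · intro j
      have e1 := h₁.delta j
      have e2 := h₂.delta j
      simp only [quasiDeriv, Pi.add_apply] at e1 e2 ⊢
      linear_combination e1 + e2
    · intro j s
      filter_upwards [h₁.action j s, h₂.action j s, Lp.coeFn_add (p.2 (j, s)) (q.2 (j, s)),
        Lp.coeFn_add (w₁ j s) (w₂ j s)] with x e1 e2 e3 e4
      have e5 : ((p + q).2 (j, s) : ArcL2) x = (p.2 (j, s) + q.2 (j, s) : ArcL2) x := rfl
      have e6 : ((w₁ + w₂) j s : ArcL2) x = (w₁ j s + w₂ j s : ArcL2) x := rfl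
      rw [e5, e6, e3, e4]
      simp only [Pi.add_apply]
      linear_combination e1 + e2
  zero_mem' := by
    refine ⟨0, 0, 0, ?_, ?_, ?_, ?_, ?_⟩
    · refine fun j s => ⟨?_, ?_, ?_⟩
      · exact Lp.coeFn_zero ℂ 2 _
      · exact fun x _ => hasDerivWithinAt_const x _ (0 : ℂ)
      · intro x hx
        have := ArcL2.integral_congr (Lp.coeFn_zero ℂ 2 _) hx
        simp only [Pi.zero_apply, intervalIntegral.integral_zero] at this ⊢
        rw [this, zero_add]
    · exact fun _ _ => rfl
    · exact fun _ _ => rfl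
    · intro j
      simp [quasiDeriv]
    · intro j s
      filter_upwards [Lp.coeFn_zero ℂ 2 (volume.restrict (Ioo (0 : ℝ) Real.pi))] with x e
      have e5 : (((0 : ChainL2 × ChainL2).2 (j, s) : ArcL2)) x = (0 : ArcL2) x := rfl
      have e6 : (((0 : ℤ → Arc → ArcL2) j s : ArcL2)) x = (0 : ArcL2) x := rfl
      rw [e5, e6, e]
      simp
  smul_mem' := by
    rintro c p ⟨u, v, w, h⟩
    refine ⟨c • u, c • v, c • w, ?_, ?_, ?_, ?_, ?_⟩
    · exact fun j s => (h.sobolev j s).smul c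
    · intro j s
      simp only [Pi.smul_apply]
      rw [h.cont_right]
    · intro j s
      simp only [Pi.smul_apply]
      rw [h.cont_left]
    · intro j
      have e := h.delta j
      simp only [quasiDeriv, Pi.smul_apply, smul_eq_mul] at e ⊢
      linear_combination c * e
    · intro j s
      filter_upwards [h.action j s, Lp.coeFn_smul c (p.2 (j, s)), Lp.coeFn_smul c (w j s)]
        with x e1 e3 e4
      have e5 : ((c • p).2 (j, s) : ArcL2) x = (c • p.2 (j, s) : ArcL2) x := rfl
      have e6 : ((c • w) j s : ArcL2) x = (c • w j s : ArcL2) x := rfl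
      rw [e5, e6, e3, e4]
      simp only [Pi.smul_apply, smul_eq_mul]
      linear_combination c * e1

lemma chainGraph_single_valued (α : ℝ) (A : ℤ → ℝ) (x : ChainL2 × ChainL2)
    (hx : x ∈ chainGraph α A) (h0 : x.1 = 0) : x.2 = 0 := by
  obtain ⟨u, v, w, h⟩ := hx
  ext1
  funext ⟨j, s⟩
  have hs := h.sobolev j s
  rw [h0] at hs
  obtain ⟨hu, hv, hw⟩ := IsH2.eq_zero hs
  change x.2 (j, s) = 0
  rw [Lp.eq_zero_iff_ae_eq_zero]
  have ha := h.action j s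
  rw [hw] at ha
  filter_upwards [ha, ae_restrict_mem measurableSet_Ioo,
    Lp.coeFn_zero ℂ 2 (volume.restrict (Ioo (0 : ℝ) Real.pi))] with y e1 hy e2
  rw [e1, e2, hu y (Ioo_subset_Icc_self hy), hv y (Ioo_subset_Icc_self hy)]
  simp

/-- The magnetic Laplacian on the chain of rings of circumference `2π`, with `δ` coupling of
strength `α` at each vertex and the potential `A j` on the `j`-th ring, on its natural (maximal)
domain. -/
def chainHamiltonian (α : ℝ) (A : ℤ → ℝ) : ChainL2 →ₗ.[ℂ] ChainL2 :=
  (chainGraph α A).toLinearPMap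

/-- The operator defined above has the prescribed graph. -/
lemma chainHamiltonian_graph (α : ℝ) (A : ℤ → ℝ) :
    (chainHamiltonian α A).graph = chainGraph α A :=
  Submodule.toLinearPMap_graph_eq _ (chainGraph_single_valued α A)

/-- The periodic Hamiltonian `-Δ_{α,A}`. -/
def periodicHamiltonian (α A : ℝ) : ChainL2 →ₗ.[ℂ] ChainL2 :=
  chainHamiltonian α fun _ => A

/-- The Hamiltonian `-Δ_{A₁,A₂}`: the potential is changed to `A₁`, `A₂` on the rings `1`, `2`. -/
def twoRingHamiltonian (α A A₁ A₂ : ℝ) : ChainL2 →ₗ.[ℂ] ChainL2 :=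
  chainHamiltonian α fun j => if j = 1 then A₁ else if j = 2 then A₂ else A

/-- The Hamiltonian `-Δ_{A₁} = -Δ_{A₁,A}`: the potential is changed to `A₁` on a single ring. -/
def oneRingHamiltonian (α A A₁ : ℝ) : ChainL2 →ₗ.[ℂ] ChainL2 :=
  twoRingHamiltonian α A A₁ A

end RingChain

end

noncomputable section

namespace RingChain

/-! ### Products of integrals with smooth functions -/

/-! Fix an energy `z = k ^ 2` with `sn k π ≠ 0`. On a half-circle the factor `e^{iax}` turns `𝒟`
into `d/dx`, so a solution of `(H - z) f = 0` is determined there by its two end values. Inserting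
the resulting boundary derivatives into the δ condition leaves a three-term relation for the vertex
values, `cos (A_j π) y_{j+1} + cos (A_{j-1} π) y_{j-1} = 2 ξ y_j`, with `ξ = disc α k = cos kπ +
(α/4) sin(kπ)/k`. The equation `(H - z) f = h` reduces in the same way to `(J - 2ξ) y = e` on
`ℓ²(ℤ)`, with `e` controlled by `h` (`ActsAs.vertex_kernel`, `exists_chain_solution`). Thus `z` is
in the resolvent set when `J - 2ξ` is invertible, and eigenfunctions are the `ℓ²` solutions of the
relation. At the excluded energies `n ^ 2`, `n ≥ 1`, there are infinitely many independent
eigenfunctions supported on two rings (`flat_band`).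

Put `c = cos Aπ`, `c₁ = cos A₁π`. Energies with `|ξ| ≤ |c|` belong to the spectrum whatever happens
on ring 1, by truncated Bloch waves living on rings with potential `A` (`mem_spectrum_of_band`). Off
these bands, `|c₁| ≤ |c|` gives `‖J‖ ≤ 2|c| < 2|ξ|`, so nothing is added. If `|c₁| > |c|`, then `J`
is a finite-rank perturbation of the constant-coefficient operator and `J - 2ξ` can fail to be
invertible only through a kernel (`jacobiInvertible_of_injective`). A kernel vector decays
geometrically away from ring 1 with ratio `c/ν`, where `ν` is the root of `ν² + c² = 2ξν` with `|ν|
> |c|`. Matching the two half-lines across ring 1 forces `c₁² = ν²`, that is `|ξ| = (c² + c₁²) /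
(2|c₁|)`, and conversely produces exactly one state up to scaling. This level lies strictly between
`|c|` and `1`.

It remains to count energies. Between consecutive points `n ^ 2` the function `ξ` passes from
`(-1)^n` to `(-1)^(n+1)` and meets each level `t` in `(-1, 1)` exactly once, because `ξ - t = sn ·
((cs - t)/sn + α/4)` and `(cs - t)/sn` is strictly decreasing there (`exists_crossing`). The lowest
interval extends to `-∞` and behaves in the same way. Hence each interval contains two gaps, one for
each sign of `ξ`, and each of them contains exactly one energy at the bound-state level. Reality of
the spectrum comes from Green's identity for a Floquet solution (`im_sq_eq_zero_of_disc`). -/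

lemma integral_mul_rule_real {g g' w : ℝ → ℝ} {x : ℝ} (hg : ∀ t, HasDerivAt g (g' t) t)
    (hg' : Continuous g') (hw : IntervalIntegrable w volume 0 x) :
    g x * ∫ t in (0 : ℝ)..x, w t =
      ∫ t in (0 : ℝ)..x, (g' t * (∫ r in (0 : ℝ)..t, w r) + g t * w t) := by
  -- `w` is merely integrable, so its primitive need not be differentiable everywhere; integration
  -- by parts is applied in its absolutely continuous form.
  have hW := hw.absolutelyContinuousOnInterval_intervalIntegral (c := 0) (by simp)
  have hgd : deriv g = g' := funext fun t => (hg t).deriv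
  have hgC : ContDiff ℝ 1 g := contDiff_one_iff_deriv.2
    ⟨fun t => (hg t).differentiableAt, hgd ▸ hg'⟩
  have hG : AbsolutelyContinuousOnInterval g 0 x := hgC.contDiffOn.absolutelyContinuousOnInterval
  have key := hG.integral_deriv_mul_eq_sub hW
  simp only [intervalIntegral.integral_same, mul_zero, sub_zero] at key
  rw [← key]
  apply intervalIntegral.integral_congr_ae
  filter_upwards [hw.ae_hasDerivAt_integral] with t ht htm
  rw [(ht (uIoc_subset_uIcc htm) 0 (by simp)).deriv, hgd]

lemma integral_mul_rule {g g' w : ℝ → ℂ} {x : ℝ} (hg : ∀ t, HasDerivAt g (g' t) t)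
    (hg' : Continuous g') (hw : IntervalIntegrable w volume 0 x) (W₀ : ℂ) :
    g x * (W₀ + ∫ t in (0 : ℝ)..x, w t) = g 0 * W₀ +
      ∫ t in (0 : ℝ)..x, (g' t * (W₀ + ∫ r in (0 : ℝ)..t, w r) + g t * w t) := by
  have hgc : Continuous g := continuous_iff_continuousAt.2 fun t => (hg t).continuousAt
  have hre : IntervalIntegrable (fun t => (w t).re) volume 0 x :=
    ⟨hw.1.re, hw.2.re⟩
  have him : IntervalIntegrable (fun t => (w t).im) volume 0 x :=
    ⟨hw.1.im, hw.2.im⟩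
  have sub : ∀ t ∈ uIcc 0 x, IntervalIntegrable w volume 0 t := fun t ht =>
    hw.mono_set (uIcc_subset_uIcc_left ht)
  have Wre : ∀ t ∈ uIcc 0 x, (∫ r in (0 : ℝ)..t, w r).re = ∫ r in (0 : ℝ)..t, (w r).re :=
    fun t ht => (Complex.reCLM.intervalIntegral_comp_comm (sub t ht)).symm
  have Wim : ∀ t ∈ uIcc 0 x, (∫ r in (0 : ℝ)..t, w r).im = ∫ r in (0 : ℝ)..t, (w r).im :=
    fun t ht => (Complex.imCLM.intervalIntegral_comp_comm (sub t ht)).symm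
  have hgre : ∀ t, HasDerivAt (fun t => (g t).re) (g' t).re t := fun t =>
    Complex.reCLM.hasFDerivAt.comp_hasDerivAt t (hg t)
  have hgim : ∀ t, HasDerivAt (fun t => (g t).im) (g' t).im t := fun t =>
    Complex.imCLM.hasFDerivAt.comp_hasDerivAt t (hg t)
  have hWc : ContinuousOn (fun t => ∫ r in (0 : ℝ)..t, w r) (uIcc 0 x) :=
    intervalIntegral.continuousOn_primitive_interval' hw (by simp)
  have hWrc : ContinuousOn (fun t => ∫ r in (0 : ℝ)..t, (w r).re) (uIcc 0 x) :=
    intervalIntegral.continuousOn_primitive_interval' hre (by simp)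
  have hWic : ContinuousOn (fun t => ∫ r in (0 : ℝ)..t, (w r).im) (uIcc 0 x) :=
    intervalIntegral.continuousOn_primitive_interval' him (by simp)
  have gre : Continuous fun t => (g t).re := Complex.continuous_re.comp hgc
  have gim : Continuous fun t => (g t).im := Complex.continuous_im.comp hgc
  have gre' : Continuous fun t => (g' t).re := Complex.continuous_re.comp hg'
  have gim' : Continuous fun t => (g' t).im := Complex.continuous_im.comp hg'
  have i1 : ∀ {φ φ' W v : ℝ → ℝ}, Continuous φ → Continuous φ' → ContinuousOn W (uIcc 0 x) →
      IntervalIntegrable v volume 0 x →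
      IntervalIntegrable (fun t => φ' t * W t + φ t * v t) volume 0 x := fun h1 h2 h3 h4 =>
    (h2.continuousOn.mul h3).intervalIntegrable.add (h4.continuousOn_mul h1.continuousOn)
  have I1 : IntervalIntegrable (fun t => g' t * (∫ r in (0 : ℝ)..t, w r) + g t * w t) volume 0 x :=
    (hg'.continuousOn.mul hWc).intervalIntegrable.add (hw.continuousOn_mul hgc.continuousOn)
  have rr := integral_mul_rule_real hgre gre' hre
  have ri := integral_mul_rule_real hgre gre' him
  have ir := integral_mul_rule_real hgim gim' hre
  have ii := integral_mul_rule_real hgim gim' him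
  -- The real rule is applied to the four products of real and imaginary parts.
  have main : g x * (∫ t in (0 : ℝ)..x, w t) =
      ∫ t in (0 : ℝ)..x, (g' t * (∫ r in (0 : ℝ)..t, w r) + g t * w t) := by
    apply Complex.ext
    · have e := Complex.reCLM.intervalIntegral_comp_comm I1
      simp only [Complex.reCLM_apply] at e
      rw [← e, Complex.mul_re, Wre x (by simp), Wim x (by simp), rr, ii,
        ← intervalIntegral.integral_sub
          (i1 gre gre' hWrc hre) (i1 gim gim' hWic him)]
      apply intervalIntegral.integral_congr
      intro t ht
      simp only [Complex.add_re, Complex.mul_re, Wre t ht, Wim t ht]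
      ring
    · have e := Complex.imCLM.intervalIntegral_comp_comm I1
      simp only [Complex.imCLM_apply] at e
      rw [← e, Complex.mul_im, Wre x (by simp), Wim x (by simp), ri, ir,
        ← intervalIntegral.integral_add
          (i1 gre gre' hWic him) (i1 gim gim' hWrc hre)]
      apply intervalIntegral.integral_congr
      intro t ht
      simp only [Complex.add_im, Complex.mul_im, Wre t ht, Wim t ht]
      ring
  have hgI : ∫ t in (0 : ℝ)..x, g' t = g x - g 0 :=
    intervalIntegral.integral_eq_sub_of_hasDerivAt (fun t _ => hg t) (hg'.intervalIntegrable _ _)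
  have split : (fun t => g' t * (W₀ + ∫ r in (0 : ℝ)..t, w r) + g t * w t) = fun t =>
      g' t * W₀ + (g' t * (∫ r in (0 : ℝ)..t, w r) + g t * w t) := by
    funext t; ring
  rw [split, intervalIntegral.integral_add
    ((hg'.intervalIntegrable _ _).mul_const W₀) I1, intervalIntegral.integral_mul_const, hgI, ← main]
  ring

/-! ### Fundamental solutions of `-v'' = k² v` -/

/-- The solution of `-v'' = k² v` with `v 0 = 0`, `v' 0 = 1`. -/
def sn (k : ℂ) (x : ℝ) : ℂ := if k = 0 then x else Complex.sin (k * x) / k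

/-- The solution of `-v'' = k² v` with `v 0 = 1`, `v' 0 = 0`. -/
def cs (k : ℂ) (x : ℝ) : ℂ := Complex.cos (k * x)

@[simp] lemma sn_zero (k : ℂ) : sn k 0 = 0 := by simp [sn]

@[simp] lemma cs_zero (k : ℂ) : cs k 0 = 1 := by simp [cs]

lemma mul_sn (k : ℂ) (x : ℝ) : k * sn k x = Complex.sin (k * x) := by
  unfold sn
  split_ifs with h
  · simp [h]
  · field_simp

lemma hasDerivAt_mul_ofReal (k : ℂ) (x : ℝ) : HasDerivAt (fun x : ℝ => k * (x : ℂ)) k x := by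
  simpa using (Complex.ofRealCLM.hasDerivAt (x := x)).const_mul k

lemma hasDerivAt_sn (k : ℂ) (x : ℝ) : HasDerivAt (sn k) (cs k x) x := by
  by_cases h : k = 0
  · have : sn k = fun x : ℝ => (x : ℂ) := by funext x; simp [sn, h]
    rw [this]
    have e : cs k x = 1 := by simp [cs, h]
    rw [e]
    exact Complex.ofRealCLM.hasDerivAt
  · have : sn k = fun x : ℝ => Complex.sin (k * x) / k := by funext x; simp [sn, h]
    rw [this]
    have h2 := ((Complex.hasDerivAt_sin _).comp x (hasDerivAt_mul_ofReal k x)).div_const k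
    convert! h2 using 1
    simp [cs, h]

lemma hasDerivAt_cs (k : ℂ) (x : ℝ) : HasDerivAt (cs k) (-k ^ 2 * sn k x) x := by
  have h2 := (Complex.hasDerivAt_cos _).comp x (hasDerivAt_mul_ofReal k x)
  convert! h2 using 1
  rw [← mul_sn]
  ring

lemma continuous_sn (k : ℂ) : Continuous (sn k) :=
  continuous_iff_continuousAt.2 fun x => (hasDerivAt_sn k x).continuousAt

lemma continuous_cs (k : ℂ) : Continuous (cs k) :=
  continuous_iff_continuousAt.2 fun x => (hasDerivAt_cs k x).continuousAt

lemma cs_sq_add (k : ℂ) (x : ℝ) : cs k x ^ 2 + k ^ 2 * sn k x ^ 2 = 1 := by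
  rw [← mul_pow, mul_sn, cs, add_comm, Complex.sin_sq_add_cos_sq]

/-- The gauge factor `e^{i a x}`. -/
def gauge (a : ℝ) (x : ℝ) : ℂ := Complex.exp (Complex.I * a * x)

@[simp] lemma gauge_zero (a : ℝ) : gauge a 0 = 1 := by simp [gauge]

@[simp] lemma norm_gauge (a x : ℝ) : ‖gauge a x‖ = 1 := by
  rw [gauge, show Complex.I * a * x = ((a * x : ℝ) : ℂ) * Complex.I by push_cast; ring,
    Complex.norm_exp_ofReal_mul_I]

lemma gauge_ne_zero (a x : ℝ) : gauge a x ≠ 0 := Complex.exp_ne_zero _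

lemma gauge_mul_gauge_neg (a x : ℝ) : gauge a x * gauge (-a) x = 1 := by
  rw [gauge, gauge, ← Complex.exp_add]
  simp

lemma hasDerivAt_gauge (a x : ℝ) : HasDerivAt (gauge a) (Complex.I * a * gauge a x) x := by
  have := (Complex.hasDerivAt_exp _).comp x (hasDerivAt_mul_ofReal (Complex.I * a) x)
  convert! this using 1
  rw [mul_comm, gauge]

lemma continuous_gauge (a : ℝ) : Continuous (gauge a) :=
  continuous_iff_continuousAt.2 fun x => (hasDerivAt_gauge a x).continuousAt

/-! ### Functions on a half-circle -/

/-- The Lebesgue measure on `(0, π)`. -/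
abbrev arcMeasure : Measure ℝ := volume.restrict (Ioo (0 : ℝ) Real.pi)

lemma memLp_of_continuous {f : ℝ → ℂ} (hf : Continuous f) : MemLp f 2 arcMeasure := by
  obtain ⟨B, hB⟩ := (isCompact_Icc (a := (0 : ℝ)) (b := Real.pi)).exists_bound_of_continuousOn
    hf.continuousOn
  refine MemLp.of_bound hf.aestronglyMeasurable B ?_
  filter_upwards [ae_restrict_mem measurableSet_Ioo] with x hx using hB x (Ioo_subset_Icc_self hx)

/-- The element of `L²(0, π)` given by a continuous function. -/
def toArc (f : ℝ → ℂ) (hf : Continuous f) : ArcL2 := (memLp_of_continuous hf).toLp f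

lemma coeFn_toArc (f : ℝ → ℂ) (hf : Continuous f) : toArc f hf =ᵐ[arcMeasure] f :=
  MemLp.coeFn_toLp _

/-- The constant `2` bounds `√π`, the square root of the length of the half-circle, by way of `π <
4`. The same bound turns Cauchy–Schwarz into `integral_norm_arc_le`. -/
lemma norm_le_of_ae_bound {f : ArcL2} {M : ℝ} (hM : 0 ≤ M)
    (h : ∀ᵐ x ∂arcMeasure, ‖f x‖ ≤ M) : ‖f‖ ≤ 2 * M := by
  have h1 := Lp.norm_le_of_ae_bound hM h
  have h3 : (measureUnivNNReal arcMeasure : ℝ) = Real.pi := by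
    change (arcMeasure univ).toReal = Real.pi
    rw [Measure.restrict_apply_univ, Real.volume_Ioo, sub_zero,
      ENNReal.toReal_ofReal Real.pi_pos.le]
  have h4 : (measureUnivNNReal arcMeasure : ℝ) ^ ((2 : ENNReal).toReal⁻¹) ≤ 2 := by
    rw [h3]
    have e : (2 : ENNReal).toReal⁻¹ = 1 / 2 := by norm_num
    rw [e, ← Real.sqrt_eq_rpow]
    exact Real.sqrt_le_iff.2 ⟨by norm_num, by linarith [Real.pi_lt_four]⟩
  exact h1.trans (mul_le_mul_of_nonneg_right h4 hM)

/-- A function `v` with derivative `v₁` and weak second derivative `q`, multiplied by the gauge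
factor `e^{- i a x}`. -/
lemma exists_isH2_gauge (a : ℝ) {v v₁ q : ℝ → ℂ} (hv : ∀ x, HasDerivAt v (v₁ x) x)
    (hv₁ : Continuous v₁) (hq : MemLp q 2 arcMeasure)
    (hint : ∀ x ∈ Icc (0 : ℝ) Real.pi, v₁ x = v₁ 0 + ∫ t in (0 : ℝ)..x, q t) :
    ∃ (f w : ArcL2),
      f =ᵐ[arcMeasure] (fun x => gauge (-a) x * v x) ∧
      IsH2 f (fun x => gauge (-a) x * v x)
        (fun x => gauge (-a) x * (v₁ x - Complex.I * a * v x)) w ∧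
      ∀ᵐ x ∂arcMeasure, -(w x) - 2 * Complex.I * a * (gauge (-a) x * (v₁ x - Complex.I * a * v x))
        + (a : ℂ) ^ 2 * (gauge (-a) x * v x) = -(gauge (-a) x * q x) := by
  have hvc : Continuous v := continuous_iff_continuousAt.2 fun x => (hv x).continuousAt
  have hgc := continuous_gauge (-a)
  -- The weak second derivative of `e^{-iax} v` is `e^{-iax} (q - 2ia v' - a² v)`; its `L²` part and
  -- its continuous part are treated separately.
  have hW1 : MemLp (fun x => gauge (-a) x * q x) 2 arcMeasure := by
    refine hq.of_le (hgc.aestronglyMeasurable.mul hq.1) (Filter.Eventually.of_forall fun x => ?_)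
    rw [norm_mul, norm_gauge, one_mul]
  have hrc : Continuous fun x => gauge (-a) x * (-2 * Complex.I * a * v₁ x - (a : ℂ) ^ 2 * v x) := by
    fun_prop
  have hW2 := memLp_of_continuous hrc
  have hf := memLp_of_continuous (hgc.mul hvc)
  have hgd : ∀ x, HasDerivAt (gauge (-a)) (-(Complex.I * a) * gauge (-a) x) x := fun x => by
    simpa using hasDerivAt_gauge (-a) x
  have hd1 : ∀ x, HasDerivAt (fun x => gauge (-a) x * v x)
      (gauge (-a) x * (v₁ x - Complex.I * a * v x)) x := fun x => by
    convert! (hgd x).mul (hv x) using 1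
    ring
  have hw := MemLp.coeFn_toLp (hW1.add hW2)
  refine ⟨hf.toLp _, (hW1.add hW2).toLp _, hf.coeFn_toLp, ⟨hf.coeFn_toLp,
    fun x _ => (hd1 x).hasDerivWithinAt, ?_⟩, ?_⟩
  · intro x hx
    rw [ArcL2.integral_congr hw hx]
    have hqi : IntervalIntegrable q volume 0 x := by
      rw [intervalIntegrable_iff_integrableOn_Ioo_of_le hx.1]
      exact IntegrableOn.mono_set (hq.integrable (by norm_num)) (Ioo_subset_Ioo_right hx.2)
    have r1 := integral_mul_rule hgd (by fun_prop) hqi (v₁ 0)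
    rw [← hint x hx] at r1
    have r2 : gauge (-a) x * v x = gauge (-a) 0 * v 0 +
        ∫ t in (0 : ℝ)..x, gauge (-a) t * (v₁ t - Complex.I * a * v t) := by
      rw [intervalIntegral.integral_eq_sub_of_hasDerivAt (fun t _ => hd1 t)
        (Continuous.intervalIntegrable (by fun_prop) _ _)]
      ring
    have r3 : ∫ t in (0 : ℝ)..x, (-(Complex.I * a) * gauge (-a) t *
        (v₁ 0 + ∫ r in (0 : ℝ)..t, q r) + gauge (-a) t * q t) =
        ∫ t in (0 : ℝ)..x, (-(Complex.I * a) * gauge (-a) t * v₁ t + gauge (-a) t * q t) := by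
      apply intervalIntegral.integral_congr
      intro t ht
      rw [uIcc_of_le hx.1] at ht
      simp only
      rw [← hint t ⟨ht.1, ht.2.trans hx.2⟩]
    rw [r3] at r1
    have hgq : IntervalIntegrable (fun t => gauge (-a) t * q t) volume 0 x :=
      hqi.continuousOn_mul hgc.continuousOn
    have r4 : ∫ t in (0 : ℝ)..x, (((fun x => gauge (-a) x * q x) +
        (fun x => gauge (-a) x * (-2 * Complex.I * a * v₁ x - (a : ℂ) ^ 2 * v x)) : ℝ → ℂ) t) =
        (∫ t in (0 : ℝ)..x, (-(Complex.I * a) * gauge (-a) t * v₁ t + gauge (-a) t * q t)) -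
        Complex.I * a * ∫ t in (0 : ℝ)..x, gauge (-a) t * (v₁ t - Complex.I * a * v t) := by
      rw [← intervalIntegral.integral_const_mul, ← intervalIntegral.integral_sub
        ((Continuous.intervalIntegrable (by fun_prop) _ _).add hgq)
        (Continuous.intervalIntegrable (by fun_prop) _ _)]
      apply intervalIntegral.integral_congr
      intro t _
      simp only [Pi.add_apply]
      ring_nf
      rw [Complex.I_sq]
      ring
    rw [r4]
    simp only [gauge_zero, one_mul] at r1 r2 ⊢
    linear_combination r1 - Complex.I * a * r2
  · filter_upwards [hw] with x hx
    rw [hx]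
    simp only [Pi.add_apply]
    ring_nf
    rw [Complex.I_sq]
    ring

/-- `f = u` solves `(-𝒟² - z) u = h` on a half-circle with potential `a`. -/
structure ArcEq (a : ℝ) (z : ℂ) (f h : ArcL2) (u u' : ℝ → ℂ) (w : ArcL2) : Prop where
  sobolev : IsH2 f u u' w
  eqn : ∀ᵐ x ∂arcMeasure,
    h x = -(w x) - 2 * Complex.I * a * u' x + (a : ℂ) ^ 2 * u x - z * u x

lemma integral_norm_arc_le (h : ArcL2) : ∫ x, ‖h x‖ ∂arcMeasure ≤ 2 * ‖h‖ := by
  have hm : AEStronglyMeasurable h arcMeasure := Lp.aestronglyMeasurable h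
  have h1 := eLpNorm_le_eLpNorm_mul_rpow_measure_univ (μ := arcMeasure) (p := 1) (q := 2)
    (by norm_num) hm
  have h2 : arcMeasure univ = ENNReal.ofReal Real.pi := by
    rw [Measure.restrict_apply_univ, Real.volume_Ioo, sub_zero]
  have h3 : (∫ x, ‖h x‖ ∂arcMeasure) = (eLpNorm h 1 arcMeasure).toReal := by
    rw [integral_norm_eq_lintegral_enorm hm, eLpNorm_one_eq_lintegral_enorm]
  rw [h3, Lp.norm_def, mul_comm]
  have hfin : eLpNorm h 2 arcMeasure ≠ ⊤ := Lp.eLpNorm_ne_top h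
  have h4 : (1 / (1 : ENNReal).toReal - 1 / (2 : ENNReal).toReal) = 1 / 2 := by norm_num
  rw [h4, h2, ENNReal.ofReal_rpow_of_nonneg Real.pi_pos.le (by norm_num)] at h1
  have h5 := ENNReal.toReal_mono (ENNReal.mul_ne_top hfin ENNReal.ofReal_ne_top) h1
  rw [ENNReal.toReal_mul, ENNReal.toReal_ofReal (by positivity), ← Real.sqrt_eq_rpow] at h5
  refine h5.trans (mul_le_mul_of_nonneg_left ?_ ENNReal.toReal_nonneg)
  exact Real.sqrt_le_iff.2 ⟨by norm_num, by linarith [Real.pi_lt_four]⟩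

lemma exists_bound_sn_cs (k : ℂ) : ∃ K : ℝ, 1 ≤ K ∧ ∀ x ∈ Icc (0 : ℝ) Real.pi,
    ‖sn k x‖ ≤ K ∧ ‖cs k x‖ ≤ K := by
  obtain ⟨B₁, h₁⟩ := (isCompact_Icc (a := (0 : ℝ)) (b := Real.pi)).exists_bound_of_continuousOn
    (continuous_sn k).continuousOn
  obtain ⟨B₂, h₂⟩ := (isCompact_Icc (a := (0 : ℝ)) (b := Real.pi)).exists_bound_of_continuousOn
    (continuous_cs k).continuousOn
  refine ⟨max 1 (max B₁ B₂), le_max_left _ _, fun x hx => ⟨(h₁ x hx).trans ?_, (h₂ x hx).trans ?_⟩⟩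
  · exact (le_max_left _ _).trans (le_max_right _ _)
  · exact (le_max_right _ _).trans (le_max_right _ _)

/-- Variation of constants: the solution of `-p'' - k² p = H` with `p 0 = p' 0 = 0`. -/
lemma exists_particular_solution (k : ℂ) : ∃ M : ℝ, 0 ≤ M ∧ ∀ H : ℝ → ℂ, Integrable H →
    ∃ p p₁ : ℝ → ℂ, (∀ x, HasDerivAt p (p₁ x) x) ∧ Continuous p₁ ∧ p 0 = 0 ∧ p₁ 0 = 0 ∧
      (∀ x, p₁ x = ∫ t in (0 : ℝ)..x, (-k ^ 2 * p t - H t)) ∧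
      ∀ x ∈ Icc (0 : ℝ) Real.pi, ‖p x‖ ≤ M * ∫ t, ‖H t‖ ∧ ‖p₁ x‖ ≤ M * ∫ t, ‖H t‖ := by
  obtain ⟨K, hK1, hK⟩ := exists_bound_sn_cs k
  -- With `N` the integral of `‖H‖`, the bounds are `2K²N` for `p` and `(‖k‖² + 1)K²N` for `p₁`;
  -- this constant dominates both.
  refine ⟨2 * (1 + ‖k‖ ^ 2) * K ^ 2, by positivity, fun H hH => ?_⟩
  have hHi : ∀ x y, IntervalIntegrable H volume x y := fun x y => hH.intervalIntegrable
  have hs : ∀ x y, IntervalIntegrable (fun t => sn k t * H t) volume x y := fun x y =>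
    (hHi x y).continuousOn_mul (continuous_sn k).continuousOn
  have hc : ∀ x y, IntervalIntegrable (fun t => cs k t * H t) volume x y := fun x y =>
    (hHi x y).continuousOn_mul (continuous_cs k).continuousOn
  set Sh : ℝ → ℂ := fun x => ∫ t in (0 : ℝ)..x, sn k t * H t with hSh
  set Ch : ℝ → ℂ := fun x => ∫ t in (0 : ℝ)..x, cs k t * H t with hCh
  have cSh : Continuous Sh := intervalIntegral.continuous_primitive hs 0
  have cCh : Continuous Ch := intervalIntegral.continuous_primitive hc 0
  have csn := continuous_sn k
  have ccs := continuous_cs k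
  have cont' : Continuous fun x => -k ^ 2 * sn k x := by fun_prop
  have e1 : ∀ x, cs k x * Sh x =
      ∫ t in (0 : ℝ)..x, (-k ^ 2 * sn k t * Sh t + cs k t * (sn k t * H t)) := fun x => by
    simpa using integral_mul_rule (hasDerivAt_cs k) cont' (hs 0 x) 0
  have e2 : ∀ x, sn k x * Ch x =
      ∫ t in (0 : ℝ)..x, (cs k t * Ch t + sn k t * (cs k t * H t)) := fun x => by
    simpa using integral_mul_rule (hasDerivAt_sn k) ccs (hc 0 x) 0
  have e3 : ∀ x, sn k x * Sh x =
      ∫ t in (0 : ℝ)..x, (cs k t * Sh t + sn k t * (sn k t * H t)) := fun x => by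
    simpa using integral_mul_rule (hasDerivAt_sn k) ccs (hs 0 x) 0
  have e4 : ∀ x, cs k x * Ch x =
      ∫ t in (0 : ℝ)..x, (-k ^ 2 * sn k t * Ch t + cs k t * (cs k t * H t)) := fun x => by
    simpa using integral_mul_rule (hasDerivAt_cs k) cont' (hc 0 x) 0
  have ii : ∀ {φ φ' W v : ℝ → ℂ} (x : ℝ), Continuous φ → Continuous φ' → Continuous W →
      (∀ x y, IntervalIntegrable v volume x y) →
      IntervalIntegrable (fun t => φ' t * W t + φ t * v t) volume 0 x := fun x h1 h2 h3 h4 =>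
    ((h2.mul h3).intervalIntegrable _ _).add ((h4 0 x).continuousOn_mul h1.continuousOn)
  -- Duhamel's formula `p(x) = -∫₀ˣ sn(x - t) H(t) dt`, expanded by the addition theorem for `sn`.
  set p : ℝ → ℂ := fun x => cs k x * Sh x - sn k x * Ch x with hp
  set p₁ : ℝ → ℂ := fun x => -k ^ 2 * (sn k x * Sh x) - cs k x * Ch x with hp₁
  have cp₁ : Continuous p₁ := by fun_prop
  have f1 : ∀ x, p x = ∫ t in (0 : ℝ)..x, p₁ t := fun x => by
    rw [hp]
    simp only
    rw [e1, e2, ← intervalIntegral.integral_sub (ii x ccs cont' cSh hs) (ii x csn ccs cCh hc)]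
    apply intervalIntegral.integral_congr
    intro t _
    simp only [hp₁]
    ring
  have f2 : ∀ x, p₁ x = ∫ t in (0 : ℝ)..x, (-k ^ 2 * p t - H t) := fun x => by
    rw [hp₁]
    simp only
    rw [e3, e4, ← intervalIntegral.integral_const_mul, ← intervalIntegral.integral_sub
      ((ii x csn ccs cSh hs).const_mul _) (ii x ccs cont' cCh hc)]
    apply intervalIntegral.integral_congr
    intro t _
    simp only [hp]
    linear_combination -(H t) * cs_sq_add k t
  have hI0 : 0 ≤ ∫ t, ‖H t‖ := integral_nonneg fun _ => norm_nonneg _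
  have bd : ∀ φ : ℝ → ℂ, (∀ x ∈ Icc (0 : ℝ) Real.pi, ‖φ x‖ ≤ K) → ∀ x ∈ Icc (0 : ℝ) Real.pi,
      ‖∫ t in (0 : ℝ)..x, φ t * H t‖ ≤ K * ∫ t, ‖H t‖ := fun φ hφ x hx => by
    rw [intervalIntegral.integral_of_le hx.1, ← integral_const_mul]
    refine (norm_integral_le_of_norm_le (hH.norm.const_mul K).integrableOn ?_).trans
      (setIntegral_le_integral (hH.norm.const_mul K)
        (Filter.Eventually.of_forall fun t => by positivity))
    filter_upwards [ae_restrict_mem measurableSet_Ioc] with t ht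
    rw [norm_mul]
    exact mul_le_mul_of_nonneg_right (hφ t ⟨ht.1.le, ht.2.trans hx.2⟩) (norm_nonneg _)
  refine ⟨p, p₁, fun x => ?_, cp₁, by simp [hp, hSh], by simp [hp₁, hCh], f2, fun x hx => ?_⟩
  · have : p = fun x => ∫ t in (0 : ℝ)..x, p₁ t := funext f1
    rw [this]
    exact (cp₁.integral_hasStrictDerivAt 0 x).hasDerivAt
  · have b1 := bd _ (fun x hx => (hK x hx).1) x hx
    have b2 := bd _ (fun x hx => (hK x hx).2) x hx
    have b3 := hK x hx
    set N := ∫ t, ‖H t‖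
    have m1 : ‖sn k x * Sh x‖ ≤ K ^ 2 * N := by
      rw [norm_mul]
      calc _ ≤ K * (K * N) := mul_le_mul b3.1 b1 (norm_nonneg _) (by positivity)
        _ = _ := by ring
    have m2 : ‖cs k x * Sh x‖ ≤ K ^ 2 * N := by
      rw [norm_mul]
      calc _ ≤ K * (K * N) := mul_le_mul b3.2 b1 (norm_nonneg _) (by positivity)
        _ = _ := by ring
    have m3 : ‖sn k x * Ch x‖ ≤ K ^ 2 * N := by
      rw [norm_mul]
      calc _ ≤ K * (K * N) := mul_le_mul b3.1 b2 (norm_nonneg _) (by positivity)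
        _ = _ := by ring
    have m4 : ‖cs k x * Ch x‖ ≤ K ^ 2 * N := by
      rw [norm_mul]
      calc _ ≤ K * (K * N) := mul_le_mul b3.2 b2 (norm_nonneg _) (by positivity)
        _ = _ := by ring
    have hKN : 0 ≤ K ^ 2 * N := by positivity
    constructor
    · calc ‖p x‖ ≤ K ^ 2 * N + K ^ 2 * N := (norm_sub_le _ _).trans (add_le_add m2 m3)
        _ ≤ _ := by nlinarith [mul_nonneg (sq_nonneg ‖k‖) hKN]
    · calc ‖p₁ x‖ ≤ ‖k‖ ^ 2 * (K ^ 2 * N) + K ^ 2 * N := by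
            refine (norm_sub_le _ _).trans (add_le_add ?_ m4)
            rw [norm_mul, norm_neg, norm_pow]
            exact mul_le_mul_of_nonneg_left m1 (by positivity)
        _ ≤ _ := by nlinarith [mul_nonneg (sq_nonneg ‖k‖) hKN]

/-- The boundary value problem on a half-circle, with the boundary values of the quasiderivative. -/
theorem exists_arc_solution (k : ℂ) (hS : sn k Real.pi ≠ 0) :
    ∃ M : ℝ, 0 ≤ M ∧ ∀ (a : ℝ) (h : ArcL2), ∃ e₀ e₁ : ℂ, ‖e₀‖ ≤ M * ‖h‖ ∧ ‖e₁‖ ≤ M * ‖h‖ ∧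
      ∀ y₀ y₁ : ℂ, ∃ f u u' w, ArcEq a (k ^ 2) f h u u' w ∧ u 0 = y₀ ∧ u Real.pi = y₁ ∧
      quasiDeriv a u u' 0 = (gauge a Real.pi * y₁ - y₀ * cs k Real.pi) / sn k Real.pi + e₀ ∧
      quasiDeriv a u u' Real.pi =
        (y₁ * cs k Real.pi - gauge (-a) Real.pi * y₀) / sn k Real.pi + e₁ ∧
      ‖f‖ ≤ M * (‖y₀‖ + ‖y₁‖ + ‖h‖) := by
  obtain ⟨K, hK1, hK⟩ := exists_bound_sn_cs k
  obtain ⟨M, hM, hpart⟩ := exists_particular_solution k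
  have hpi : Real.pi ∈ Icc (0 : ℝ) Real.pi := ⟨Real.pi_pos.le, le_rfl⟩
  set S := sn k Real.pi with hSdef
  set C := cs k Real.pi with hCdef
  have hSn : 0 < ‖S‖ := norm_pos_iff.2 hS
  set T := 2 * M with hT
  have hT0 : 0 ≤ T := by positivity
  set Q := K * ‖S‖⁻¹ with hQ
  have hQ0 : 0 ≤ Q := by positivity
  have hC : ‖C‖ ≤ K := (hK _ hpi).2
  have hQ1 : ‖S‖⁻¹ ≤ Q := by
    rw [hQ]; exact le_mul_of_one_le_left (by positivity) hK1
  refine ⟨2 * (K + K * Q + T + T * Q * K) + (T + T * Q), by positivity, fun a h => ?_⟩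
  -- With `v = e^{iax} u` the equation becomes `-v'' - k² v = e^{iax} h`; its right side is extended
  -- by zero to the whole line.
  set H : ℝ → ℂ := (Ioo (0 : ℝ) Real.pi).indicator (fun t => gauge a t * h t) with hH
  have hgc := continuous_gauge a
  have hL2 : MemLp (fun t => gauge a t * h t) 2 arcMeasure := by
    refine (Lp.memLp h).of_le (hgc.aestronglyMeasurable.mul (Lp.aestronglyMeasurable h))
      (Filter.Eventually.of_forall fun x => ?_)
    rw [norm_mul, norm_gauge, one_mul]
  have hHae : H =ᵐ[arcMeasure] fun t => gauge a t * h t := by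
    filter_upwards [ae_restrict_mem measurableSet_Ioo] with x hx
    rw [hH, indicator_of_mem hx]
  have hHL2 : MemLp H 2 arcMeasure := hL2.ae_eq hHae.symm
  have hHint : Integrable H := by
    rw [hH, integrable_indicator_iff measurableSet_Ioo]
    exact hL2.integrable (by norm_num)
  have hHnorm : ∫ t, ‖H t‖ ≤ 2 * ‖h‖ := by
    have e : (fun t => ‖H t‖) = (Ioo (0 : ℝ) Real.pi).indicator (fun t => ‖h t‖) := by
      funext t
      rw [hH, norm_indicator_eq_indicator_norm]
      simp
    rw [e, integral_indicator measurableSet_Ioo]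
    exact integral_norm_arc_le h
  obtain ⟨p, p₁, hpd, hp₁c, hp0, hp₁0, hp₁i, hpb⟩ := hpart H hHint
  have hpb' : ∀ x ∈ Icc (0 : ℝ) Real.pi, ‖p x‖ ≤ T * ‖h‖ ∧ ‖p₁ x‖ ≤ T * ‖h‖ := fun x hx => by
    have e : M * ∫ t, ‖H t‖ ≤ T * ‖h‖ := by
      calc _ ≤ M * (2 * ‖h‖) := mul_le_mul_of_nonneg_left hHnorm hM
        _ = _ := by rw [hT]; ring
    exact ⟨(hpb x hx).1.trans e, (hpb x hx).2.trans e⟩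
  have hppi := hpb' Real.pi hpi
  -- These are the contributions of the particular solution to the two boundary quasiderivatives.
  -- They do not involve `y₀` and `y₁`, so the boundary data are affine in the vertex values.
  refine ⟨-(p Real.pi / S), gauge (-a) Real.pi * (p₁ Real.pi - p Real.pi / S * C), ?_, ?_,
    fun y₀ y₁ => ?_⟩
  · rw [norm_neg, norm_div, div_eq_mul_inv]
    calc ‖p Real.pi‖ * ‖S‖⁻¹ ≤ (T * ‖h‖) * Q := mul_le_mul hppi.1 hQ1 (by positivity) (by positivity)
      _ = T * Q * ‖h‖ := by ring
      _ ≤ _ := by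
        apply mul_le_mul_of_nonneg_right _ (norm_nonneg h)
        have : 0 ≤ K * Q := by positivity
        nlinarith
  · rw [norm_mul, norm_gauge, one_mul]
    have n1 : ‖p Real.pi / S * C‖ ≤ T * Q * K * ‖h‖ := by
      rw [norm_mul, norm_div, div_eq_mul_inv]
      calc ‖p Real.pi‖ * ‖S‖⁻¹ * ‖C‖ ≤ (T * ‖h‖) * Q * K := by gcongr; exact hppi.1
        _ = _ := by ring
    refine ((norm_sub_le _ _).trans (add_le_add hppi.2 n1)).trans ?_
    rw [← add_mul]
    apply mul_le_mul_of_nonneg_right _ (norm_nonneg h)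
    have : 0 ≤ K * Q := by positivity
    have : 0 ≤ T * Q := by positivity
    nlinarith
  -- Chosen so that `v π = e^{iaπ} y₁`; this is where `sn k π ≠ 0` is needed.
  set B : ℂ := (gauge a Real.pi * y₁ - p Real.pi - y₀ * C) / S with hB
  set v : ℝ → ℂ := fun x => p x + y₀ * cs k x + B * sn k x with hv
  set v₁ : ℝ → ℂ := fun x => p₁ x + y₀ * (-k ^ 2 * sn k x) + B * cs k x with hv₁
  have hpc : Continuous p := continuous_iff_continuousAt.2 fun x => (hpd x).continuousAt
  have csn := continuous_sn k
  have ccs := continuous_cs k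
  have hvd : ∀ x, HasDerivAt v (v₁ x) x := fun x =>
    ((hpd x).add ((hasDerivAt_cs k x).const_mul y₀)).add ((hasDerivAt_sn k x).const_mul B)
  have hv₁c : Continuous v₁ := by fun_prop
  have hvc : Continuous v := by fun_prop
  have hq : MemLp (fun t => -k ^ 2 * v t - H t) 2 arcMeasure :=
    (memLp_of_continuous (by fun_prop)).sub hHL2
  have hint : ∀ x ∈ Icc (0 : ℝ) Real.pi,
      v₁ x = v₁ 0 + ∫ t in (0 : ℝ)..x, (-k ^ 2 * v t - H t) := fun x _ => by
    have s1 : ∀ t, HasDerivAt (fun x => y₀ * (-k ^ 2 * sn k x) + B * cs k x)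
        (-k ^ 2 * (y₀ * cs k t + B * sn k t)) t := fun t => by
      convert! (((hasDerivAt_sn k t).const_mul (-k ^ 2)).const_mul y₀).add
        ((hasDerivAt_cs k t).const_mul B) using 1
      ring
    have s2 := intervalIntegral.integral_eq_sub_of_hasDerivAt (a := 0) (b := x) (fun t _ => s1 t)
      (Continuous.intervalIntegrable (by fun_prop) _ _)
    have s3 : ∫ t in (0 : ℝ)..x, (-k ^ 2 * v t - H t) =
        (∫ t in (0 : ℝ)..x, (-k ^ 2 * p t - H t)) +
        ∫ t in (0 : ℝ)..x, -k ^ 2 * (y₀ * cs k t + B * sn k t) := by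
      rw [← intervalIntegral.integral_add
        ((Continuous.intervalIntegrable (by fun_prop) _ _).sub hHint.intervalIntegrable)
        (Continuous.intervalIntegrable (by fun_prop) _ _)]
      apply intervalIntegral.integral_congr
      intro t _
      simp only [hv]
      ring
    rw [s3, s2, ← hp₁i]
    simp only [hv₁, hp₁0, sn_zero, cs_zero]
    ring
  obtain ⟨f, w, hf, hH2, hact⟩ := exists_isH2_gauge a hvd hv₁c hq hint
  have hv0 : v 0 = y₀ := by simp [hv, hp0]
  have hvpi : v Real.pi = gauge a Real.pi * y₁ := by
    simp only [hv, hB, ← hSdef, ← hCdef]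
    field_simp
    ring
  have hgg := gauge_mul_gauge_neg a Real.pi
  have hBn : ‖B‖ ≤ Q * (‖y₀‖ + ‖y₁‖ + T * ‖h‖) := by
    rw [hB, norm_div, div_eq_mul_inv, hQ]
    have n1 : ‖gauge a Real.pi * y₁ - p Real.pi - y₀ * C‖ ≤ ‖y₁‖ + T * ‖h‖ + ‖y₀‖ * K := by
      refine (norm_sub_le _ _).trans (add_le_add ((norm_sub_le _ _).trans (add_le_add ?_ hppi.1)) ?_)
      · simp
      · rw [norm_mul]; gcongr
    have n2 : ‖y₁‖ + T * ‖h‖ + ‖y₀‖ * K ≤ K * (‖y₀‖ + ‖y₁‖ + T * ‖h‖) := by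
      nlinarith [mul_nonneg (sub_nonneg.2 hK1)
        (add_nonneg (norm_nonneg y₁) (mul_nonneg hT0 (norm_nonneg h)))]
    calc _ ≤ (K * (‖y₀‖ + ‖y₁‖ + T * ‖h‖)) * ‖S‖⁻¹ :=
          mul_le_mul_of_nonneg_right (n1.trans n2) (by positivity)
      _ = _ := by ring
  have hTQK : 0 ≤ T * Q * K := by positivity
  refine ⟨f, _, _, w, ⟨hH2, ?_⟩, ?_, ?_, ?_, ?_, ?_⟩
  · filter_upwards [hact, hHae] with x hx1 hx2
    rw [hx1, hx2]
    linear_combination -(h x) * gauge_mul_gauge_neg a x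
  · simp [hv0]
  · simp only [hvpi]
    linear_combination y₁ * hgg
  · simp only [quasiDeriv, hv₁, hp₁0, gauge_zero, sn_zero, cs_zero, hB]
    field_simp
    ring
  · have e2 := cs_sq_add k Real.pi
    rw [← hSdef, ← hCdef] at e2
    simp only [quasiDeriv, hv₁, hB, ← hSdef, ← hCdef]
    field_simp
    linear_combination (-(gauge (-a) Real.pi) * y₀) * e2 + y₁ * C * hgg
  · set N := ‖y₀‖ + ‖y₁‖ + ‖h‖ with hN
    have hyN : ‖y₀‖ ≤ N := by rw [hN]; linarith [norm_nonneg y₁, norm_nonneg h]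
    have hhN : ‖h‖ ≤ N := by rw [hN]; linarith [norm_nonneg y₁, norm_nonneg y₀]
    have hyyN : ‖y₀‖ + ‖y₁‖ ≤ N := by rw [hN]; linarith [norm_nonneg h]
    have hN0 : 0 ≤ N := by positivity
    have hb : ∀ x ∈ Icc (0 : ℝ) Real.pi, ‖v x‖ ≤ (K + K * Q + T + T * Q * K) * N := fun x hx => by
      have n1 := (hpb' x hx).1
      have n2 : ‖y₀ * cs k x‖ ≤ N * K := by
        rw [norm_mul]; exact mul_le_mul hyN (hK x hx).2 (norm_nonneg _) hN0
      have n3 : ‖B * sn k x‖ ≤ (Q * (N + T * N)) * K := by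
        rw [norm_mul]
        refine mul_le_mul (hBn.trans ?_) (hK x hx).1 (norm_nonneg _) (by positivity)
        gcongr
      calc ‖v x‖ ≤ T * N + N * K + (Q * (N + T * N)) * K :=
            (norm_add_le _ _).trans (add_le_add ((norm_add_le _ _).trans (add_le_add
              (n1.trans (by gcongr)) n2)) n3)
        _ = _ := by ring
    have hf2 := norm_le_of_ae_bound (f := f) (M := (K + K * Q + T + T * Q * K) * N)
      (by positivity) (by
        filter_upwards [hf, ae_restrict_mem measurableSet_Ioo] with x hx hxm
        rw [hx, norm_mul, norm_gauge, one_mul]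
        exact hb x (Ioo_subset_Icc_self hxm))
    calc ‖f‖ ≤ 2 * ((K + K * Q + T + T * Q * K) * N) := hf2
      _ ≤ _ := by
        have : 0 ≤ (T + T * Q) * N := by positivity
        linarith

lemma IsH2.continuousOn {f w : ArcL2} {u u' : ℝ → ℂ} (h : IsH2 f u u' w) :
    ContinuousOn u (Icc 0 Real.pi) := fun x hx => (h.deriv x hx).continuousWithinAt

lemma IsH2.continuousOn_deriv {f w : ArcL2} {u u' : ℝ → ℂ} (h : IsH2 f u u' w) :
    ContinuousOn u' (Icc 0 Real.pi) := by
  have h1 : ContinuousOn (fun x => u' 0 + ∫ t in (0 : ℝ)..x, w t) (Icc 0 Real.pi) := by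
    have := intervalIntegral.continuousOn_primitive_interval'
      (w.intervalIntegrable (x := Real.pi) ⟨Real.pi_pos.le, le_rfl⟩) (by simp : (0 : ℝ) ∈ _)
    rw [uIcc_of_le Real.pi_pos.le] at this
    exact continuousOn_const.add this
  exact h1.congr fun x hx => h.deriv₂ x hx

/-- A solution of the homogeneous equation is determined by its initial values. -/
theorem ArcEq.eq_fundamental {a : ℝ} {k : ℂ} {f w : ArcL2} {u u' : ℝ → ℂ}
    (h : ArcEq a (k ^ 2) f 0 u u' w) : ∀ x ∈ Icc (0 : ℝ) Real.pi,
      gauge a x * u x = u 0 * cs k x + quasiDeriv a u u' 0 * sn k x ∧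
      gauge a x * quasiDeriv a u u' x =
        -k ^ 2 * (u 0 * sn k x) + quasiDeriv a u u' 0 * cs k x := by
  have hu := h.sobolev.continuousOn
  have hu' := h.sobolev.continuousOn_deriv
  set G : ℝ → ℂ := fun x => -2 * Complex.I * a * u' x + ((a : ℂ) ^ 2 - k ^ 2) * u x with hG
  have hGc : ContinuousOn G (Icc 0 Real.pi) := by fun_prop
  -- The equation identifies the weak second derivative almost everywhere with the continuous `G`. A
  -- continuous extension of `G` to the line makes `u'` differentiable at every point of the closed
  -- interval, including its ends.
  set E : ℝ → ℂ := IccExtend Real.pi_pos.le ((Icc (0 : ℝ) Real.pi).domRestrict G) with hE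
  have hEc : Continuous E := (continuousOn_iff_continuous_domRestrict.1 hGc).Icc_extend'
  have hEG : ∀ x ∈ Icc (0 : ℝ) Real.pi, E x = G x := fun x hx => by
    rw [hE, IccExtend_of_mem _ _ hx, domRestrict_apply]
  have hwE : ∀ᵐ x ∂arcMeasure, w x = E x := by
    filter_upwards [h.eqn, ae_restrict_mem measurableSet_Ioo, Lp.coeFn_zero ℂ 2 arcMeasure]
      with x e hx e0
    rw [e0] at e
    rw [hEG x (Ioo_subset_Icc_self hx), hG]
    simp only [Pi.zero_apply] at e ⊢
    linear_combination e
  have hd2 : ∀ x ∈ Icc (0 : ℝ) Real.pi, HasDerivWithinAt u' (G x) (Icc 0 Real.pi) x := by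
    intro x hx
    have h1 : HasDerivAt (fun x => u' 0 + ∫ t in (0 : ℝ)..x, E t) (E x) x :=
      (hEc.integral_hasStrictDerivAt 0 x).hasDerivAt.const_add _
    rw [← hEG x hx]
    refine h1.hasDerivWithinAt.congr (fun y hy => ?_) ?_
    · rw [h.sobolev.deriv₂ y hy, ArcL2.integral_congr hwE hy]
    · rw [h.sobolev.deriv₂ x hx, ArcL2.integral_congr hwE hx]
  set v : ℝ → ℂ := fun x => gauge a x * u x with hv
  set v₁ : ℝ → ℂ := fun x => gauge a x * quasiDeriv a u u' x with hv₁
  have dv : ∀ x ∈ Icc (0 : ℝ) Real.pi, HasDerivWithinAt v (v₁ x) (Icc 0 Real.pi) x := fun x hx => by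
    convert! (hasDerivAt_gauge a x).hasDerivWithinAt.mul (h.sobolev.deriv x hx) using 1
    simp only [hv₁, quasiDeriv]
    ring
  have dv₁ : ∀ x ∈ Icc (0 : ℝ) Real.pi,
      HasDerivWithinAt v₁ (-k ^ 2 * v x) (Icc 0 Real.pi) x := fun x hx => by
    convert! (hasDerivAt_gauge a x).hasDerivWithinAt.mul ((hd2 x hx).add
      ((h.sobolev.deriv x hx).const_mul (Complex.I * a))) using 1
    simp only [hv, hG, Pi.add_apply]
    ring_nf
    rw [Complex.I_sq]
    ring
  have const : ∀ φ : ℝ → ℂ, (∀ x ∈ Icc (0 : ℝ) Real.pi,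
      HasDerivWithinAt φ 0 (Icc 0 Real.pi) x) → ∀ x ∈ Icc (0 : ℝ) Real.pi, φ x = φ 0 := by
    intro φ hφ
    refine constant_of_has_deriv_right_zero (fun x hx => (hφ x hx).continuousWithinAt)
      fun x hx => ?_
    exact (hφ x (Ico_subset_Icc_self hx)).mono_of_mem_nhdsWithin (Icc_mem_nhdsGE_of_mem hx)
  -- The Wronskians of `v` with `sn` and `cs` are constant; since `cs² + k² sn² = 1`, the pair can
  -- be solved for `v` and `v₁`.
  have c1 := const (fun x => cs k x * v x - sn k x * v₁ x) fun x hx => by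
    convert! ((hasDerivAt_cs k x).hasDerivWithinAt.mul (dv x hx)).sub
      ((hasDerivAt_sn k x).hasDerivWithinAt.mul (dv₁ x hx)) using 1
    ring
  have c2 := const (fun x => k ^ 2 * (sn k x * v x) + cs k x * v₁ x) fun x hx => by
    convert! (((hasDerivAt_sn k x).hasDerivWithinAt.mul (dv x hx)).const_mul (k ^ 2)).add
      ((hasDerivAt_cs k x).hasDerivWithinAt.mul (dv₁ x hx)) using 1
    ring
  intro x hx
  have d1 := c1 x hx
  have d2 := c2 x hx
  have e := cs_sq_add k x
  have v0 : v 0 = u 0 := by simp [hv]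
  have v10 : v₁ 0 = quasiDeriv a u u' 0 := by simp [hv₁]
  simp only [sn_zero, cs_zero, v0, v10, one_mul, zero_mul, sub_zero, mul_zero, zero_add] at d1 d2
  change v x = _ ∧ v₁ x = _
  constructor
  · linear_combination cs k x * d1 + sn k x * d2 - v x * e
  · linear_combination -k ^ 2 * sn k x * d1 + cs k x * d2 - v₁ x * e

/-- The boundary values of the quasiderivative in terms of those of the function. -/
lemma ArcEq.quasiDeriv_eq {a : ℝ} {k : ℂ} (hS : sn k Real.pi ≠ 0) {f w : ArcL2} {u u' : ℝ → ℂ}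
    (h : ArcEq a (k ^ 2) f 0 u u' w) :
    quasiDeriv a u u' 0 =
      (gauge a Real.pi * u Real.pi - u 0 * cs k Real.pi) / sn k Real.pi ∧
    quasiDeriv a u u' Real.pi =
      (u Real.pi * cs k Real.pi - gauge (-a) Real.pi * u 0) / sn k Real.pi := by
  obtain ⟨e1, e2⟩ := h.eq_fundamental Real.pi ⟨Real.pi_pos.le, le_rfl⟩
  have e := cs_sq_add k Real.pi
  have hg := gauge_mul_gauge_neg a Real.pi
  have d1 : quasiDeriv a u u' 0 =
      (gauge a Real.pi * u Real.pi - u 0 * cs k Real.pi) / sn k Real.pi := by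
    rw [eq_div_iff hS]
    linear_combination -e1
  refine ⟨d1, ?_⟩
  rw [eq_div_iff hS]
  apply mul_left_cancel₀ (gauge_ne_zero a Real.pi)
  linear_combination sn k Real.pi * e2 - cs k Real.pi * e1 + u 0 * hg - u 0 * e

/-- A solution of the homogeneous equation with vanishing boundary values vanishes. -/
lemma ArcEq.eq_zero {a : ℝ} {k : ℂ} (hS : sn k Real.pi ≠ 0) {f w : ArcL2} {u u' : ℝ → ℂ}
    (h : ArcEq a (k ^ 2) f 0 u u' w) (h0 : u 0 = 0) (h1 : u Real.pi = 0) : f = 0 := by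
  have d := (h.quasiDeriv_eq hS).1
  rw [h0, h1] at d
  rw [Lp.eq_zero_iff_ae_eq_zero]
  filter_upwards [h.sobolev.repr, ae_restrict_mem measurableSet_Ioo] with x e hx
  have e1 := (h.eq_fundamental x (Ioo_subset_Icc_self hx)).1
  rw [d, h0] at e1
  rw [e, Pi.zero_apply]
  apply (mul_eq_zero.1 (e1.trans _)).resolve_left (gauge_ne_zero a x)
  simp

/-- The boundary values of a solution of the homogeneous equation are bounded by its norm. -/
lemma exists_trace_bound (k : ℂ) (hS : sn k Real.pi ≠ 0) : ∃ K : ℝ, 0 ≤ K ∧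
    ∀ (a : ℝ) (f w : ArcL2) (u u' : ℝ → ℂ), ArcEq a (k ^ 2) f 0 u u' w → ‖u 0‖ ≤ K * ‖f‖ := by
  have csn := continuous_sn k
  have ccs := continuous_cs k
  let L : ℂ × ℂ →ₗ[ℂ] ArcL2 :=
    { toFun := fun p => p.1 • toArc (cs k) ccs + p.2 • toArc (sn k) csn
      map_add' := fun p q => by simp only [Prod.fst_add, Prod.snd_add, add_smul]; abel
      map_smul' := fun c p => by
        simp only [Prod.smul_fst, Prod.smul_snd, smul_eq_mul, mul_smul, smul_add, RingHom.id_apply] }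
  have hL : ∀ p, L p =ᵐ[arcMeasure] fun x => p.1 * cs k x + p.2 * sn k x := fun p => by
    have e : L p = p.1 • toArc (cs k) ccs + p.2 • toArc (sn k) csn := rfl
    rw [e]
    filter_upwards [Lp.coeFn_add (p.1 • toArc (cs k) ccs) (p.2 • toArc (sn k) csn),
      Lp.coeFn_smul p.1 (toArc (cs k) ccs), Lp.coeFn_smul p.2 (toArc (sn k) csn),
      coeFn_toArc _ ccs, coeFn_toArc _ csn] with x e1 e2 e3 e4 e5
    rw [e1, Pi.add_apply, e2, e3, Pi.smul_apply, Pi.smul_apply, e4, e5, smul_eq_mul, smul_eq_mul]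
  have hker : LinearMap.ker L = ⊥ := by
    rw [LinearMap.ker_eq_bot']
    intro p hp
    have h0 : (fun x => p.1 * cs k x + p.2 * sn k x) =ᵐ[arcMeasure] fun _ => (0 : ℂ) := by
      filter_upwards [hL p, Lp.coeFn_zero ℂ 2 arcMeasure] with x e1 e2
      rw [← e1, hp, e2, Pi.zero_apply]
    rw [arcMeasure, restrict_Ioo_eq_restrict_Icc] at h0
    have h1 := Measure.eqOn_Icc_of_ae_eq volume Real.pi_pos.ne h0 (by fun_prop) continuousOn_const
    have h2 := h1 (⟨le_rfl, Real.pi_pos.le⟩ : (0 : ℝ) ∈ Icc 0 Real.pi)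
    have h3 := h1 (⟨Real.pi_pos.le, le_rfl⟩ : Real.pi ∈ Icc 0 Real.pi)
    simp only [sn_zero, cs_zero, mul_one, mul_zero, add_zero] at h2
    simp only [h2, zero_mul, zero_add] at h3
    exact Prod.ext h2 ((mul_eq_zero.1 h3).resolve_right hS)
  -- The solution space is two-dimensional, so an injective map out of it is bounded below. The
  -- constant does not depend on `a`, because the gauge factor has modulus one.
  obtain ⟨K, -, hK⟩ := L.exists_antilipschitzWith hker
  refine ⟨K, K.2, fun a f w u u' h => ?_⟩
  have b1 := hK.le_mul_dist (u 0, quasiDeriv a u u' 0) 0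
  rw [map_zero, dist_zero_right, dist_zero_right] at b1
  have b2 : ‖L (u 0, quasiDeriv a u u' 0)‖ ≤ ‖f‖ := by
    apply Lp.norm_le_norm_of_ae_le
    filter_upwards [hL (u 0, quasiDeriv a u u' 0), h.sobolev.repr,
      ae_restrict_mem measurableSet_Ioo] with x e1 e2 hx
    rw [e1, e2, ← (h.eq_fundamental x (Ioo_subset_Icc_self hx)).1, norm_mul, norm_gauge, one_mul]
  exact (norm_fst_le (u 0, quasiDeriv a u u' 0)).trans
    (b1.trans (mul_le_mul_of_nonneg_left b2 K.2))

end RingChain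

/-! ### A criterion for membership in the resolvent set -/

namespace UnboundedOp

variable {H : Type*} [NormedAddCommGroup H] [NormedSpace ℂ H]

/-- A point at which `T - z` is injective and onto, with a bounded solution operator, belongs to
the resolvent set. -/
lemma mem_resolventSet_of_bounded_solution (T : H →ₗ.[ℂ] H) (z : ℂ) (M : ℝ)
    (hsurj : ∀ h : H, ∃ f : T.domain, T f - z • (f : H) = h ∧ ‖(f : H)‖ ≤ M * ‖h‖)
    (hinj : ∀ f : T.domain, T f - z • (f : H) = 0 → f = 0) : z ∈ resolventSet T := by
  have huniq : ∀ f g : T.domain, T f - z • (f : H) = T g - z • (g : H) → f = g := fun f g h => by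
    rw [← sub_eq_zero]
    apply hinj
    rw [T.map_sub, Submodule.coe_sub, smul_sub]
    linear_combination (norm := module) h
  choose r hr hrb using hsurj
  -- Solutions are picked arbitrarily; injectivity of `T - z` makes the choice linear.
  let R : H →ₗ[ℂ] H :=
    { toFun := fun h => (r h : H)
      map_add' := fun h₁ h₂ => by
        rw [← Submodule.coe_add]
        congr 1
        apply huniq
        rw [hr, T.map_add, Submodule.coe_add, smul_add]
        linear_combination (norm := module) -(1 : ℂ) • hr h₁ - (1 : ℂ) • hr h₂
      map_smul' := fun c h => by
        rw [RingHom.id_apply, ← Submodule.coe_smul]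
        congr 1
        apply huniq
        rw [hr, T.map_smul, Submodule.coe_smul]
        linear_combination (norm := module) -c • hr h }
  refine ⟨R.mkContinuous M hrb, fun h => ⟨r h, rfl, hr h⟩, fun f => ?_⟩
  change (r (T f - z • (f : H)) : H) = f
  congr 1
  exact huniq _ _ (hr _)

end UnboundedOp

namespace RingChain

/-! ### Square-summable families -/

section lp
variable {ι : Type*} {E : ι → Type*} [∀ i, NormedAddCommGroup (E i)]

lemma lp_hasSum_sq (f : lp E 2) : HasSum (fun i => ‖f i‖ ^ 2) (‖f‖ ^ 2) := by
  have := lp.hasSum_norm (p := 2) (by norm_num) f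
  simpa using this

lemma exists_lp_of_hasSum {F : ∀ i, E i} {s B : ℝ} (hB : 0 ≤ B)
    (h : HasSum (fun i => ‖F i‖ ^ 2) s) (hs : s ≤ B ^ 2) :
    ∃ f : lp E 2, (∀ i, f i = F i) ∧ ‖f‖ ≤ B := by
  have hm : Memℓp F 2 := memℓp_gen (by simpa using h.summable)
  obtain ⟨f, hf⟩ : ∃ f : lp E 2, ∀ i, f i = F i := ⟨⟨F, hm⟩, fun _ => rfl⟩
  have h1 := lp_hasSum_sq f
  simp only [hf] at h1
  rw [h.unique h1] at hs
  exact ⟨f, hf, (abs_le_of_sq_le_sq' hs hB).2⟩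

lemma exists_lp_of_le {F : ∀ i, E i} {g : ι → ℝ} {s B : ℝ} (hB : 0 ≤ B)
    (hF : ∀ i, ‖F i‖ ^ 2 ≤ g i) (h : HasSum g s) (hs : s ≤ B ^ 2) :
    ∃ f : lp E 2, (∀ i, f i = F i) ∧ ‖f‖ ≤ B := by
  have h1 : Summable fun i => ‖F i‖ ^ 2 :=
    Summable.of_nonneg_of_le (fun _ => by positivity) hF h.summable
  exact exists_lp_of_hasSum hB h1.hasSum ((hasSum_le hF h1.hasSum h).trans hs)

end lp

instance : Fintype Arc := ⟨⟨[Arc.upper, Arc.lower], by simp⟩, by rintro (_ | _) <;> simp⟩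

lemma sum_arc {M : Type*} [AddCommMonoid M] (f : Arc → M) :
    ∑ s, f s = f Arc.upper + f Arc.lower := by
  change Multiset.sum _ = _
  change Multiset.sum (Multiset.map f [Arc.upper, Arc.lower]) = _
  simp

lemma hasSum_comp_fst {g : ℤ → ℝ} (hg : ∀ j, 0 ≤ g j) {a : ℝ} (h : HasSum g a) :
    HasSum (fun p : ℤ × Arc => g p.1) (2 * a) := by
  have h1 : HasSum (fun _ : Arc => (1 : ℝ)) 2 := by
    have := hasSum_fintype fun _ : Arc => (1 : ℝ)
    rwa [sum_arc, one_add_one_eq_two] at this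
  have h2 := h.mul h1 (h.summable.mul_of_nonneg h1.summable hg fun _ => zero_le_one)
  simpa [mul_comm] using h2

/-! ### Reduction to the vertices -/

/-- The Jacobi operator of the vertex values, with the coefficient `b j` on the `j`-th ring. -/
def jacobi (b : ℤ → ℝ) (y : ℤ → ℂ) (j : ℤ) : ℂ := b j * y (j + 1) + b (j - 1) * y (j - 1)

/-- The coefficients `cos (A j π)`. -/
def ringCos (A : ℤ → ℝ) (j : ℤ) : ℝ := Real.cos (A j * Real.pi)

/-- Half the discriminant of the chain with coupling `α`, at the energy `k ^ 2`. -/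
def disc (α : ℝ) (k : ℂ) : ℂ := cs k Real.pi + α / 4 * sn k Real.pi

lemma gauge_add_gauge_neg (A : ℝ) : gauge A Real.pi + gauge (-A) Real.pi =
    2 * (Real.cos (A * Real.pi) : ℝ) := by
  rw [gauge, gauge, Complex.ofReal_cos, Complex.two_cos]
  congr 2
  · push_cast; ring
  · push_cast; ring

/-- Writing the image of `f` as `h + z • f` encodes `(H - z) f = h` in the graph, so that both the
resolvent equation and the eigenvalue equation are read off half-circle by half-circle. -/
lemma ActsAs.arcEq {α : ℝ} {A : ℤ → ℝ} {f h : ChainL2} {z : ℂ} {u u' : ℤ → Arc → ℝ → ℂ}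
    {w : ℤ → Arc → ArcL2} (H : ActsAs α A f (h + z • f) u u' w) (j : ℤ) (s : Arc) :
    ArcEq (arcPotential (A j) s) z (f (j, s)) (h (j, s)) (u j s) (u' j s) (w j s) := by
  refine ⟨H.sobolev j s, ?_⟩
  filter_upwards [H.action j s, (H.sobolev j s).repr, Lp.coeFn_add (h (j, s)) (z • f (j, s)),
    Lp.coeFn_smul z (f (j, s))] with x e1 e2 e3 e4
  have e5 : ((h + z • f) (j, s) : ArcL2) x = (h (j, s) + z • f (j, s) : ArcL2) x := rfl
  rw [e5, e3, Pi.add_apply, e4, Pi.smul_apply, e2, smul_eq_mul] at e1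
  linear_combination e1

lemma ActsAs.of_arcEq {α : ℝ} {A : ℤ → ℝ} {f h : ChainL2} {z : ℂ} {u u' : ℤ → Arc → ℝ → ℂ}
    {w : ℤ → Arc → ArcL2}
    (H : ∀ j s, ArcEq (arcPotential (A j) s) z (f (j, s)) (h (j, s)) (u j s) (u' j s) (w j s))
    {y : ℤ → ℂ} (h0 : ∀ j s, u j s 0 = y j) (h1 : ∀ j s, u j s Real.pi = y (j + 1))
    (hδ : ∀ j, quasiDeriv (arcPotential (A j) Arc.upper) (u j Arc.upper) (u' j Arc.upper) 0
      + quasiDeriv (arcPotential (A j) Arc.lower) (u j Arc.lower) (u' j Arc.lower) 0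
      - quasiDeriv (arcPotential (A (j - 1)) Arc.upper) (u (j - 1) Arc.upper) (u' (j - 1) Arc.upper)
          Real.pi
      - quasiDeriv (arcPotential (A (j - 1)) Arc.lower) (u (j - 1) Arc.lower) (u' (j - 1) Arc.lower)
          Real.pi
      = α * y j) :
    ActsAs α A f (h + z • f) u u' w where
  sobolev := fun j s => (H j s).sobolev
  cont_right := fun j s => by rw [h0, h0]
  cont_left := fun j s => by rw [h0, h1, sub_add_cancel]
  delta := fun j => by rw [hδ, h0]
  action := fun j s => by
    filter_upwards [(H j s).eqn, (H j s).sobolev.repr, Lp.coeFn_add (h (j, s)) (z • f (j, s)),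
      Lp.coeFn_smul z (f (j, s))] with x e1 e2 e3 e4
    have e5 : ((h + z • f) (j, s) : ArcL2) x = (h (j, s) + z • f (j, s) : ArcL2) x := rfl
    rw [e5, e3, Pi.add_apply, e4, Pi.smul_apply, e2, smul_eq_mul, e1]
    ring

/-- Multiplication by `S / 2` clears the common denominator of the four boundary quasiderivatives.
This is the origin of the `α / 4` in the discriminant and of the factor `-(S / 2)` in front of the
error. -/
lemma jacobi_eq_iff {C S α b b' y y₁ y₂ e : ℂ} (hS : S ≠ 0) :
    (2 * b * y₁ - 2 * y * C) / S - (2 * y * C - 2 * b' * y₂) / S + e = α * y ↔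
      b * y₁ + b' * y₂ - 2 * (C + α / 4 * S) * y = -(S / 2) * e := by
  rw [← sub_div, div_add' _ _ _ hS, div_eq_iff hS]
  constructor <;> intro h
  · linear_combination (1 / 2 : ℂ) * h
  · linear_combination (2 : ℂ) * h

/-- The vertex values of a solution of `(H - z) f = 0` are a square-summable solution of the
Jacobi equation, and they determine `f`. -/
theorem ActsAs.vertex_kernel {α : ℝ} {A : ℤ → ℝ} {k : ℂ} (hS : sn k Real.pi ≠ 0) {f : ChainL2}
    {u u' : ℤ → Arc → ℝ → ℂ} {w : ℤ → Arc → ArcL2}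
    (H : ActsAs α A f (0 + k ^ 2 • f) u u' w) :
    (Summable fun j => ‖u j Arc.upper 0‖ ^ 2) ∧
    (∀ j, jacobi (ringCos A) (fun j => u j Arc.upper 0) j =
      2 * disc α k * u j Arc.upper 0) ∧
    ((∀ j, u j Arc.upper 0 = 0) → f = 0) := by
  have harc := H.arcEq
  have hpi : ∀ j s, u j s Real.pi = u (j + 1) Arc.upper 0 := fun j s => by
    have := H.cont_left (j + 1) s
    rwa [add_sub_cancel_right] at this
  refine ⟨?_, fun j => ?_, fun h0 => ?_⟩
  -- The left end of the upper half-circle already sees every vertex, so one half-circle per ring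
  -- suffices for summability.
  · obtain ⟨K, hK0, hK⟩ := exists_trace_bound k hS
    have h1 : Summable fun j : ℤ => ‖f (j, Arc.upper)‖ ^ 2 :=
      (lp_hasSum_sq f).summable.comp_injective
        (i := fun j : ℤ => (j, Arc.upper)) fun a b h => (Prod.ext_iff.1 h).1
    refine Summable.of_nonneg_of_le (fun _ => by positivity) (fun j => ?_) (h1.mul_left (K ^ 2))
    rw [← mul_pow]
    exact pow_le_pow_left₀ (norm_nonneg _) (hK _ _ _ _ _ (harc j Arc.upper)) 2
  · have hd := H.delta j
    rw [((harc j Arc.upper).quasiDeriv_eq hS).1, ((harc j Arc.lower).quasiDeriv_eq hS).1,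
      ((harc (j - 1) Arc.upper).quasiDeriv_eq hS).2, ((harc (j - 1) Arc.lower).quasiDeriv_eq hS).2,
      hpi, hpi, hpi, hpi, sub_add_cancel, H.cont_right j Arc.lower,
      H.cont_right (j - 1) Arc.lower] at hd
    simp only [arcPotential, neg_neg] at hd
    have g1 := gauge_add_gauge_neg (A j)
    have g2 := gauge_add_gauge_neg (A (j - 1))
    have key := (jacobi_eq_iff (C := cs k Real.pi) (α := α) (b := ringCos A j)
      (b' := ringCos A (j - 1)) (y := u j Arc.upper 0) (y₁ := u (j + 1) Arc.upper 0)
      (y₂ := u (j - 1) Arc.upper 0) (e := 0) hS).1 (by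
        rw [← hd, ringCos, ringCos, ← g1, ← g2]
        ring)
    rw [jacobi, disc]
    linear_combination key
  · ext1
    funext ⟨j, s⟩
    refine (harc j s).eq_zero hS ?_ ?_
    · rw [H.cont_right, h0]
    · rw [hpi, h0]

/-- Solutions of `(H - z) f = h` correspond to solutions of an inhomogeneous Jacobi equation. -/
theorem exists_chain_solution (k : ℂ) (hS : sn k Real.pi ≠ 0) (α : ℝ) :
    ∃ M : ℝ, 0 ≤ M ∧ ∀ (A : ℤ → ℝ) (h : ChainL2), ∃ e : lp (fun _ : ℤ => ℂ) 2,
      ‖e‖ ≤ M * ‖h‖ ∧ (h = 0 → e = 0) ∧ ∀ y : lp (fun _ : ℤ => ℂ) 2,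
        (∀ j, jacobi (ringCos A) y j - 2 * disc α k * y j = e j) →
        ∃ f u u' w, ActsAs α A f (h + k ^ 2 • f) u u' w ∧ (∀ j s, u j s 0 = y j) ∧
          (∀ j s, ‖f (j, s)‖ ≤ M * (‖y j‖ + ‖y (j + 1)‖ + ‖h (j, s)‖)) ∧
          ‖f‖ ≤ M * (‖y‖ + ‖h‖) := by
  obtain ⟨M, hM, harc⟩ := exists_arc_solution k hS
  set m : ℝ := ‖sn k Real.pi‖ with hm
  have hm0 : 0 ≤ m := norm_nonneg _
  refine ⟨4 * M + 4 * m * M, by positivity, fun A h => ?_⟩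
  choose e₀ e₁ b₀ b₁ hex using fun (j : ℤ) (s : Arc) => harc (arcPotential (A j) s) (h (j, s))
  have hh := lp_hasSum_sq h
  have hsub : ∀ i : ℤ → ℤ × Arc, Function.Injective i →
      ∃ a, HasSum (fun j => ‖h (i j)‖ ^ 2) a ∧ a ≤ ‖h‖ ^ 2 := fun i hi => by
    have hs := hh.summable.comp_injective hi
    refine ⟨_, hs.hasSum, ?_⟩
    rw [← hh.tsum_eq]
    exact hs.tsum_le_tsum_of_inj i hi (fun _ _ => by positivity) (fun _ => le_rfl) hh.summable
  obtain ⟨a₁, s₁, l₁⟩ := hsub (fun j => (j, Arc.upper)) fun a b h => (Prod.ext_iff.1 h).1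
  obtain ⟨a₂, s₂, l₂⟩ := hsub (fun j => (j, Arc.lower)) fun a b h => (Prod.ext_iff.1 h).1
  obtain ⟨a₃, s₃, l₃⟩ := hsub (fun j => (j - 1, Arc.upper))
    fun a b h => sub_left_injective (Prod.ext_iff.1 h).1
  obtain ⟨a₄, s₄, l₄⟩ := hsub (fun j => (j - 1, Arc.lower))
    fun a b h => sub_left_injective (Prod.ext_iff.1 h).1
  -- The contribution of `h` to the δ condition at vertex `j`, collected from the four half-circles
  -- meeting there.
  set err : ℤ → ℂ := fun j => e₀ j Arc.upper + e₀ j Arc.lower - e₁ (j - 1) Arc.upper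
    - e₁ (j - 1) Arc.lower with herr
  have herrb : ∀ j, ‖err j‖ ≤ M * (‖h (j, Arc.upper)‖ + ‖h (j, Arc.lower)‖ +
      ‖h (j - 1, Arc.upper)‖ + ‖h (j - 1, Arc.lower)‖) := fun j => by
    refine (norm_sub_le _ _).trans (le_trans (add_le_add ((norm_sub_le _ _).trans
      (add_le_add ((norm_add_le _ _).trans (add_le_add (b₀ j _) (b₀ j _))) (b₁ (j - 1) _)))
      (b₁ (j - 1) _)) (le_of_eq ?_))
    ring
  -- The factor `-(S / 2)` is the one in `jacobi_eq_iff`.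
  obtain ⟨e, he, hen⟩ := exists_lp_of_le (F := fun j => -(sn k Real.pi / 2) * err j)
    (B := 4 * m * M * ‖h‖) (by positivity) (g := fun j => m ^ 2 * M ^ 2 *
      (‖h (j, Arc.upper)‖ ^ 2 + ‖h (j, Arc.lower)‖ ^ 2 +
      ‖h (j - 1, Arc.upper)‖ ^ 2 + ‖h (j - 1, Arc.lower)‖ ^ 2)) (fun j => by
      rw [norm_mul, norm_neg, norm_div, RCLike.norm_ofNat, ← hm, mul_pow]
      have := pow_le_pow_left₀ (norm_nonneg _) (herrb j) 2
      rw [mul_pow] at this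
      set p := ‖h (j, Arc.upper)‖
      set q := ‖h (j, Arc.lower)‖
      set r := ‖h (j - 1, Arc.upper)‖
      set t := ‖h (j - 1, Arc.lower)‖
      have h4 : (p + q + r + t) ^ 2 ≤ 4 * (p ^ 2 + q ^ 2 + r ^ 2 + t ^ 2) := by
        nlinarith [sq_nonneg (p - q), sq_nonneg (p - r), sq_nonneg (p - t), sq_nonneg (q - r),
          sq_nonneg (q - t), sq_nonneg (r - t)]
      calc (m / 2) ^ 2 * ‖err j‖ ^ 2 ≤ (m / 2) ^ 2 *
            (M ^ 2 * (4 * (p ^ 2 + q ^ 2 + r ^ 2 + t ^ 2))) :=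
            mul_le_mul_of_nonneg_left (this.trans (mul_le_mul_of_nonneg_left h4 (sq_nonneg _)))
              (sq_nonneg _)
        _ = _ := by ring)
    ((((s₁.add s₂).add s₃).add s₄).mul_left (m ^ 2 * M ^ 2)) (by
      calc m ^ 2 * M ^ 2 * (a₁ + a₂ + a₃ + a₄) ≤ m ^ 2 * M ^ 2 * (4 * ‖h‖ ^ 2) := by
            apply mul_le_mul_of_nonneg_left _ (by positivity); linarith
        _ ≤ (4 * m * M * ‖h‖) ^ 2 := by nlinarith [sq_nonneg (m * M * ‖h‖)])
  have hbd : ‖e‖ ≤ (4 * M + 4 * m * M) * ‖h‖ := hen.trans (by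
    apply mul_le_mul_of_nonneg_right _ (norm_nonneg _); linarith)
  refine ⟨e, hbd, fun h0 => ?_, fun y hy => ?_⟩
  · rw [← norm_le_zero_iff]
    simpa [h0] using hbd
  choose F u u' w hF hu0 hu1 hq0 hq1 hFn using fun (j : ℤ) (s : Arc) => hex j s (y j) (y (j + 1))
  have hys := lp_hasSum_sq y
  have hys' : HasSum (fun j => ‖y (j + 1)‖ ^ 2) (‖y‖ ^ 2) :=
    ((Equiv.addRight (1 : ℤ)).hasSum_iff (f := fun j => ‖y j‖ ^ 2)).2 hys
  -- Each vertex value is counted once per half-circle on either side of its vertex, whence the four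
  -- copies of `‖y‖ ^ 2` in the total below.
  obtain ⟨f, hf, hfn⟩ := exists_lp_of_le (F := fun p : ℤ × Arc => F p.1 p.2)
    (B := 4 * M * (‖y‖ + ‖h‖)) (by positivity)
    (g := fun p => 3 * M ^ 2 * (‖y p.1‖ ^ 2 + ‖y (p.1 + 1)‖ ^ 2 + ‖h p‖ ^ 2)) (fun p => by
      have := pow_le_pow_left₀ (norm_nonneg _) (hFn p.1 p.2) 2
      rw [mul_pow] at this
      set a := ‖y p.1‖
      set b := ‖y (p.1 + 1)‖
      set c := ‖h p‖
      have h4 : (a + b + c) ^ 2 ≤ 3 * (a ^ 2 + b ^ 2 + c ^ 2) := by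
        nlinarith [sq_nonneg (a - b), sq_nonneg (a - c), sq_nonneg (b - c)]
      calc _ ≤ _ := this
        _ ≤ M ^ 2 * (3 * (a ^ 2 + b ^ 2 + c ^ 2)) := mul_le_mul_of_nonneg_left h4 (sq_nonneg _)
        _ = _ := by ring)
    ((((hasSum_comp_fst (fun _ => by positivity) hys).add
      (hasSum_comp_fst (fun _ => by positivity) hys')).add hh).mul_left (3 * M ^ 2)) (by
      have h1 : 0 ≤ ‖y‖ * ‖h‖ := by positivity
      have h2 : 2 * ‖y‖ ^ 2 + 2 * ‖y‖ ^ 2 + ‖h‖ ^ 2 ≤ 5 * (‖y‖ + ‖h‖) ^ 2 := by nlinarith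
      calc _ ≤ 3 * M ^ 2 * (5 * (‖y‖ + ‖h‖) ^ 2) := mul_le_mul_of_nonneg_left h2 (by positivity)
        _ ≤ _ := by nlinarith [sq_nonneg (M * (‖y‖ + ‖h‖))])
  refine ⟨f, u, u', w, ActsAs.of_arcEq (y := y) (fun j s => ?_) hu0 hu1 fun j => ?_, hu0,
    fun j s => ?_, ?_⟩
  · rw [hf]
    exact hF j s
  · rw [hq0, hq0, hq1, hq1, sub_add_cancel]
    simp only [arcPotential, neg_neg]
    have g1 := gauge_add_gauge_neg (A j)
    have g2 := gauge_add_gauge_neg (A (j - 1))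
    have hyj := hy j
    rw [he, jacobi, disc] at hyj
    rw [← (jacobi_eq_iff (C := cs k Real.pi) (α := α) (b := ringCos A j)
      (b' := ringCos A (j - 1)) (y := y j) (y₁ := y (j + 1)) (y₂ := y (j - 1))
      (e := err j) hS).2 hyj, ringCos, ringCos, ← g1, ← g2]
    simp only [herr]
    ring
  · rw [hf]
    refine (hFn j s).trans (mul_le_mul_of_nonneg_right ?_ (by positivity))
    have : 0 ≤ 4 * m * M := by positivity
    linarith
  · refine hfn.trans (mul_le_mul_of_nonneg_right ?_ (by positivity))
    have : 0 ≤ 4 * m * M := by positivity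
    linarith

/-- If `J - 2 ξ` has a bounded inverse, then the energy is in the resolvent set. -/
theorem mem_resolventSet_of_jacobi {α : ℝ} {A : ℤ → ℝ} {k : ℂ} (hS : sn k Real.pi ≠ 0) (D : ℝ)
    (hsurj : ∀ e : lp (fun _ : ℤ => ℂ) 2, ∃ y : lp (fun _ : ℤ => ℂ) 2,
      (∀ j, jacobi (ringCos A) y j - 2 * disc α k * y j = e j) ∧ ‖y‖ ≤ D * ‖e‖)
    (hinj : ∀ y : lp (fun _ : ℤ => ℂ) 2,
      (∀ j, jacobi (ringCos A) y j = 2 * disc α k * y j) → y = 0) :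
    k ^ 2 ∈ UnboundedOp.resolventSet (chainHamiltonian α A) := by
  obtain ⟨M, hM, hsol⟩ := exists_chain_solution k hS α
  -- This composes `‖f‖ ≤ M (‖y‖ + ‖h‖)`, `‖y‖ ≤ |D| ‖e‖` and `‖e‖ ≤ M ‖h‖`; the absolute value is
  -- there because `D` carries no sign condition.
  refine UnboundedOp.mem_resolventSet_of_bounded_solution _ _ (M * (|D| * M + 1)) (fun h => ?_)
    fun f hf => ?_
  · obtain ⟨e, he, -, hex⟩ := hsol A h
    obtain ⟨y, hy, hyn⟩ := hsurj e
    obtain ⟨f, u, u', w, H, -, -, hfn⟩ := hex y hy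
    have hg : (f, h + k ^ 2 • f) ∈ (chainHamiltonian α A).graph := by
      rw [chainHamiltonian_graph]
      exact ⟨u, u', w, H⟩
    rw [LinearPMap.mem_graph_iff] at hg
    obtain ⟨g, hg1, hg2⟩ := hg
    refine ⟨g, ?_, ?_⟩
    · rw [hg2, hg1]
      simp
    · rw [hg1]
      have : ‖y‖ ≤ |D| * (M * ‖h‖) :=
        hyn.trans (mul_le_mul (le_abs_self D) he (norm_nonneg _) (abs_nonneg _))
      calc ‖f‖ ≤ M * (‖y‖ + ‖h‖) := hfn
        _ ≤ M * (|D| * (M * ‖h‖) + ‖h‖) := by gcongr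
        _ = _ := by ring
  · have hg : ((f : ChainL2), 0 + k ^ 2 • (f : ChainL2)) ∈ chainGraph α A := by
      rw [← chainHamiltonian_graph, LinearPMap.mem_graph_iff]
      exact ⟨f, rfl, by rw [zero_add]; exact sub_eq_zero.1 hf⟩
    obtain ⟨u, u', w, H⟩ := hg
    obtain ⟨h1, h2, h3⟩ := H.vertex_kernel hS
    obtain ⟨y, hy, -⟩ := exists_lp_of_hasSum (F := fun j => u j Arc.upper 0)
      (Real.sqrt_nonneg _) h1.hasSum
      (Real.sq_sqrt (tsum_nonneg fun _ => by positivity)).ge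
    have hy0 := hinj y fun j => by
      have := h2 j
      simp only [jacobi] at this ⊢
      rw [hy, hy, hy]
      exact this
    exact Subtype.ext (h3 fun j => by rw [← hy, hy0]; rfl)

/-! ### Jacobi operators -/

/-- Square-summable sequences of vertex values. -/
abbrev VertexL2 : Type := lp (fun _ : ℤ => ℂ) 2

/-- The weighted shift `y ↦ (b j * y (j + m))`. -/
lemma exists_weighted_shift {b : ℤ → ℝ} {B : ℝ} (hb : ∀ j, |b j| ≤ B) (m : ℤ) :
    ∃ W : VertexL2 →L[ℂ] VertexL2, (∀ y j, W y j = b j * y (j + m)) ∧ ‖W‖ ≤ B := by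
  have hB : 0 ≤ B := (abs_nonneg _).trans (hb 0)
  have hex : ∀ y : VertexL2, ∃ x : VertexL2, (∀ j, x j = b j * y (j + m)) ∧ ‖x‖ ≤ B * ‖y‖ := by
    intro y
    have hs : HasSum (fun j => B ^ 2 * ‖y (j + m)‖ ^ 2) (B ^ 2 * ‖y‖ ^ 2) :=
      (((Equiv.addRight m).hasSum_iff (f := fun j => ‖y j‖ ^ 2)).2 (lp_hasSum_sq y)).mul_left _
    refine exists_lp_of_le (F := fun j => (b j : ℂ) * y (j + m)) (by positivity) (fun j => ?_) hs
      (by rw [mul_pow])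
    rw [norm_mul, mul_pow, Complex.norm_real, Real.norm_eq_abs]
    gcongr
    exact hb j
  choose F hF hFn using hex
  let L : VertexL2 →ₗ[ℂ] VertexL2 :=
    { toFun := F
      map_add' := fun x y => by
        ext j
        rw [lp.coeFn_add, Pi.add_apply, hF, hF, hF, lp.coeFn_add, Pi.add_apply, mul_add]
      map_smul' := fun c x => by
        ext j
        rw [RingHom.id_apply, lp.coeFn_smul, Pi.smul_apply, hF, hF, lp.coeFn_smul, Pi.smul_apply,
          smul_eq_mul, smul_eq_mul]
        ring }
  exact ⟨L.mkContinuous B hFn, hF, L.mkContinuous_norm_le hB hFn⟩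

/-- With `W` the weighted shift `y ↦ (b_j y_{j+1})`, the operator is `W + W*`. Self-adjointness and
the bound `2B` follow. -/
lemma exists_jacobi_operator {b : ℤ → ℝ} {B : ℝ} (hb : ∀ j, |b j| ≤ B) :
    ∃ J : VertexL2 →L[ℂ] VertexL2, (∀ y j, J y j = jacobi b y j) ∧ ‖J‖ ≤ 2 * B ∧
      IsSelfAdjoint J := by
  obtain ⟨W, hW, hWn⟩ := exists_weighted_shift hb 1
  obtain ⟨V, hV, hVn⟩ := exists_weighted_shift (fun j => hb (j - 1)) (-1)
  have hadj : V = ContinuousLinearMap.adjoint W := by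
    rw [ContinuousLinearMap.eq_adjoint_iff]
    intro x y
    rw [lp.inner_eq_tsum, lp.inner_eq_tsum,
      ← (Equiv.addRight (1 : ℤ)).tsum_eq (fun j => inner ℂ (V x j) (y j))]
    congr 1
    funext j
    simp only [Equiv.coe_addRight, hV, hW, RCLike.inner_apply, add_sub_cancel_right,
      add_neg_cancel_right, map_mul, Complex.conj_ofReal]
    ring
  refine ⟨W + V, fun y j => ?_, (norm_add_le _ _).trans (by linarith), ?_⟩
  · rw [add_apply, lp.coeFn_add, Pi.add_apply, hW, hV, jacobi, sub_eq_add_neg]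
  · rw [hadj, ← ContinuousLinearMap.star_eq_adjoint]
    exact IsSelfAdjoint.add_star_self W

/-- `J - μ` has a bounded inverse on `ℓ²`. -/
def JacobiInvertible (b : ℤ → ℝ) (μ : ℂ) : Prop :=
  (∃ D : ℝ, ∀ e : VertexL2, ∃ y : VertexL2, (∀ j, jacobi b y j - μ * y j = e j) ∧ ‖y‖ ≤ D * ‖e‖) ∧
  ∀ y : VertexL2, (∀ j, jacobi b y j = μ * y j) → y = 0

lemma jacobiInvertible_of_isUnit {b : ℤ → ℝ} {μ : ℂ} {J : VertexL2 →L[ℂ] VertexL2}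
    (hJ : ∀ y j, J y j = jacobi b y j) (hu : IsUnit (J - algebraMap ℂ _ μ)) :
    JacobiInvertible b μ := by
  have happ : ∀ y : VertexL2, ∀ j, (J - algebraMap ℂ _ μ) y j = jacobi b y j - μ * y j :=
    fun y j => by
      rw [sub_apply, Algebra.algebraMap_eq_smul_one,
        smul_apply, one_apply_eq_self, lp.coeFn_sub, Pi.sub_apply,
        hJ, lp.coeFn_smul, Pi.smul_apply, smul_eq_mul]
  obtain ⟨U, hU⟩ := hu
  rw [← hU] at happ
  constructor
  · refine ⟨‖(↑U⁻¹ : VertexL2 →L[ℂ] VertexL2)‖, fun e => ⟨(↑U⁻¹ : VertexL2 →L[ℂ] VertexL2) e,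
      fun j => ?_, ContinuousLinearMap.le_opNorm _ _⟩⟩
    rw [← happ, ← mul_apply_eq_comp, U.mul_inv, one_apply_eq_self]
  · intro y hy
    have h0 : (U : VertexL2 →L[ℂ] VertexL2) y = 0 := by
      ext j
      rw [happ, hy, sub_self]
      rfl
    have : (↑U⁻¹ * U : VertexL2 →L[ℂ] VertexL2) y = 0 := by
      rw [mul_apply_eq_comp, h0, map_zero]
    rwa [U.inv_mul, one_apply_eq_self] at this

lemma isUnit_jacobi_of_norm_lt {J : VertexL2 →L[ℂ] VertexL2} {μ : ℂ} (h : ‖J‖ < ‖μ‖) :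
    IsUnit (J - algebraMap ℂ _ μ) := by
  have h1 : μ ∈ resolventSet ℂ J := by
    apply spectrum.mem_resolventSet_of_norm_lt_mul
    calc ‖J‖ * ‖(1 : VertexL2 →L[ℂ] VertexL2)‖ ≤ ‖J‖ * 1 := by
          gcongr
          exact ContinuousLinearMap.norm_id_le
      _ < ‖μ‖ := by rwa [mul_one]
  rw [spectrum.mem_resolventSet_iff] at h1
  rw [← neg_sub]
  exact h1.neg

/-- Points off the interval `[-2B, 2B]` are in the resolvent set of `J`. -/
lemma jacobiInvertible_of_off_interval {b : ℤ → ℝ} {B : ℝ} (hb : ∀ j, |b j| ≤ B) {μ : ℂ}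
    (h : ∀ t : ℝ, |t| ≤ 2 * B → μ ≠ t) : JacobiInvertible b μ := by
  obtain ⟨J, hJ, hJn, hJs⟩ := exists_jacobi_operator hb
  refine jacobiInvertible_of_isUnit hJ ?_
  by_cases hμ : μ = μ.re
  · apply isUnit_jacobi_of_norm_lt
    refine hJn.trans_lt ?_
    by_contra! hle
    refine h μ.re ?_ hμ
    rwa [hμ, Complex.norm_real, Real.norm_eq_abs] at hle
  · have h1 : μ ∈ resolventSet ℂ J := by
      by_contra hs
      exact hμ (hJs.mem_spectrum_eq_re hs)
    rw [spectrum.mem_resolventSet_iff] at h1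
    rw [← neg_sub]
    exact h1.neg

/-- If `b` differs from the constant `c` at a single place, then `μ` with `|μ| > 2 |c|` is in the
resolvent set unless it is an eigenvalue. -/
lemma jacobiInvertible_of_injective {b : ℤ → ℝ} {c : ℝ} {i : ℤ} (hb : ∀ j, j ≠ i → b j = c) {μ : ℂ}
    (hμ : 2 * |c| < ‖μ‖) (hinj : ∀ y : VertexL2, (∀ j, jacobi b y j = μ * y j) → y = 0) :
    JacobiInvertible b μ := by
  obtain ⟨J₀, hJ₀, hJ₀n, -⟩ := exists_jacobi_operator (b := fun _ => c) (fun _ => le_rfl)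
  have hbB : ∀ j, |b j| ≤ max |b i| |c| := fun j => by
    by_cases h : j = i
    · rw [h]; exact le_max_left _ _
    · rw [hb j h]; exact le_max_right _ _
  obtain ⟨J, hJ, -, -⟩ := exists_jacobi_operator hbB
  obtain ⟨U, hU⟩ := isUnit_jacobi_of_norm_lt (hJ₀n.trans_lt hμ)
  refine jacobiInvertible_of_isUnit hJ ?_
  obtain ⟨V, hV, -⟩ := exists_weighted_shift (b := fun j => b j - c) (B := |b i| + |c|)
    (fun j => by
      by_cases h : j = i
      · rw [h]; exact abs_sub _ _
      · rw [hb j h, sub_self, abs_zero]; positivity) 0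
  set ev : ℤ → VertexL2 →L[ℂ] ℂ := fun j => lp.evalCLM ℂ (fun _ : ℤ => ℂ) 2 j with hev
  have hevj : ∀ j (y : VertexL2), ev j y = y j := fun _ _ => rfl
  set κ : ℂ := ((b i - c : ℝ) : ℂ) with hκ
  set sg : ℤ → VertexL2 := fun j => lp.single 2 j (1 : ℂ) with hsg
  -- The coefficient `b i` is the weight of the edge between vertices `i` and `i + 1`, so changing
  -- it alters just these two rows: a perturbation of rank at most two.
  set K : VertexL2 →L[ℂ] VertexL2 :=
    (ev (i + 1)).smulRight (κ • sg i) + (ev i).smulRight (κ • sg (i + 1)) with hK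
  have hKc : IsCompactOperator K := by
    have h1 : ∀ (φ : VertexL2 →L[ℂ] ℂ) (x : VertexL2), IsCompactOperator (φ.smulRight x) :=
      fun φ x => by
        have h0 : IsCompactOperator φ := isCompactOperator_of_locallyCompactSpace_dom φ
        exact h0.clm_comp ((ContinuousLinearMap.id ℂ ℂ).smulRight x)
    exact (h1 _ _).add (h1 _ _)
  have hJK : J = J₀ + K := by
    ext y j
    have e1 : (J₀ + K) y j = J₀ y j + (y (i + 1) * (κ * sg i j) + y i * (κ * sg (i + 1) j)) := rfl
    rw [e1, hJ, hJ₀, jacobi, jacobi]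
    by_cases h1 : j = i
    · subst h1
      have h2 : b (j - 1) = c := hb _ (by omega)
      have h3 : sg (j + 1) j = 0 := lp.single_apply_ne 2 _ _ (by omega)
      have h4 : sg j j = 1 := lp.single_apply_self 2 _ _
      rw [h2, h3, h4, hκ]
      push_cast
      ring
    · by_cases h2 : j = i + 1
      · subst h2
        have h3 : sg (i + 1) (i + 1) = 1 := lp.single_apply_self 2 _ _
        have h4 : sg i (i + 1) = 0 := lp.single_apply_ne 2 _ _ (by omega)
        rw [h3, h4, hb (i + 1) (by omega), hκ, add_sub_cancel_right]
        push_cast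
        ring
      · have h3 : sg (i + 1) j = 0 := lp.single_apply_ne 2 _ _ h2
        have h4 : sg i j = 0 := lp.single_apply_ne 2 _ _ h1
        rw [h3, h4, hb j h1, hb (j - 1) (by omega)]
        ring
  -- With `U = J₀ - μ` invertible, `J - μ = U (1 + U⁻¹ K)`. The Fredholm alternative for the compact
  -- `U⁻¹ K` leaves an eigenvalue `-1` as the sole obstruction, and its eigenvector would lie in the
  -- kernel of `J - μ`.
  have hfac : J - algebraMap ℂ _ μ = U * ((↑U⁻¹ * K) - algebraMap ℂ _ (-1 : ℂ)) := by
    rw [mul_sub, ← mul_assoc, U.mul_inv, one_mul, hJK, map_neg, map_one, mul_neg, mul_one, hU]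
    abel
  rw [hfac]
  refine U.isUnit.mul ?_
  have hc2 : IsCompactOperator (↑U⁻¹ * K : VertexL2 →L[ℂ] VertexL2) := hKc.clm_comp _
  rcases IsCompactOperator.hasEigenvalue_or_mem_resolventSet hc2
    (show (-1 : ℂ) ≠ 0 by norm_num) with h | h
  · exfalso
    obtain ⟨y, hy⟩ := h.exists_hasEigenvector
    have hy1 : (↑U⁻¹ * K : VertexL2 →L[ℂ] VertexL2) y = (-1 : ℂ) • y := hy.apply_eq_smul
    have hy2 : (J - algebraMap ℂ _ μ) y = 0 := by
      rw [hfac, mul_apply_eq_comp, sub_apply, hy1,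
        Algebra.algebraMap_eq_smul_one, smul_apply,
        one_apply_eq_self, sub_self, map_zero]
    apply hy.2
    apply hinj
    intro j
    have e : (J - algebraMap ℂ _ μ) y j = J y j - μ * y j := by
      rw [sub_apply, Algebra.algebraMap_eq_smul_one,
        smul_apply, one_apply_eq_self, lp.coeFn_sub, Pi.sub_apply,
        lp.coeFn_smul, Pi.smul_apply, smul_eq_mul]
    rw [hy2, hJ] at e
    exact (sub_eq_zero.1 e.symm)
  · rw [spectrum.mem_resolventSet_iff] at h
    rw [← neg_sub]
    exact h.neg

/-! ### Square-summable solutions of the Jacobi equation -/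

lemma VertexL2.tendsto_norm (y : VertexL2) {i : ℕ → ℤ} (hi : Function.Injective i) :
    Filter.Tendsto (fun n => ‖y (i n)‖) Filter.atTop (nhds 0) := by
  have h := ((lp_hasSum_sq y).summable.comp_injective hi).tendsto_atTop_zero
  have h2 := (Real.continuous_sqrt.tendsto 0).comp h
  rw [Real.sqrt_zero] at h2
  refine h2.congr fun n => ?_
  simp [Real.sqrt_sq]

/-- Inside the band, no solution on a half-line decays. -/
lemma eq_zero_of_tendsto_of_band {c ξ : ℝ} (hc : c ≠ 0) (hξ : |ξ| ≤ |c|) {x : ℕ → ℂ}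
    (hx : Filter.Tendsto (fun n => ‖x n‖) Filter.atTop (nhds 0))
    (hrec : ∀ n, c * x (n + 2) + c * x n = 2 * ξ * x (n + 1)) : ∀ n, x n = 0 := by
  set t : ℝ := ξ / c with ht
  have ht1 : |t| ≤ 1 := by
    rw [ht, abs_div]
    exact div_le_one_of_le₀ hξ (abs_nonneg _)
  have hrec' : ∀ n, x (n + 2) = 2 * t * x (n + 1) - x n := fun n => by
    have hc' : (c : ℂ) ≠ 0 := by exact_mod_cast hc
    apply mul_left_cancel₀ hc'
    rw [ht]
    push_cast
    field_simp
    linear_combination hrec n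
  -- A quadratic form conserved by the recursion. It equals `|x_{n+1} - t x_n|² + (1 - t²)|x_n|²`,
  -- nonnegative because `|t| ≤ 1`; decay of `x` forces its constant value to be zero, hence both
  -- terms vanish.
  set Q : ℕ → ℝ := fun n => Complex.normSq (x (n + 1)) + Complex.normSq (x n) -
    2 * t * ((x (n + 1)).re * (x n).re + (x (n + 1)).im * (x n).im) with hQ
  have hQs : ∀ n, Q (n + 1) = Q n := fun n => by
    have hre : (x (n + 2)).re = 2 * t * (x (n + 1)).re - (x n).re := by
      rw [hrec']; simp
    have him : (x (n + 2)).im = 2 * t * (x (n + 1)).im - (x n).im := by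
      rw [hrec']; simp
    simp only [hQ, Complex.normSq_apply]
    rw [show n + 1 + 1 = n + 2 from rfl, hre, him]
    ring
  have hQ0 : ∀ n, Q n = 0 := by
    have hconst : ∀ n, Q n = Q 0 := fun n => by
      induction n with
      | zero => rfl
      | succ n ih => rw [hQs, ih]
    have hz : Filter.Tendsto x Filter.atTop (nhds 0) := tendsto_zero_iff_norm_tendsto_zero.2 hx
    have hz1 := hz.comp (Filter.tendsto_add_atTop_nat 1)
    have hQt : Filter.Tendsto Q Filter.atTop (nhds 0) := by
      have hcont : Continuous fun p : ℂ × ℂ => Complex.normSq p.1 + Complex.normSq p.2 -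
          2 * t * (p.1.re * p.2.re + p.1.im * p.2.im) := by
        have := Complex.continuous_normSq
        fun_prop
      have h := (hcont.tendsto (0, 0)).comp (hz1.prodMk_nhds hz)
      simpa [Function.comp_def, hQ] using h
    have h0 : Q 0 = 0 := tendsto_nhds_unique (tendsto_const_nhds.congr fun n => (hconst n).symm) hQt
    intro n
    rw [hconst, h0]
  have hle : ∀ n, (1 - t ^ 2) * Complex.normSq (x n) = 0 ∧
      (x (n + 1)).re = t * (x n).re ∧ (x (n + 1)).im = t * (x n).im := fun n => by
    have h := hQ0 n
    have ht2 : 0 ≤ 1 - t ^ 2 := by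
      rw [abs_le] at ht1; nlinarith [ht1.1, ht1.2]
    simp only [hQ, Complex.normSq_apply] at h ⊢
    have h1 : ((x (n + 1)).re - t * (x n).re) ^ 2 + ((x (n + 1)).im - t * (x n).im) ^ 2 +
        (1 - t ^ 2) * ((x n).re * (x n).re + (x n).im * (x n).im) = 0 := by
      linear_combination h
    have h2 : 0 ≤ (1 - t ^ 2) * ((x n).re * (x n).re + (x n).im * (x n).im) :=
      mul_nonneg ht2 (by nlinarith [mul_self_nonneg (x n).re, mul_self_nonneg (x n).im])
    have h3 := sq_nonneg ((x (n + 1)).re - t * (x n).re)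
    have h4 := sq_nonneg ((x (n + 1)).im - t * (x n).im)
    refine ⟨by linarith, ?_, ?_⟩
    · exact sub_eq_zero.1 (pow_eq_zero_iff two_ne_zero |>.1 (by linarith))
    · exact sub_eq_zero.1 (pow_eq_zero_iff two_ne_zero |>.1 (by linarith))
  intro n
  -- At a band edge the form gives only `x_{n+1} = t x_n` with `t = ±1`; the modulus is then
  -- constant, which again contradicts decay unless it is zero.
  by_cases h1 : 1 - t ^ 2 = 0
  · have hn : ∀ m, Complex.normSq (x (m + 1)) = Complex.normSq (x m) := fun m => by
      rw [Complex.normSq_apply, Complex.normSq_apply, (hle m).2.1, (hle m).2.2]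
      linear_combination -((x m).re * (x m).re + (x m).im * (x m).im) * h1
    have hn' : ∀ m, Complex.normSq (x (n + m)) = Complex.normSq (x n) := fun m => by
      induction m with
      | zero => rfl
      | succ m ih => rw [← ih, ← hn (n + m)]; rfl
    have h2 : Filter.Tendsto (fun m => Complex.normSq (x (n + m))) Filter.atTop (nhds 0) := by
      have e : (fun m => Complex.normSq (x (n + m))) = fun m => ‖x (m + n)‖ ^ 2 := by
        funext m
        rw [Complex.normSq_eq_norm_sq, add_comm]
      rw [e]
      simpa using ((hx.comp (Filter.tendsto_add_atTop_nat n)).pow 2)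
    exact Complex.normSq_eq_zero.1
      (tendsto_nhds_unique (tendsto_const_nhds.congr fun m => (hn' m).symm) h2)
  · exact Complex.normSq_eq_zero.1 ((mul_eq_zero.1 (hle n).1).resolve_left h1)

/-- Outside of the band, a bounded solution on a half-line decays geometrically. -/
lemma geometric_of_bounded {c ξ ν : ℝ} (hν : |c| < |ν|) (hξ : ν ^ 2 + c ^ 2 = 2 * ξ * ν) {x : ℕ → ℂ}
    (hx : Filter.Tendsto (fun n => ‖x n‖) Filter.atTop (nhds 0))
    (hrec : ∀ n, c * x (n + 2) + c * x n = 2 * ξ * x (n + 1)) : ∀ n, ν * x (n + 1) = c * x n := by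
  have hν0 : 0 < |ν| := (abs_nonneg c).trans_lt hν
  have hνC : (ν : ℂ) ≠ 0 := by exact_mod_cast abs_pos.1 hν0
  have hξC : (ν : ℂ) ^ 2 + (c : ℂ) ^ 2 = 2 * ξ * ν := by exact_mod_cast hξ
  -- This combination removes the decaying solution `(c/ν)^n`. What remains satisfies `ν d_n = c
  -- d_{n+1}`, so its modulus cannot decrease, while decay of `x` sends it to zero.
  set d : ℕ → ℂ := fun n => ν * x (n + 1) - c * x n with hd
  have hdr : ∀ n, ν * d n = c * d (n + 1) := fun n => by
    simp only [hd]
    rw [show n + 1 + 1 = n + 2 from rfl]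
    linear_combination -(ν : ℂ) * hrec n + x (n + 1) * hξC
  have hz : Filter.Tendsto x Filter.atTop (nhds 0) := tendsto_zero_iff_norm_tendsto_zero.2 hx
  have hdt : Filter.Tendsto (fun n => ‖d n‖) Filter.atTop (nhds 0) := by
    have := ((hz.comp (Filter.tendsto_add_atTop_nat 1)).const_mul (ν : ℂ)).sub
      (hz.const_mul (c : ℂ))
    simpa using this.norm
  have hmono : ∀ n, ‖d n‖ ≤ ‖d (n + 1)‖ := fun n => by
    have h := congrArg norm (hdr n)
    rw [norm_mul, norm_mul, Complex.norm_real, Complex.norm_real, Real.norm_eq_abs,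
      Real.norm_eq_abs] at h
    by_contra! hlt
    have h1 : |c| * ‖d (n + 1)‖ ≤ |ν| * ‖d (n + 1)‖ :=
      mul_le_mul_of_nonneg_right hν.le (norm_nonneg _)
    have h2 : |ν| * ‖d (n + 1)‖ < |ν| * ‖d n‖ := mul_lt_mul_of_pos_left hlt hν0
    linarith
  intro n
  have h0 : ‖d n‖ ≤ 0 := ge_of_tendsto hdt (by
    filter_upwards [Filter.eventually_ge_atTop n] with m hm
    exact monotone_nat_of_le_succ hmono hm)
  exact sub_eq_zero.1 (norm_le_zero_iff.1 h0)

/-- The exceptional coefficient joins vertices 1 and 2. The half-lines start at these vertices (to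
the right from 2, to the left from 1), and the rows centred at interior points of either one involve
only the constant coefficient. -/
lemma jacobi_right {b : ℤ → ℝ} {c ξ : ℝ} (hb : ∀ j, j ≠ 1 → b j = c) {y : ℤ → ℂ}
    (hy : ∀ j, jacobi b y j = 2 * (ξ : ℂ) * y j) (n : ℕ) :
    c * y (2 + (n + 2 : ℕ)) + c * y (2 + (n : ℕ)) = 2 * ξ * y (2 + (n + 1 : ℕ)) := by
  have h := hy (2 + (n + 1 : ℕ))
  rw [jacobi, hb _ (by omega), hb _ (by omega),
    show (2 + ((n + 1 : ℕ) : ℤ) + 1) = 2 + (n + 2 : ℕ) by push_cast; ring,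
    show (2 + ((n + 1 : ℕ) : ℤ) - 1) = 2 + (n : ℕ) by push_cast; ring] at h
  exact h

lemma jacobi_left {b : ℤ → ℝ} {c ξ : ℝ} (hb : ∀ j, j ≠ 1 → b j = c) {y : ℤ → ℂ}
    (hy : ∀ j, jacobi b y j = 2 * (ξ : ℂ) * y j) (n : ℕ) :
    c * y (1 - (n + 2 : ℕ)) + c * y (1 - (n : ℕ)) = 2 * ξ * y (1 - (n + 1 : ℕ)) := by
  have h := hy (1 - (n + 1 : ℕ))
  rw [jacobi, hb _ (by omega), hb _ (by omega),
    show (1 - ((n + 1 : ℕ) : ℤ) + 1) = 1 - (n : ℕ) by push_cast; ring,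
    show (1 - ((n + 1 : ℕ) : ℤ) - 1) = 1 - (n + 2 : ℕ) by push_cast; ring, add_comm] at h
  exact h

lemma VertexL2.eq_zero_of_half_lines {y : VertexL2} (h1 : ∀ n : ℕ, y (1 - (n : ℕ)) = 0)
    (h2 : ∀ n : ℕ, y (2 + (n : ℕ)) = 0) :
    y = 0 := by
  ext j
  rcases le_or_gt j 1 with h | h
  · obtain ⟨n, rfl⟩ : ∃ n : ℕ, j = 1 - (n : ℕ) := ⟨(1 - j).toNat, by omega⟩
    exact h1 n
  · obtain ⟨n, rfl⟩ : ∃ n : ℕ, j = 2 + (n : ℕ) := ⟨(j - 2).toNat, by omega⟩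
    exact h2 n

/-- There are no bound states in the bands. -/
lemma jacobi_kernel_band {b : ℤ → ℝ} {c ξ : ℝ} (hb : ∀ j, j ≠ 1 → b j = c) {y : VertexL2}
    (hy : ∀ j, jacobi b y j = 2 * (ξ : ℂ) * y j)
    (hc : c ≠ 0) (hξ : |ξ| ≤ |c|) : y = 0 := by
  apply VertexL2.eq_zero_of_half_lines
  · exact eq_zero_of_tendsto_of_band hc hξ (y.tendsto_norm fun a b h => by omega)
      (jacobi_left hb hy)
  · exact eq_zero_of_tendsto_of_band hc hξ (y.tendsto_norm fun a b h => by omega)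
      (jacobi_right hb hy)

/-- The bound states outside of the bands. -/
lemma jacobi_kernel_gap {b : ℤ → ℝ} {c ξ : ℝ} (hb : ∀ j, j ≠ 1 → b j = c) {y : VertexL2}
    (hy : ∀ j, jacobi b y j = 2 * (ξ : ℂ) * y j) {ν : ℝ}
    (hν : |c| < |ν|) (hξ : ν ^ 2 + c ^ 2 = 2 * ξ * ν) :
    b 1 * y 1 = ν * y 2 ∧ b 1 * y 2 = ν * y 1 ∧ (y 1 = 0 → y = 0) := by
  have hν0 : (ν : ℂ) ≠ 0 := by exact_mod_cast abs_pos.1 ((abs_nonneg c).trans_lt hν)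
  have hξC : (ν : ℂ) ^ 2 + (c : ℂ) ^ 2 = 2 * ξ * ν := by exact_mod_cast hξ
  have r := geometric_of_bounded hν hξ (y.tendsto_norm (i := fun n => 2 + (n : ℤ))
    fun a b h => by simpa using h) (jacobi_right hb hy)
  have l := geometric_of_bounded hν hξ (y.tendsto_norm (i := fun n => 1 - (n : ℤ))
    fun a b h => by simpa using h) (jacobi_left hb hy)
  set x : ℤ → ℂ := fun j => y j
  -- Row 2 reads `c y_3 + b_1 y_1 = 2ξ y_2`. Decay gives `y_3 = (c/ν) y_2`, and `2ξ - c²/ν = ν`. Row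
  -- 1 is treated by the mirror image of this computation.
  have e1 : b 1 * y 1 = ν * y 2 := by
    have h : jacobi b x 2 = _ := hy 2
    have h0 : (ν : ℂ) * x (2 + (0 + 1 : ℕ)) = c * x (2 + (0 : ℕ)) := r 0
    change b 1 * x 1 = ν * x 2
    rw [jacobi, hb 2 (by norm_num)] at h
    norm_num at h h0
    apply mul_left_cancel₀ hν0
    linear_combination (ν : ℂ) * h - c * h0 - x 2 * hξC
  have e2 : b 1 * y 2 = ν * y 1 := by
    have h : jacobi b x 1 = _ := hy 1
    have h0 : (ν : ℂ) * x (1 - (0 + 1 : ℕ)) = c * x (1 - (0 : ℕ)) := l 0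
    change b 1 * x 2 = ν * x 1
    rw [jacobi, hb (1 - 1) (by norm_num)] at h
    norm_num at h h0
    apply mul_left_cancel₀ hν0
    linear_combination (ν : ℂ) * h - c * h0 - x 1 * hξC
  refine ⟨e1, e2, fun h1 => ?_⟩
  have h2 : y 2 = 0 := by
    rw [h1, mul_zero] at e1
    exact (mul_eq_zero.1 e1.symm).resolve_left hν0
  apply VertexL2.eq_zero_of_half_lines
  · intro n
    induction n with
    | zero => simpa using h1
    | succ n ih =>
      have := l n
      rw [ih, mul_zero] at this
      exact (mul_eq_zero.1 this).resolve_left hν0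
  · intro n
    induction n with
    | zero => simpa using h2
    | succ n ih =>
      have := r n
      rw [ih, mul_zero] at this
      exact (mul_eq_zero.1 this).resolve_left hν0

/-- The bound state of the perturbed Jacobi operator. -/
lemma exists_jacobi_bound_state {b : ℤ → ℝ} {c ξ ν : ℝ} (hb : ∀ j, j ≠ 1 → b j = c)
    (hν : |c| < |ν|) (hξ : ν ^ 2 + c ^ 2 = 2 * ξ * ν) (hb1 : b 1 ^ 2 = ν ^ 2) :
    ∃ y : VertexL2, (∀ j, jacobi b y j = 2 * (ξ : ℂ) * y j) ∧ y 1 = 1 := by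
  have hν0 : 0 < |ν| := (abs_nonneg c).trans_lt hν
  have hνR : ν ≠ 0 := abs_pos.1 hν0
  set l : ℝ := c / ν with hl
  set ε : ℝ := b 1 / ν with hε
  have hε2 : ε ^ 2 = 1 := by
    rw [hε, div_pow, hb1, div_self (pow_ne_zero 2 hνR)]
  have hl1 : l ^ 2 < 1 := by
    rw [hl, div_pow, div_lt_one (by positivity)]
    exact sq_lt_sq.2 hν
  have hlξ : ν * (1 + l ^ 2) = 2 * ξ := by
    rw [hl]
    field_simp
    linear_combination hξ
  have hcl : c = ν * l := by rw [hl]; field_simp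
  have hbε : b 1 = ν * ε := by rw [hε]; field_simp
  -- Geometric decay on either side of ring 1, with a relative sign `ε = ±1` fixed by the matching.
  -- For `c = 0` the convention `0 ^ 0 = 1` gives the state supported at the vertices 1 and 2.
  set Y : ℤ → ℝ := fun j => if 2 ≤ j then ε * l ^ (j - 2).toNat else l ^ (1 - j).toNat with hY
  have hYr : ∀ n : ℕ, Y (2 + n) = ε * l ^ n := fun n => by
    simp only [hY]
    rw [if_pos (by omega), add_sub_cancel_left, Int.toNat_natCast]
  have hYl : ∀ n : ℕ, Y (1 - n) = l ^ n := fun n => by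
    simp only [hY]
    rw [if_neg (by omega), sub_sub_cancel, Int.toNat_natCast]
  have hgeo : Summable fun n : ℕ => (l ^ 2) ^ n := summable_geometric_of_lt_one (sq_nonneg l) hl1
  have hsum : Summable fun j => ‖(Y j : ℂ)‖ ^ 2 := by
    have hsq : ∀ r : ℝ, ‖(r : ℂ)‖ ^ 2 = r ^ 2 := fun r => by
      rw [Complex.norm_real, Real.norm_eq_abs, sq_abs]
    simp only [hsq]
    rw [← (Equiv.addRight (2 : ℤ)).summable_iff]
    apply Summable.of_nat_of_neg_add_one
    · refine hgeo.congr fun n => ?_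
      simp only [Function.comp, Equiv.coe_addRight]
      rw [add_comm, hYr, mul_pow, hε2, one_mul, ← pow_mul, ← pow_mul, mul_comm]
    · refine hgeo.congr fun n => ?_
      simp only [Function.comp, Equiv.coe_addRight]
      rw [show -((n : ℤ) + 1) + 2 = 1 - n by ring, hYl, ← pow_mul, ← pow_mul, mul_comm]
  obtain ⟨y, hy, -⟩ := exists_lp_of_hasSum (F := fun j => (Y j : ℂ)) (Real.sqrt_nonneg _) hsum.hasSum
    (Real.sq_sqrt (tsum_nonneg fun _ => by positivity)).ge
  have hYrec : ∀ j, b j * Y (j + 1) + b (j - 1) * Y (j - 1) = 2 * ξ * Y j := by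
    intro j
    rw [← hlξ]
    by_cases h1 : j = 1
    · subst h1
      have e0 := hYl 1
      have e1 := hYl 0
      have e2 := hYr 0
      norm_num at e0 e1 e2 ⊢
      rw [e0, e1, e2, hb 0 (by norm_num), hcl, hbε]
      linear_combination ν * hε2
    by_cases h2 : j = 2
    · subst h2
      have e0 := hYl 0
      have e1 := hYr 0
      have e2 := hYr 1
      norm_num at e0 e1 e2 ⊢
      rw [e0, e1, e2, hb 2 (by norm_num), hcl, hbε]
      ring
    rw [hb j h1, hb (j - 1) (by omega), hcl]
    rcases lt_or_gt_of_ne h1 with h | h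
    · obtain ⟨n, rfl⟩ : ∃ n : ℕ, j = 1 - (n + 1 : ℕ) := ⟨(-j).toNat, by omega⟩
      rw [show (1 - ((n + 1 : ℕ) : ℤ) + 1) = 1 - (n : ℕ) by push_cast; ring,
        show (1 - ((n + 1 : ℕ) : ℤ) - 1) = 1 - (n + 2 : ℕ) by push_cast; ring, hYl, hYl, hYl]
      ring
    · obtain ⟨n, rfl⟩ : ∃ n : ℕ, j = 2 + (n + 1 : ℕ) := ⟨(j - 3).toNat, by omega⟩
      rw [show (2 + ((n + 1 : ℕ) : ℤ) + 1) = 2 + (n + 2 : ℕ) by push_cast; ring,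
        show (2 + ((n + 1 : ℕ) : ℤ) - 1) = 2 + (n : ℕ) by push_cast; ring, hYr, hYr, hYr]
      ring
  refine ⟨y, fun j => ?_, ?_⟩
  · rw [jacobi, hy, hy, hy]
    have := congrArg (fun r : ℝ => (r : ℂ)) (hYrec j)
    push_cast at this
    exact this
  · rw [hy]
    have := hYl 0
    norm_num at this
    rw [this]
    simp

/-! ### The discriminant -/

/-- At a non-real energy the discriminant avoids the interval `[-1, 1]`. -/
theorem im_sq_eq_zero_of_disc {α t : ℝ} {k : ℂ} (hS : sn k Real.pi ≠ 0) (ht : |t| ≤ 1)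
    (hd : disc α k = t) : (k ^ 2).im = 0 := by
  obtain ⟨p, q, hpq, hp⟩ : ∃ p q : ℝ, p ^ 2 + q ^ 2 = 1 ∧ p = t :=
    ⟨t, Real.sqrt (1 - t ^ 2), by
      rw [Real.sq_sqrt (by rw [abs_le] at ht; nlinarith [ht.1, ht.2])]; ring, rfl⟩
  set S := sn k Real.pi with hSd
  set C := cs k Real.pi with hCd
  set e : ℂ := ⟨p, q⟩ with he
  -- A Floquet solution on one period: `v π = e · v 0` with `|e| = 1`, and `e · v' 0 - v' π = (α/2)
  -- v π` because `Re e = disc α k`. It models a half-circle of a ring symmetric under exchange of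
  -- its halves, hence the coupling `α/2`.
  set v : ℝ → ℂ := fun x => S * cs k x + (e - C) * sn k x with hv
  set v₁ : ℝ → ℂ := fun x => S * (-k ^ 2 * sn k x) + (e - C) * cs k x with hv₁
  have dv : ∀ x, HasDerivAt v (v₁ x) x := fun x =>
    ((hasDerivAt_cs k x).const_mul S).add ((hasDerivAt_sn k x).const_mul (e - C))
  have dv₁ : ∀ x, HasDerivAt v₁ (-k ^ 2 * v x) x := fun x => by
    convert! (((hasDerivAt_sn k x).const_mul (-k ^ 2)).const_mul S).add
      ((hasDerivAt_cs k x).const_mul (e - C)) using 1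
    simp only [hv]
    ring
  have hre : ∀ {φ φ' : ℝ → ℂ}, (∀ x, HasDerivAt φ (φ' x) x) →
      ∀ x, HasDerivAt (fun x => (φ x).re) (φ' x).re x := fun h x =>
    Complex.reCLM.hasFDerivAt.comp_hasDerivAt x (h x)
  have him : ∀ {φ φ' : ℝ → ℂ}, (∀ x, HasDerivAt φ (φ' x) x) →
      ∀ x, HasDerivAt (fun x => (φ x).im) (φ' x).im x := fun h x =>
    Complex.imCLM.hasFDerivAt.comp_hasDerivAt x (h x)
  -- This is `Im (v' · conj v)`. Its increment over the period is `-Im (k²) ∫ |v|²`; it vanishes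
  -- since the multiplier is unimodular and `α` is real.
  set B : ℝ → ℝ := fun x => (v₁ x).im * (v x).re - (v₁ x).re * (v x).im with hB
  have dB : ∀ x, HasDerivAt B (-(k ^ 2).im * Complex.normSq (v x)) x := fun x => by
    convert! ((him dv₁ x).mul (hre dv x)).sub ((hre dv₁ x).mul (him dv x)) using 1
    simp only [neg_mul, Complex.neg_re, Complex.neg_im, Complex.mul_re, Complex.mul_im,
      Complex.normSq_apply]
    ring
  have hvc : Continuous v := continuous_iff_continuousAt.2 fun x => (dv x).continuousAt
  have hnc : Continuous fun x => Complex.normSq (v x) := Complex.continuous_normSq.comp hvc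
  have hI := intervalIntegral.integral_eq_sub_of_hasDerivAt (a := 0) (b := Real.pi)
    (fun x _ => dB x) (Continuous.intervalIntegrable (by fun_prop) _ _)
  rw [intervalIntegral.integral_const_mul] at hI
  have hpos : 0 < ∫ x in (0 : ℝ)..Real.pi, Complex.normSq (v x) := by
    refine intervalIntegral.integral_pos Real.pi_pos hnc.continuousOn
      (fun _ _ => Complex.normSq_nonneg _) ⟨0, ⟨le_rfl, Real.pi_pos.le⟩, ?_⟩
    rw [Complex.normSq_pos]
    simpa [hv] using hS
  have hCS : C ^ 2 + k ^ 2 * S ^ 2 = 1 := cs_sq_add k Real.pi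
  have v0 : v 0 = S := by simp [hv]
  have v10 : v₁ 0 = e - C := by simp [hv₁]
  have vp : v Real.pi = e * S := by simp only [hv, ← hSd, ← hCd]; ring
  have v1p : v₁ Real.pi = e * C - 1 := by
    simp only [hv₁, ← hSd, ← hCd]; linear_combination -hCS
  have hdre : C.re + α / 4 * S.re = p := by
    have := congrArg Complex.re hd
    rw [disc] at this
    simpa [hp, ← hSd, ← hCd] using this
  have hdim : C.im + α / 4 * S.im = 0 := by
    have := congrArg Complex.im hd
    rw [disc] at this
    simpa [hp, ← hSd, ← hCd] using this
  have hBB : B Real.pi - B 0 = 0 := by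
    simp only [hB, v0, v10, vp, v1p, he, Complex.sub_re, Complex.sub_im, Complex.mul_re,
      Complex.mul_im, Complex.one_re, Complex.one_im]
    linear_combination (C.im * S.re - C.re * S.im) * hpq + 2 * S.re * hdim - 2 * S.im * hdre
  rw [hBB] at hI
  rcases mul_eq_zero.1 hI with h | h
  · exact neg_eq_zero.1 h
  · exact absurd h hpos.ne'

/-- The singularity at `k = 0` is removable: `sn k x` is `x` times the slope of `sin` between `0`
and `kx`. -/
lemma continuous_sn_left (x : ℝ) : Continuous fun k => sn k x := by
  have h1 : (fun k => sn k x) = fun k => dslope Complex.sin 0 (k * x) * x := by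
    funext k
    by_cases hx : (x : ℂ) = 0
    · simp [sn, hx]
    by_cases hk : k = 0
    · simp [sn, hk]
    · rw [dslope_of_ne _ (mul_ne_zero hk hx), slope_def_field]
      simp only [sn, if_neg hk, Complex.sin_zero, sub_zero]
      field_simp
  rw [h1]
  have h2 : Continuous (dslope Complex.sin 0) := by
    rw [← continuousOn_univ, continuousOn_dslope Filter.univ_mem]
    exact ⟨Complex.continuous_sin.continuousOn, Complex.differentiableAt_sin⟩
  fun_prop

/-! ### The discriminant at real energies -/

/-- A square root of a real energy. -/
def momentum (E : ℝ) : ℂ := Real.sqrt E + Real.sqrt (-E) * Complex.I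

lemma continuous_momentum : Continuous momentum := by
  unfold momentum
  fun_prop

lemma momentum_of_nonneg {E : ℝ} (hE : 0 ≤ E) : momentum E = (Real.sqrt E : ℝ) := by
  simp [momentum, Real.sqrt_eq_zero_of_nonpos (neg_nonpos.2 hE)]

lemma momentum_of_nonpos {E : ℝ} (hE : E ≤ 0) : momentum E = (Real.sqrt (-E) : ℝ) * Complex.I := by
  simp [momentum, Real.sqrt_eq_zero_of_nonpos hE]

lemma momentum_sq (E : ℝ) : momentum E ^ 2 = E := by
  rcases le_total 0 E with h | h
  · rw [momentum_of_nonneg h, ← Complex.ofReal_pow, Real.sq_sqrt h]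
  · rw [momentum_of_nonpos h, mul_pow, Complex.I_sq, ← Complex.ofReal_pow,
      Real.sq_sqrt (neg_nonneg.2 h)]
    push_cast
    ring

/-- The real values of `cs` and `sn` at the end of a half-circle. -/
def csE (E : ℝ) : ℝ := (cs (momentum E) Real.pi).re

def snE (E : ℝ) : ℝ := (sn (momentum E) Real.pi).re

lemma csE_of_nonneg {E : ℝ} (hE : 0 ≤ E) : cs (momentum E) Real.pi = (csE E : ℝ) ∧
    csE E = Real.cos (Real.sqrt E * Real.pi) := by
  have : cs (momentum E) Real.pi = (Real.cos (Real.sqrt E * Real.pi) : ℝ) := by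
    rw [cs, momentum_of_nonneg hE]
    push_cast
    rfl
  refine ⟨?_, ?_⟩ <;> rw [csE, this, Complex.ofReal_re]

lemma csE_of_nonpos {E : ℝ} (hE : E ≤ 0) : cs (momentum E) Real.pi = (csE E : ℝ) ∧
    csE E = Real.cosh (Real.sqrt (-E) * Real.pi) := by
  have : cs (momentum E) Real.pi = (Real.cosh (Real.sqrt (-E) * Real.pi) : ℝ) := by
    rw [cs, momentum_of_nonpos hE, mul_right_comm, Complex.cos_mul_I]
    push_cast
    rfl
  refine ⟨?_, ?_⟩ <;> rw [csE, this, Complex.ofReal_re]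

lemma snE_of_nonneg {E : ℝ} (hE : 0 ≤ E) : sn (momentum E) Real.pi = (snE E : ℝ) ∧
    Real.sqrt E * snE E = Real.sin (Real.sqrt E * Real.pi) := by
  have h : sn (momentum E) Real.pi = (snE E : ℝ) := by
    rw [snE, momentum_of_nonneg hE, sn]
    split_ifs with h0
    · rw [Complex.ofReal_re]
    · rw [← Complex.ofReal_mul, ← Complex.ofReal_sin, ← Complex.ofReal_div, Complex.ofReal_re]
  refine ⟨h, ?_⟩
  have := mul_sn (momentum E) Real.pi
  rw [h, momentum_of_nonneg hE] at this
  exact_mod_cast this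

lemma snE_of_nonpos {E : ℝ} (hE : E ≤ 0) : sn (momentum E) Real.pi = (snE E : ℝ) ∧
    Real.sqrt (-E) * snE E = Real.sinh (Real.sqrt (-E) * Real.pi) := by
  have h : sn (momentum E) Real.pi = (snE E : ℝ) := by
    rw [snE, momentum_of_nonpos hE, sn]
    split_ifs with h0
    · rw [Complex.ofReal_re]
    · rw [mul_right_comm, Complex.sin_mul_I, mul_div_mul_right _ _ Complex.I_ne_zero,
        ← Complex.ofReal_mul, ← Complex.ofReal_sinh, ← Complex.ofReal_div, Complex.ofReal_re]
  refine ⟨h, ?_⟩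
  have := mul_sn (momentum E) Real.pi
  rw [h, momentum_of_nonpos hE, mul_right_comm, mul_right_comm _ Complex.I, Complex.sin_mul_I] at this
  exact_mod_cast mul_right_cancel₀ Complex.I_ne_zero this

lemma cs_momentum (E : ℝ) : cs (momentum E) Real.pi = (csE E : ℝ) :=
  (le_total 0 E).elim (fun h => (csE_of_nonneg h).1) fun h => (csE_of_nonpos h).1

lemma sn_momentum (E : ℝ) : sn (momentum E) Real.pi = (snE E : ℝ) :=
  (le_total 0 E).elim (fun h => (snE_of_nonneg h).1) fun h => (snE_of_nonpos h).1

lemma continuous_csE : Continuous csE := by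
  have h1 := continuous_momentum
  unfold csE cs
  fun_prop

lemma continuous_snE : Continuous snE :=
  Complex.continuous_re.comp ((continuous_sn_left Real.pi).comp continuous_momentum)

/-- The discriminant at a real energy. -/
def discE (α E : ℝ) : ℝ := csE E + α / 4 * snE E

lemma continuous_discE (α : ℝ) : Continuous (discE α) := by
  have := continuous_csE
  have := continuous_snE
  unfold discE
  fun_prop

lemma disc_momentum (α E : ℝ) : disc α (momentum E) = discE α E := by
  rw [disc, cs_momentum, sn_momentum, discE]
  push_cast
  rfl

/-- The intervals between the points `n ^ 2`, `n ≥ 1`. -/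
def energyInterval (n : ℕ) : Set ℝ := {E | (n = 0 ∨ (n : ℝ) ^ 2 < E) ∧ E < ((n : ℝ) + 1) ^ 2}

lemma sqrt_mem_of_mem_energyInterval {n : ℕ} {E : ℝ} (hE : E ∈ energyInterval n) (h0 : 0 < E) :
    (n : ℝ) < Real.sqrt E ∧ Real.sqrt E < n + 1 := by
  constructor
  · rcases hE.1 with rfl | h
    · simpa using h0
    · exact Real.lt_sqrt_of_sq_lt h
  · rw [Real.sqrt_lt' (by positivity)]
    exact hE.2

/-- The zeros of `snE` are the squares `n ^ 2`, `n ≥ 1`, and it changes sign at each of them.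
Nonpositive energies lie in the lowest interval only, where `sinh` replaces `sin`. -/
lemma snE_pos {n : ℕ} {E : ℝ} (hE : E ∈ energyInterval n) : 0 < (-1) ^ n * snE E := by
  rcases lt_trichotomy E 0 with h | h | h
  · have hn : n = 0 := by
      rcases hE.1 with hn | hn
      · exact hn
      · nlinarith [sq_nonneg (n : ℝ)]
    have hs : 0 < Real.sqrt (-E) := Real.sqrt_pos.2 (by linarith)
    have h2 := (snE_of_nonpos h.le).2
    rw [hn, pow_zero, one_mul]
    have h3 : 0 < Real.sqrt (-E) * snE E := by
      rw [h2, Real.sinh_pos_iff]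
      positivity
    exact (pos_iff_pos_of_mul_pos h3).1 hs
  · have hn : n = 0 := by
      rcases hE.1 with hn | hn
      · exact hn
      · nlinarith [sq_nonneg (n : ℝ)]
    rw [hn, h, snE, momentum, sn]
    simp [Real.pi_pos]
  · obtain ⟨h1, h2⟩ := sqrt_mem_of_mem_energyInterval hE h
    have h3 := (snE_of_nonneg h.le).2
    have h4 : 0 < (-1) ^ n * Real.sin (Real.sqrt E * Real.pi) := by
      have e : Real.sqrt E * Real.pi = (Real.sqrt E * Real.pi - n * Real.pi) + n * Real.pi := by ring
      rw [e, Real.sin_add_nat_mul_pi, ← mul_assoc, ← mul_pow]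
      norm_num
      apply Real.sin_pos_of_pos_of_lt_pi <;> nlinarith [Real.pi_pos]
    rw [← h3] at h4
    have hs : 0 < Real.sqrt E := Real.sqrt_pos.2 h
    have h5 : 0 < Real.sqrt E * ((-1) ^ n * snE E) := by linarith
    exact (pos_iff_pos_of_mul_pos h5).1 hs

/-! ### Monotonicity and the crossings of a level -/

/-- The function `(csE - t) / snE`, which is decreasing between the points `n ^ 2`. -/
def ratioE (t E : ℝ) : ℝ := (csE E - t) / snE E

lemma hasDerivAt_ratio_trig {t θ : ℝ} (hθ : Real.sin θ ≠ 0) :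
    HasDerivAt (fun θ => θ * (Real.cos θ - t) / Real.sin θ)
      (((Real.cos θ - t) * Real.sin θ - θ * (1 - t * Real.cos θ)) / Real.sin θ ^ 2) θ := by
  convert! (((hasDerivAt_id θ).mul ((Real.hasDerivAt_cos θ).sub_const t)).div
    (Real.hasDerivAt_sin θ) hθ) using 1
  simp only [id, Pi.mul_apply]
  congr 1
  linear_combination θ * Real.sin_sq_add_cos_sq θ

lemma hasDerivAt_ratio_hyp {t θ : ℝ} (hθ : Real.sinh θ ≠ 0) :
    HasDerivAt (fun θ => θ * (Real.cosh θ - t) / Real.sinh θ)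
      (((Real.cosh θ - t) * Real.sinh θ - θ * (1 - t * Real.cosh θ)) / Real.sinh θ ^ 2) θ := by
  convert! (((hasDerivAt_id θ).mul ((Real.hasDerivAt_cosh θ).sub_const t)).div
    (Real.hasDerivAt_sinh θ) hθ) using 1
  simp only [id, Pi.mul_apply]
  congr 1
  linear_combination θ * Real.cosh_sq_sub_sinh_sq θ

/-- The inequality `|cos θ - t| ≤ 1 - t cos θ` comes from `(1 ∓ cos θ)(1 ± t) ≥ 0`; together with
`|sin θ| < θ` it makes the numerator of the derivative negative. -/
lemma deriv_ratio_trig_neg {t θ : ℝ} (ht : |t| < 1) (hθ : 0 < θ) :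
    (Real.cos θ - t) * Real.sin θ - θ * (1 - t * Real.cos θ) < 0 := by
  obtain ⟨t1, t2⟩ := abs_lt.1 ht
  have hs : |Real.sin θ| < θ := by
    have := Real.abs_sin_lt_abs hθ.ne'
    rwa [abs_of_pos hθ] at this
  have hc1 := Real.cos_le_one θ
  have hc2 := Real.neg_one_le_cos θ
  have hpos : 0 < 1 - t * Real.cos θ := by
    have h : |t * Real.cos θ| ≤ |t| := by
      rw [abs_mul]
      exact mul_le_of_le_one_right (abs_nonneg t) (Real.abs_cos_le_one θ)
    linarith [le_abs_self (t * Real.cos θ)]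
  have h1 : |Real.cos θ - t| ≤ 1 - t * Real.cos θ := by
    rw [abs_le]
    constructor <;> nlinarith
  have h2 : (Real.cos θ - t) * Real.sin θ ≤ (1 - t * Real.cos θ) * |Real.sin θ| := by
    calc _ ≤ |(Real.cos θ - t) * Real.sin θ| := le_abs_self _
      _ = |Real.cos θ - t| * |Real.sin θ| := abs_mul _ _
      _ ≤ _ := mul_le_mul_of_nonneg_right h1 (abs_nonneg _)
  nlinarith [mul_lt_mul_of_pos_left hs hpos]

/-- Here `θ < sinh θ` and `cosh θ - t - (1 - t cosh θ) = (cosh θ - 1)(1 + t) ≥ 0`. The sign is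
opposite to the trigonometric case because `θ = √(-E) π` decreases with `E`. -/
lemma deriv_ratio_hyp_pos {t θ : ℝ} (ht : |t| < 1) (hθ : 0 < θ) :
    0 < (Real.cosh θ - t) * Real.sinh θ - θ * (1 - t * Real.cosh θ) := by
  obtain ⟨t1, t2⟩ := abs_lt.1 ht
  have hs : θ < Real.sinh θ := Real.self_lt_sinh_iff.2 hθ
  have hc := Real.one_le_cosh θ
  have h1 : 0 < Real.cosh θ - t := by linarith
  have h2 : 1 - t * Real.cosh θ ≤ Real.cosh θ - t := by nlinarith
  nlinarith [mul_lt_mul_of_pos_left hs h1, mul_le_mul_of_nonneg_left h2 hθ.le]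

lemma deriv_ratioE_of_pos {t E : ℝ} (ht : |t| < 1) (hE : 0 < E) (hS : snE E ≠ 0) :
    deriv (ratioE t) E < 0 := by
  have hs : 0 < Real.sqrt E := Real.sqrt_pos.2 hE
  have hsin : Real.sin (Real.sqrt E * Real.pi) ≠ 0 := by
    rw [← (snE_of_nonneg hE.le).2]
    exact mul_ne_zero hs.ne' hS
  have heq : ratioE t =ᶠ[nhds E] fun E =>
      (Real.sqrt E * Real.pi) * (Real.cos (Real.sqrt E * Real.pi) - t) /
        Real.sin (Real.sqrt E * Real.pi) / Real.pi := by
    filter_upwards [lt_mem_nhds hE] with x hx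
    have hx' : 0 < Real.sqrt x := Real.sqrt_pos.2 hx
    have hpi := Real.pi_ne_zero
    rw [ratioE, (csE_of_nonneg hx.le).2, ← (snE_of_nonneg hx.le).2]
    by_cases h : snE x = 0
    · simp [h]
    · field_simp
  have hd := ((hasDerivAt_ratio_trig (t := t) hsin).comp E
    ((Real.hasDerivAt_sqrt hE.ne').mul_const Real.pi)).div_const Real.pi
  have hd' := HasDerivAt.congr_of_eventuallyEq hd heq
  rw [hd'.deriv]
  have h1 := deriv_ratio_trig_neg ht (mul_pos hs Real.pi_pos)
  have h2 : 0 < Real.sin (Real.sqrt E * Real.pi) ^ 2 := by positivity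
  refine div_neg_of_neg_of_pos (mul_neg_of_neg_of_pos (div_neg_of_neg_of_pos h1 h2) ?_) Real.pi_pos
  positivity

lemma deriv_ratioE_of_neg {t E : ℝ} (ht : |t| < 1) (hE : E < 0) : deriv (ratioE t) E < 0 := by
  have hs : 0 < Real.sqrt (-E) := Real.sqrt_pos.2 (by linarith)
  have hsinh : 0 < Real.sinh (Real.sqrt (-E) * Real.pi) := by
    rw [Real.sinh_pos_iff]
    positivity
  have heq : ratioE t =ᶠ[nhds E] fun E =>
      (Real.sqrt (-E) * Real.pi) * (Real.cosh (Real.sqrt (-E) * Real.pi) - t) /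
        Real.sinh (Real.sqrt (-E) * Real.pi) / Real.pi := by
    filter_upwards [gt_mem_nhds hE] with x hx
    have hx' : 0 < Real.sqrt (-x) := Real.sqrt_pos.2 (by linarith)
    have hpi := Real.pi_ne_zero
    rw [ratioE, (csE_of_nonpos hx.le).2, ← (snE_of_nonpos hx.le).2]
    by_cases h : snE x = 0
    · simp [h]
    · field_simp
  have hneg : HasDerivAt (fun E : ℝ => -E) (-1) E := (hasDerivAt_id E).neg
  have hd := ((hasDerivAt_ratio_hyp (t := t) hsinh.ne').comp E
    ((hneg.sqrt (neg_ne_zero.2 hE.ne)).mul_const Real.pi)).div_const Real.pi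
  have hd' := HasDerivAt.congr_of_eventuallyEq hd heq
  rw [hd'.deriv]
  have h1 := deriv_ratio_hyp_pos ht (mul_pos hs Real.pi_pos)
  have h2 : 0 < Real.sinh (Real.sqrt (-E) * Real.pi) ^ 2 := by positivity
  refine div_neg_of_neg_of_pos (mul_neg_of_pos_of_neg (div_pos h1 h2) ?_) Real.pi_pos
  exact mul_neg_of_neg_of_pos (div_neg_of_neg_of_pos (by norm_num) (by positivity)) Real.pi_pos

lemma snE_ne_zero {n : ℕ} {E : ℝ} (hE : E ∈ energyInterval n) : snE E ≠ 0 := fun h => by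
  have := snE_pos hE
  rw [h, mul_zero] at this
  exact this.false

/-- The lowest interval contains the energy `0`, where neither the trigonometric nor the hyperbolic
formula supplies a derivative; the two sides are glued there by continuity. -/
lemma strictAntiOn_ratioE {t : ℝ} (ht : |t| < 1) (n : ℕ) :
    StrictAntiOn (ratioE t) (energyInterval n) := by
  have hcont : ContinuousOn (ratioE t) (energyInterval n) := by
    have h1 := continuous_csE
    have h2 := continuous_snE
    exact (h1.sub continuous_const).continuousOn.div h2.continuousOn fun E hE => snE_ne_zero hE
  rcases Nat.eq_zero_or_pos n with rfl | hn
  · have hI : energyInterval 0 = Iic 0 ∪ Ico 0 1 := by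
      ext E
      simp only [energyInterval, mem_ofPred_eq, mem_union, mem_Iic, mem_Ico, true_or, true_and,
        Nat.cast_zero, zero_add, one_pow]
      constructor
      · intro h
        rcases le_total E 0 with h' | h'
        · exact Or.inl h'
        · exact Or.inr ⟨h', h⟩
      · rintro (h | h)
        · linarith
        · exact h.2
    rw [hI] at hcont ⊢
    refine StrictAntiOn.union (c := 0) ?_ ?_ ⟨mem_Iic.2 le_rfl, fun _ h => h⟩
      ⟨⟨le_rfl, one_pos⟩, fun _ h => h.1⟩
    · refine strictAntiOn_of_deriv_neg (convex_Iic 0) (hcont.mono subset_union_left) fun E hE => ?_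
      rw [interior_Iic] at hE
      exact deriv_ratioE_of_neg ht hE
    · refine strictAntiOn_of_deriv_neg (convex_Ico 0 1) (hcont.mono subset_union_right)
        fun E hE => ?_
      rw [interior_Ico] at hE
      refine deriv_ratioE_of_pos ht hE.1 (snE_ne_zero (n := 0) ?_)
      rw [hI]
      exact Or.inr ⟨hE.1.le, hE.2⟩
  · have hI : energyInterval n = Ioo ((n : ℝ) ^ 2) (((n : ℝ) + 1) ^ 2) := by
      ext E
      simp [energyInterval, hn.ne']
    rw [hI] at hcont ⊢
    refine strictAntiOn_of_deriv_neg (convex_Ioo _ _) hcont fun E hE => ?_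
    rw [interior_Ioo] at hE
    refine deriv_ratioE_of_pos ht (lt_of_le_of_lt (sq_nonneg _) hE.1) (snE_ne_zero (n := n) ?_)
    rw [hI]
    exact hE

lemma snE_sq_nat {n : ℕ} (hn : n ≠ 0) : snE ((n : ℝ) ^ 2) = 0 := by
  have h := (snE_of_nonneg (sq_nonneg (n : ℝ))).2
  rw [Real.sqrt_sq (Nat.cast_nonneg n), Real.sin_nat_mul_pi] at h
  exact (mul_eq_zero.1 h).resolve_left (by exact_mod_cast hn)

lemma discE_sq_nat (α : ℝ) {n : ℕ} (hn : n ≠ 0) : discE α ((n : ℝ) ^ 2) = (-1) ^ n := by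
  rw [discE, snE_sq_nat hn, (csE_of_nonneg (sq_nonneg (n : ℝ))).2,
    Real.sqrt_sq (Nat.cast_nonneg n), Real.cos_nat_mul_pi]
  ring

/-- With `κ = |α| + 1` and `E = -κ²`, one has `|α| snE E ≤ κ snE E = sinh κπ ≤ cosh κπ`, so the
discriminant is at least `(3/4) cosh κπ`, and `cosh κπ ≥ 2`. -/
lemma exists_discE_ge_one (α : ℝ) : ∃ E ≤ 0, 1 ≤ discE α E := by
  set κ := |α| + 1 with hκ
  have hκ1 : 1 ≤ κ := by rw [hκ]; linarith [abs_nonneg α]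
  have hE : -κ ^ 2 ≤ 0 := by nlinarith
  have hs : Real.sqrt (-(-κ ^ 2)) = κ := by rw [neg_neg, Real.sqrt_sq (by linarith)]
  refine ⟨-κ ^ 2, hE, ?_⟩
  have h1 := (csE_of_nonpos hE).2
  have h2 := (snE_of_nonpos hE).2
  rw [hs] at h1 h2
  set x := κ * Real.pi with hx
  have hx3 : 3 ≤ x := by nlinarith [Real.pi_gt_three]
  have hc : 2 ≤ Real.cosh x := by
    rw [Real.cosh_eq]
    have := Real.add_one_le_exp x
    have := Real.exp_pos (-x)
    linarith
  have hsc : Real.sinh x ≤ Real.cosh x := (Real.sinh_lt_cosh x).le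
  have hs0 : 0 ≤ Real.sinh x := Real.sinh_nonneg_iff.2 (by linarith)
  have hS0 : 0 ≤ snE (-κ ^ 2) := by
    by_contra! h
    nlinarith
  have hb : |α| * snE (-κ ^ 2) ≤ Real.cosh x := by
    calc |α| * snE (-κ ^ 2) ≤ κ * snE (-κ ^ 2) :=
          mul_le_mul_of_nonneg_right (by rw [hκ]; linarith) hS0
      _ ≤ _ := by rw [h2]; exact hsc
  have hb2 : -(|α| * snE (-κ ^ 2)) ≤ α * snE (-κ ^ 2) := by
    rw [← neg_mul]
    exact mul_le_mul_of_nonneg_right (neg_abs_le α) hS0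
  rw [discE, h1]
  linarith

/-- In each of the intervals, the discriminant crosses every level in `(-1, 1)` exactly once. -/
theorem exists_crossing (α : ℝ) (n : ℕ) {t : ℝ} (ht : |t| < 1) :
    ∃ E₀ ∈ energyInterval n, discE α E₀ = t ∧ ∀ E ∈ energyInterval n,
      (E < E₀ → 0 < (-1) ^ n * (discE α E - t)) ∧ (E₀ < E → (-1) ^ n * (discE α E - t) < 0) := by
  have hsgn : ((-1 : ℝ) ^ n) * (-1) ^ n = 1 := by rw [← mul_pow]; norm_num
  have hsgn' : |(-1 : ℝ) ^ n| = 1 := by rw [abs_pow]; norm_num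
  -- For `n ≥ 1` the left end is `n ^ 2`. The lowest interval has none, so a sufficiently negative
  -- energy takes its place.
  obtain ⟨l, hl1, hl2, hl3⟩ : ∃ l : ℝ, l ≤ ((n : ℝ) + 1) ^ 2 ∧ 1 ≤ (-1) ^ n * discE α l ∧
      ∀ E, l < E → (n = 0 ∨ (n : ℝ) ^ 2 < E) := by
    rcases Nat.eq_zero_or_pos n with rfl | hn
    · obtain ⟨E, hE, h⟩ := exists_discE_ge_one α
      exact ⟨E, hE.trans (by positivity), by simpa using h, fun _ _ => Or.inl rfl⟩
    · refine ⟨(n : ℝ) ^ 2, by nlinarith [(Nat.cast_nonneg n : (0 : ℝ) ≤ n)], ?_,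
        fun E hE => Or.inr hE⟩
      rw [discE_sq_nat α hn.ne', hsgn]
  have hr : (-1) ^ n * discE α (((n : ℝ) + 1) ^ 2) = -1 := by
    have := discE_sq_nat α (Nat.succ_ne_zero n)
    push_cast at this
    rw [this, pow_succ]
    linear_combination -hsgn
  have hivt := intermediate_value_Ioo' hl1 (f := fun E => (-1) ^ n * discE α E)
    ((continuous_const.mul (continuous_discE α)).continuousOn)
  have htn : |(-1) ^ n * t| < 1 := by rw [abs_mul, hsgn', one_mul]; exact ht
  obtain ⟨E₀, hE₀, h₀⟩ := hivt (show (-1) ^ n * t ∈ _ from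
    ⟨by simp only [hr]; exact (abs_lt.1 htn).1, (abs_lt.1 htn).2.trans_le hl2⟩)
  have hmem : E₀ ∈ energyInterval n := ⟨hl3 E₀ hE₀.1, hE₀.2⟩
  have hD : discE α E₀ = t := by
    have : (-1 : ℝ) ^ n ≠ 0 := by positivity
    exact mul_left_cancel₀ this h₀
  -- After division by `snE` the coupling enters only as the additive constant `α / 4`, so
  -- uniqueness and the sign on either side hold for every `α`.
  have hfac : ∀ E ∈ energyInterval n,
      (-1) ^ n * (discE α E - t) = ((-1) ^ n * snE E) * (ratioE t E - ratioE t E₀) := by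
    have hg : ∀ E ∈ energyInterval n, discE α E - t = snE E * (ratioE t E + α / 4) := fun E hE => by
      have := snE_ne_zero hE
      rw [discE, ratioE]
      field_simp
      ring
    have h0 : ratioE t E₀ = -(α / 4) := by
      have h := hg E₀ hmem
      rw [hD, sub_self] at h
      have := (mul_eq_zero.1 h.symm).resolve_left (snE_ne_zero hmem)
      linarith
    intro E hE
    rw [hg E hE, h0]
    ring
  have hanti := strictAntiOn_ratioE ht n
  refine ⟨E₀, hmem, hD, fun E hE => ⟨fun h => ?_, fun h => ?_⟩⟩
  · rw [hfac E hE]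
    exact mul_pos (snE_pos hE) (sub_pos.2 (hanti hE hmem h))
  · rw [hfac E hE]
    exact mul_neg_of_pos_of_neg (snE_pos hE) (sub_neg.2 (hanti hmem hE h))

end RingChain

/-! ### Eigenvectors and resolvent bounds through the graph -/

namespace UnboundedOp

variable {H : Type*} [NormedAddCommGroup H] [NormedSpace ℂ H]

lemma mem_eigenspace_iff (T : H →ₗ.[ℂ] H) (z : ℂ) (f : H) :
    f ∈ eigenspace T z ↔ (f, z • f) ∈ T.graph := by
  rw [LinearPMap.mem_graph_iff, eigenspace, Submodule.mem_map]
  constructor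
  · rintro ⟨g, hg, rfl⟩
    refine ⟨g, rfl, ?_⟩
    exact sub_eq_zero.1 hg
  · rintro ⟨g, rfl, hg⟩
    exact ⟨g, sub_eq_zero.2 hg, rfl⟩

lemma mem_spectrum_of_mem_eigenspace (T : H →ₗ.[ℂ] H) (z : ℂ) {f : H} (hf : f ∈ eigenspace T z)
    (h0 : f ≠ 0) : z ∈ spectrum T := by
  rintro ⟨R, -, hR⟩
  rw [mem_eigenspace_iff, LinearPMap.mem_graph_iff] at hf
  obtain ⟨g, rfl, hg⟩ := hf
  have := hR g
  rw [hg, sub_self, map_zero] at this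
  exact h0 this.symm

/-- A uniform resolvent bound on the solutions of `(T - z) f = h`. -/
lemma exists_bound_of_mem_resolventSet (T : H →ₗ.[ℂ] H) {z : ℂ} (hz : z ∈ resolventSet T) :
    ∃ M : ℝ, ∀ f h : H, (f, h + z • f) ∈ T.graph → ‖f‖ ≤ M * ‖h‖ := by
  obtain ⟨R, -, hR⟩ := hz
  refine ⟨‖R‖, fun f h hf => ?_⟩
  rw [LinearPMap.mem_graph_iff] at hf
  obtain ⟨g, rfl, hg⟩ := hf
  have := hR g
  rw [hg, add_sub_cancel_right] at this
  rw [← this]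
  exact R.le_opNorm h

end UnboundedOp

/-! ### Flat bands and truncated Bloch waves -/

namespace RingChain

/-- A family of eigenfunctions separated by coordinates spans an infinite-dimensional space. -/
lemma not_finiteDimensional_of_separated {V : Submodule ℂ ChainL2} {f : ℕ → ChainL2}
    {p : ℕ → ℤ × Arc} (hf : ∀ m, f m ∈ V) (h0 : ∀ m, f m (p m) ≠ 0)
    (hs : ∀ m n, m ≠ n → f n (p m) = 0) : ¬ FiniteDimensional ℂ V := by
  intro hfin
  have hli : LinearIndependent ℂ fun m => (⟨f m, hf m⟩ : V) := by
    rw [linearIndependent_iff']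
    intro s c hc i hi
    have h1 : ∑ m ∈ s, c m • f m = 0 := by
      have := congrArg (Submodule.subtype V) hc
      simpa using this
    have h2 : (∑ m ∈ s, c m • f m : ChainL2) (p i) = 0 := by rw [h1]; rfl
    have h3 : (∑ m ∈ s, c m • f m : ChainL2) (p i) = ∑ m ∈ s, c m • f m (p i) := by
      rw [lp.coeFn_sum, Finset.sum_apply]
      rfl
    rw [h3, Finset.sum_eq_single_of_mem i hi fun m _ hm => by rw [hs i m hm.symm, smul_zero]] at h2
    exact (smul_eq_zero.1 h2).resolve_right (h0 i)
  have := hli.finite_of_isNoetherian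
  exact not_finite ℕ

lemma exists_lp_of_finite_support {ι : Type*} {E : ι → Type*} [∀ i, NormedAddCommGroup (E i)]
    {F : ∀ i, E i} (s : Finset ι) (hF : ∀ i ∉ s, F i = 0) :
    ∃ f : lp E 2, (∀ i, f i = F i) ∧ ‖f‖ ^ 2 = ∑ i ∈ s, ‖F i‖ ^ 2 := by
  have hs : HasSum (fun i => ‖F i‖ ^ 2) (∑ i ∈ s, ‖F i‖ ^ 2) :=
    hasSum_sum_of_ne_finset_zero fun i hi => by rw [hF i hi, norm_zero]; norm_num
  obtain ⟨f, hf, -⟩ := exists_lp_of_hasSum (Real.sqrt_nonneg _) hs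
    (Real.sq_sqrt (Finset.sum_nonneg fun _ _ => by positivity)).ge
  refine ⟨f, hf, ?_⟩
  have h1 := lp_hasSum_sq f
  simp only [hf] at h1
  exact h1.unique hs

/-- Functions in the domain of the Hamiltonian built from smooth functions on finitely many rings. -/
lemma exists_actsAs_of_smooth (α : ℝ) (A : ℤ → ℝ) (z : ℂ) (T : Finset ℤ)
    {v v₁ q : ℤ → Arc → ℝ → ℂ} {y : ℤ → ℂ} (hv : ∀ j s x, HasDerivAt (v j s) (v₁ j s x) x)
    (hv₁ : ∀ j s x, HasDerivAt (v₁ j s) (q j s x) x) (hq : ∀ j s, Continuous (q j s))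
    (hT : ∀ j ∉ T, ∀ s x, v j s x = 0 ∧ q j s x = 0)
    (h0 : ∀ j s, v j s 0 = y j)
    (h1 : ∀ j s, v j s Real.pi = gauge (arcPotential (A j) s) Real.pi * y (j + 1))
    (hδ : ∀ j, v₁ j Arc.upper 0 + v₁ j Arc.lower 0 - (gauge (-A (j - 1)) Real.pi *
      v₁ (j - 1) Arc.upper Real.pi + gauge (A (j - 1)) Real.pi * v₁ (j - 1) Arc.lower Real.pi) =
      α * y j) :
    ∃ (f h : ChainL2) (u u' : ℤ → Arc → ℝ → ℂ) (w : ℤ → Arc → ArcL2),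
      ActsAs α A f (h + z • f) u u' w ∧
      (∀ j s, f (j, s) =ᵐ[arcMeasure] fun x => gauge (-arcPotential (A j) s) x * v j s x) ∧
      ∀ j s, h (j, s) =ᵐ[arcMeasure]
        fun x => -(gauge (-arcPotential (A j) s) x * (q j s x + z * v j s x)) := by
  have hvc : ∀ j s, Continuous (v j s) := fun j s =>
    continuous_iff_continuousAt.2 fun x => (hv j s x).continuousAt
  have hv₁c : ∀ j s, Continuous (v₁ j s) := fun j s =>
    continuous_iff_continuousAt.2 fun x => (hv₁ j s x).continuousAt
  choose F w hF hH2 hact using fun (j : ℤ) (s : Arc) =>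
    exists_isH2_gauge (arcPotential (A j) s) (hv j s) (hv₁c j s) (memLp_of_continuous (hq j s))
      fun x _ => by
        rw [intervalIntegral.integral_eq_sub_of_hasDerivAt (fun t _ => hv₁ j s t)
          ((hq j s).intervalIntegrable _ _)]
        ring
  have hc : ∀ j s, Continuous fun x =>
      -(gauge (-arcPotential (A j) s) x * (q j s x + z * v j s x)) := fun j s => by
    have := continuous_gauge (-arcPotential (A j) s)
    have := hq j s
    have := hvc j s
    fun_prop
  obtain ⟨f, hf, -⟩ := exists_lp_of_finite_support (F := fun p : ℤ × Arc => F p.1 p.2)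
    (T ×ˢ Finset.univ) fun p hp => by
      have hp1 : p.1 ∉ T := fun h => hp (by simp [h])
      rw [Lp.eq_zero_iff_ae_eq_zero]
      filter_upwards [hF p.1 p.2] with x hx
      rw [hx, (hT _ hp1 _ _).1, mul_zero, Pi.zero_apply]
  obtain ⟨h, hh, -⟩ := exists_lp_of_finite_support (F := fun p : ℤ × Arc => toArc _ (hc p.1 p.2))
    (T ×ˢ Finset.univ) fun p hp => by
      have hp1 : p.1 ∉ T := fun h => hp (by simp [h])
      rw [Lp.eq_zero_iff_ae_eq_zero]
      filter_upwards [coeFn_toArc _ (hc p.1 p.2)] with x hx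
      rw [hx, (hT _ hp1 _ _).1, (hT _ hp1 _ _).2]
      simp
  have hh' : ∀ j s, h (j, s) =ᵐ[arcMeasure]
      fun x => -(gauge (-arcPotential (A j) s) x * (q j s x + z * v j s x)) := fun j s => by
    rw [hh]
    exact coeFn_toArc _ (hc j s)
  refine ⟨f, h, fun j s x => gauge (-arcPotential (A j) s) x * v j s x,
    fun j s x => gauge (-arcPotential (A j) s) x *
      (v₁ j s x - Complex.I * arcPotential (A j) s * v j s x), w, ActsAs.of_arcEq (y := y) (fun j s => ⟨?_, ?_⟩) (fun j s => ?_)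
    (fun j s => ?_) (fun j => ?_), fun j s => ?_, hh'⟩
  · rw [hf]
    exact hH2 j s
  · filter_upwards [hact j s, hh' j s] with x hx1 hx2
    rw [hx1, hx2]
    ring
  · simp [h0]
  · simp only [h1]
    linear_combination y (j + 1) * gauge_mul_gauge_neg (arcPotential (A j) s) Real.pi
  · rw [← hδ]
    simp only [quasiDeriv, arcPotential, gauge_zero, neg_neg]
    ring
  · rw [hf]
    exact hF j s

lemma exists_sn_ne_zero (k : ℂ) : ∃ x ∈ Icc (0 : ℝ) Real.pi, sn k x ≠ 0 := by
  by_contra! h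
  have h1 : HasDerivWithinAt (sn k) 0 (Icc 0 Real.pi) 0 :=
    (hasDerivWithinAt_const (0 : ℝ) (Icc 0 Real.pi) (0 : ℂ)).congr h
      (h 0 ⟨le_rfl, Real.pi_pos.le⟩)
  have h2 := (uniqueDiffOn_Icc Real.pi_pos 0 ⟨le_rfl, Real.pi_pos.le⟩).eq_deriv _ h1
    (hasDerivAt_sn k 0).hasDerivWithinAt
  simp at h2

/-- The flat bands: at the zeros of `sn` there are infinitely many compactly supported
eigenfunctions. -/
theorem flat_band {α : ℝ} {A : ℤ → ℝ} {a : ℝ} (hA : ∀ j, 3 ≤ j → A j = a) {k : ℂ}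
    (hS : sn k Real.pi = 0) :
    k ^ 2 ∈ UnboundedOp.spectrum (chainHamiltonian α A) ∧
    ¬ FiniteDimensional ℂ (UnboundedOp.eigenspace (chainHamiltonian α A) (k ^ 2)) := by
  have hσ : cs k Real.pi ^ 2 = 1 := by
    have := cs_sq_add k Real.pi
    rwa [hS, zero_pow two_ne_zero, mul_zero, add_zero] at this
  set σ := cs k Real.pi with hσd
  set g := gauge a Real.pi with hg
  set g' := gauge (-a) Real.pi with hg'
  have hgg : g * g' = 1 := gauge_mul_gauge_neg a Real.pi
  have hfam : ∀ i : ℤ, 3 ≤ i → ∃ f : ChainL2,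
      f ∈ UnboundedOp.eigenspace (chainHamiltonian α A) (k ^ 2) ∧ f (i, Arc.upper) ≠ 0 ∧
      ∀ j, j ≠ i → j ≠ i + 1 → f (j, Arc.upper) = 0 := by
    intro i hi
    -- Multiples of `sn` vanish at all vertices, so only the fluxes have to balance. The pair `(1,
    -- -1)` balances vertex `i`; the flux left over at vertex `i + 1` is `σ(g' - g)`, in general
    -- nonzero, and the amplitudes on ring `i + 1` absorb it while cancelling at vertex `i + 2`.
    obtain ⟨β, hu, hl, hu1, hl1, hβ0⟩ : ∃ β : ℤ → Arc → ℂ, β i Arc.upper = 1 ∧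
        β i Arc.lower = -1 ∧ β (i + 1) Arc.upper = -σ * g ∧ β (i + 1) Arc.lower = σ * g' ∧
        ∀ j s, j ≠ i → j ≠ i + 1 → β j s = 0 :=
      ⟨fun j s => if j = i then Arc.casesOn s 1 (-1) else
        if j = i + 1 then Arc.casesOn s (-σ * g) (σ * g') else 0, if_pos rfl, if_pos rfl,
        (if_neg (by omega)).trans (if_pos rfl), (if_neg (by omega)).trans (if_pos rfl),
        fun j s h1 h2 => (if_neg h1).trans (if_neg h2)⟩
    obtain ⟨f, h, u, u', w, H, hf, hh⟩ := exists_actsAs_of_smooth α A (k ^ 2) {i, i + 1}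
      (v := fun j s x => β j s * sn k x) (v₁ := fun j s x => β j s * cs k x)
      (q := fun j s x => β j s * (-k ^ 2 * sn k x)) (y := 0)
      (fun j s x => (hasDerivAt_sn k x).const_mul _) (fun j s x => (hasDerivAt_cs k x).const_mul _)
      (fun j s => by have := continuous_sn k; fun_prop)
      (fun j hj s x => by
        have : β j s = 0 := by
          simp only [Finset.mem_insert, Finset.mem_singleton, not_or] at hj
          exact hβ0 j s hj.1 hj.2
        simp [this])
      (fun j s => by simp) (fun j s => by simp [hS])
      (fun j => by
        simp only [cs_zero, mul_one, ← hσd, Pi.zero_apply, mul_zero]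
        by_cases h1 : j = i
        · rw [h1, hu, hl, hβ0 (i - 1) _ (by omega) (by omega),
            hβ0 (i - 1) _ (by omega) (by omega)]
          ring
        by_cases h2 : j = i + 1
        · rw [h2, hu1, hl1, add_sub_cancel_right, hu, hl, hA i hi, ← hg, ← hg']
          ring
        rw [hβ0 j _ h1 h2, hβ0 j _ h1 h2]
        by_cases h3 : j = i + 2
        · rw [h3, show i + 2 - 1 = i + 1 by ring, hu1, hl1, hA _ (by omega), ← hg, ← hg']
          ring
        · rw [hβ0 (j - 1) _ (by omega) (by omega), hβ0 (j - 1) _ (by omega) (by omega)]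
          ring)
    have hh0 : h = 0 := by
      ext1
      funext ⟨j, s⟩
      change h (j, s) = 0
      rw [Lp.eq_zero_iff_ae_eq_zero]
      filter_upwards [hh j s] with x hx
      rw [hx, Pi.zero_apply]
      ring
    refine ⟨f, ?_, fun h0 => ?_, fun j h1 h2 => ?_⟩
    · rw [UnboundedOp.mem_eigenspace_iff, chainHamiltonian_graph]
      rw [hh0, zero_add] at H
      exact ⟨u, u', w, H⟩
    · have e : (fun x => gauge (-arcPotential (A i) Arc.upper) x * (β i Arc.upper * sn k x))
          =ᵐ[arcMeasure] fun _ => (0 : ℂ) := by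
        filter_upwards [hf i Arc.upper, Lp.coeFn_zero ℂ 2 arcMeasure] with x h1 h2
        rw [← h1, h0, h2, Pi.zero_apply]
      rw [arcMeasure, restrict_Ioo_eq_restrict_Icc] at e
      have hc1 := continuous_gauge (-arcPotential (A i) Arc.upper)
      have hc2 := continuous_sn k
      have e2 := Measure.eqOn_Icc_of_ae_eq volume Real.pi_pos.ne e (by fun_prop) continuousOn_const
      obtain ⟨x, hx, hxn⟩ := exists_sn_ne_zero k
      have e3 := e2 hx
      simp only [hu, one_mul] at e3
      exact hxn ((mul_eq_zero.1 e3).resolve_left (gauge_ne_zero _ _))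
    · rw [Lp.eq_zero_iff_ae_eq_zero]
      filter_upwards [hf j Arc.upper] with x hx
      rw [hx]
      rw [hβ0 j _ h1 h2, zero_mul, mul_zero, Pi.zero_apply]
  -- Steps of two make the supports disjoint, and starting at ring 3 keeps them where the potential
  -- equals `a`.
  choose f hf1 hf2 hf3 using fun m : ℕ => hfam (2 * m + 3) (by omega)
  refine ⟨UnboundedOp.mem_spectrum_of_mem_eigenspace _ _ (hf1 0) fun h => hf2 0 ?_,
    not_finiteDimensional_of_separated (p := fun m : ℕ => (2 * (m : ℤ) + 3, Arc.upper)) hf1 hf2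
      fun m n hmn => hf3 n _ (by omega) (by omega)⟩
  rw [h]
  rfl

/-- Inside the band the Bloch multiplier is `e^{iθ}` with `cos θ = ξ / c`. When `c = 0`, also `ξ =
0`, and any unimodular number serves. -/
lemma exists_multiplier {c ξ : ℝ} (h : |ξ| ≤ |c|) :
    ∃ μ : ℂ, ‖μ‖ = 1 ∧ (c : ℂ) * (μ ^ 2 + 1) = 2 * ξ * μ := by
  obtain ⟨t, ht, hξ⟩ : ∃ t : ℝ, |t| ≤ 1 ∧ ξ = c * t := by
    rcases eq_or_ne c 0 with rfl | hc
    · refine ⟨0, by simp, ?_⟩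
      rw [abs_zero] at h
      simpa using abs_nonpos_iff.1 h
    · refine ⟨ξ / c, ?_, by field_simp⟩
      rw [abs_div]
      exact div_le_one_of_le₀ h (abs_nonneg c)
  have ht2 : 0 ≤ 1 - t ^ 2 := by
    have := (sq_le_one_iff_abs_le_one t).2 ht
    linarith
  have hs : (Real.sqrt (1 - t ^ 2) : ℂ) ^ 2 = 1 - t ^ 2 := by
    rw [← Complex.ofReal_pow, Real.sq_sqrt ht2]
    push_cast
    rfl
  refine ⟨t + Real.sqrt (1 - t ^ 2) * Complex.I, ?_, ?_⟩
  · rw [Complex.norm_add_mul_I, Real.sq_sqrt ht2]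
    simp
  · rw [hξ]
    push_cast
    linear_combination (-c : ℂ) * hs + c * (Real.sqrt (1 - t ^ 2) : ℂ) ^ 2 * Complex.I_sq

/-- Truncated Bloch solutions: on the rings `4, …, N + 3` they solve the equation, and the error on
the two neighbouring rings is bounded uniformly in `N`. -/
lemma exists_truncated_bloch {α : ℝ} {A : ℤ → ℝ} {a : ℝ} (hA : ∀ j, 3 ≤ j → A j = a) {k : ℂ}
    (hS : sn k Real.pi ≠ 0) {μ : ℂ} (hμ : ‖μ‖ = 1)
    (hc : (Real.cos (a * Real.pi) : ℂ) * (μ ^ 2 + 1) = 2 * disc α k * μ) :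
    ∃ δ K : ℝ, 0 < δ ∧ ∀ N : ℕ, ∃ f h : ChainL2,
      (f, h + k ^ 2 • f) ∈ (chainHamiltonian α A).graph ∧ N * δ ≤ ‖f‖ ^ 2 ∧ ‖h‖ ^ 2 ≤ K := by
  have hμ0 : μ ≠ 0 := norm_ne_zero_iff.1 (by rw [hμ]; exact one_ne_zero)
  have hμz : ∀ j : ℤ, ‖μ ^ j‖ = 1 := fun j => by rw [norm_zpow, hμ, one_zpow]
  set S := sn k Real.pi with hSd
  set C := cs k Real.pi with hCd
  -- The Bloch wave on one ring after gauging: vertex value `1` on the left, `μ` times the gauge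
  -- factor on the right.
  set V : Arc → ℝ → ℂ := fun s x =>
    cs k x + (gauge (arcPotential a s) Real.pi * μ - C) / S * sn k x with hV
  set V' : Arc → ℝ → ℂ := fun s x =>
    -k ^ 2 * sn k x + (gauge (arcPotential a s) Real.pi * μ - C) / S * cs k x with hV'
  have hVd : ∀ s x, HasDerivAt (V s) (V' s x) x := fun s x =>
    (hasDerivAt_cs k x).add ((hasDerivAt_sn k x).const_mul _)
  have hV'd : ∀ s x, HasDerivAt (V' s) (-k ^ 2 * V s x) x := fun s x => by
    convert! ((hasDerivAt_sn k x).const_mul (-k ^ 2)).add ((hasDerivAt_cs k x).const_mul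
      ((gauge (arcPotential a s) Real.pi * μ - C) / S)) using 1
    simp only [hV]
    ring
  have hVc : ∀ s, Continuous (V s) := fun s =>
    continuous_iff_continuousAt.2 fun x => (hVd s x).continuousAt
  have hV'c : ∀ s, Continuous (V' s) := fun s =>
    continuous_iff_continuousAt.2 fun x => (hV'd s x).continuousAt
  have hV0 : ∀ s, V s 0 = 1 := fun s => by simp [hV]
  have hVπ : ∀ s, V s Real.pi = gauge (arcPotential a s) Real.pi * μ := fun s => by
    simp only [hV, ← hSd, ← hCd]
    field_simp
    ring
  have hV'0 : ∀ s, V' s 0 = (gauge (arcPotential a s) Real.pi * μ - C) / S := fun s => by simp [hV']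
  have hCS : C ^ 2 + k ^ 2 * S ^ 2 = 1 := cs_sq_add k Real.pi
  have hV'π : ∀ s, V' s Real.pi = (gauge (arcPotential a s) Real.pi * μ * C - 1) / S := fun s => by
    simp only [hV', ← hSd, ← hCd]
    field_simp
    linear_combination -hCS
  obtain ⟨B, hB⟩ : ∃ B : ℝ, ∀ s, ∀ x ∈ Icc (0 : ℝ) Real.pi, ‖V s x‖ ≤ B ∧ ‖V' s x‖ ≤ B := by
    choose b₁ hb₁ using fun s =>
      (isCompact_Icc (a := (0 : ℝ)) (b := Real.pi)).exists_bound_of_continuousOn (hVc s).continuousOn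
    choose b₂ hb₂ using fun s =>
      (isCompact_Icc (a := (0 : ℝ)) (b := Real.pi)).exists_bound_of_continuousOn
        (hV'c s).continuousOn
    refine ⟨max (max (b₁ Arc.upper) (b₂ Arc.upper)) (max (b₁ Arc.lower) (b₂ Arc.lower)), ?_⟩
    rintro (_ | _) x hx
    · exact ⟨(hb₁ _ x hx).trans ((le_max_left _ _).trans (le_max_left _ _)),
        (hb₂ _ x hx).trans ((le_max_right _ _).trans (le_max_left _ _))⟩
    · exact ⟨(hb₁ _ x hx).trans ((le_max_left _ _).trans (le_max_right _ _)),
        (hb₂ _ x hx).trans ((le_max_right _ _).trans (le_max_right _ _))⟩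
  have hδ : 0 < ‖toArc (V Arc.upper) (hVc Arc.upper)‖ ^ 2 := by
    have : toArc (V Arc.upper) (hVc Arc.upper) ≠ 0 := fun h0 => by
      have e : V Arc.upper =ᵐ[arcMeasure] fun _ => (0 : ℂ) := by
        filter_upwards [coeFn_toArc _ (hVc Arc.upper), Lp.coeFn_zero ℂ 2 arcMeasure] with x h1 h2
        rw [← h1, h0, h2, Pi.zero_apply]
      rw [arcMeasure, restrict_Ioo_eq_restrict_Icc] at e
      have := Measure.eqOn_Icc_of_ae_eq volume Real.pi_pos.ne e (hVc Arc.upper).continuousOn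
        continuousOn_const ⟨le_rfl, Real.pi_pos.le⟩
      rw [hV0] at this
      exact one_ne_zero this
    positivity
  -- Two cut-off rings have four half-circles; on each the error is at most `2B` pointwise, and
  -- passing to the `L²` norm costs a factor `2`.
  refine ⟨_, 4 * (2 * (2 * B)) ^ 2, hδ, fun N => ?_⟩
  obtain ⟨χ, hχ1, hχ0, hχn⟩ : ∃ χ : ℤ → ℂ, (∀ j : ℤ, 4 ≤ j → j ≤ N + 4 → χ j = 1) ∧
      (∀ j : ℤ, ¬ (4 ≤ j ∧ j ≤ N + 4) → χ j = 0) ∧ ∀ j, ‖χ (j + 1) - χ j‖ ≤ 1 := by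
    refine ⟨fun j => if 4 ≤ j ∧ j ≤ N + 4 then 1 else 0, fun j h1 h2 => if_pos ⟨h1, h2⟩,
      fun j h => if_neg h, fun j => ?_⟩
    dsimp only
    split_ifs <;> simp
  -- A cosine step from `χ j` to `χ (j + 1)` with zero slope at both ends, so that the cut-off
  -- preserves the δ conditions. It varies only on the rings `3` and `N + 4`.
  set φ : ℤ → ℝ → ℂ := fun j x => χ j + (χ (j + 1) - χ j) / 2 * (1 - Real.cos x) with hφ
  set φ₁ : ℤ → ℝ → ℂ := fun j x => (χ (j + 1) - χ j) / 2 * Real.sin x with hφ₁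
  set φ₂ : ℤ → ℝ → ℂ := fun j x => (χ (j + 1) - χ j) / 2 * Real.cos x with hφ₂
  have hφd : ∀ j x, HasDerivAt (φ j) (φ₁ j x) x := fun j x => by
    have := ((((Real.hasDerivAt_cos x).ofReal_comp).const_sub 1).const_mul
      ((χ (j + 1) - χ j) / 2)).const_add (χ j)
    simpa [hφ, hφ₁] using this
  have hφ₁d : ∀ j x, HasDerivAt (φ₁ j) (φ₂ j x) x := fun j x =>
    ((Real.hasDerivAt_sin x).ofReal_comp).const_mul _
  have hφc : ∀ j, Continuous (φ j) := fun j =>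
    continuous_iff_continuousAt.2 fun x => (hφd j x).continuousAt
  have hφ₁c : ∀ j, Continuous (φ₁ j) := fun j =>
    continuous_iff_continuousAt.2 fun x => (hφ₁d j x).continuousAt
  have hφ₂c : ∀ j, Continuous (φ₂ j) := fun j => by simp only [hφ₂]; fun_prop
  obtain ⟨f, h, u, u', w, H, hf, hh⟩ := exists_actsAs_of_smooth α A (k ^ 2) (Finset.Icc 3 (N + 4))
    (v := fun j s x => μ ^ j * (φ j x * V s x))
    (v₁ := fun j s x => μ ^ j * (φ₁ j x * V s x + φ j x * V' s x))
    (q := fun j s x => μ ^ j * ((φ₂ j x * V s x + φ₁ j x * V' s x) +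
      (φ₁ j x * V' s x + φ j x * (-k ^ 2 * V s x)))) (y := fun j => μ ^ j * χ j)
    (fun j s x => ((hφd j x).mul (hVd s x)).const_mul _)
    (fun j s x => (((hφ₁d j x).mul (hVd s x)).add ((hφd j x).mul (hV'd s x))).const_mul _)
    (fun j s => by
      have := hφc j; have := hφ₁c j; have := hφ₂c j; have := hVc s; have := hV'c s
      fun_prop)
    (fun j hj s x => by
      rw [Finset.mem_Icc] at hj
      have h1 : χ j = 0 := hχ0 j (by omega)
      have h2 : χ (j + 1) = 0 := hχ0 (j + 1) (by omega)
      simp [hφ, hφ₁, hφ₂, h1, h2])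
    (fun j s => by simp [hφ, hV0])
    (fun j s => by
      by_cases hj : 3 ≤ j
      · simp only [hφ, hVπ, hA j hj, Real.cos_pi, zpow_add_one₀ hμ0]
        push_cast
        ring
      · have h1 : χ j = 0 := hχ0 j (by omega)
        have h2 : χ (j + 1) = 0 := hχ0 (j + 1) (by omega)
        simp [hφ, h1, h2])
    (fun j => by
      by_cases hj : 4 ≤ j
      · have e1 : φ (j - 1) Real.pi = χ j := by
          simp only [hφ, Real.cos_pi, sub_add_cancel]
          push_cast
          ring
        have e2 : φ j 0 = χ j := by simp [hφ]
        have e3 : φ₁ (j - 1) Real.pi = 0 := by simp [hφ₁]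
        have e4 : φ₁ j 0 = 0 := by simp [hφ₁]
        have e5 : μ ^ j = μ ^ (j - 1) * μ := by rw [← zpow_add_one₀ hμ0, sub_add_cancel]
        have e6 := gauge_mul_gauge_neg a Real.pi
        have e7 : gauge a Real.pi + gauge (-a) Real.pi = 2 * Real.cos (a * Real.pi) :=
          gauge_add_gauge_neg a
        rw [hA _ (by omega : 3 ≤ j - 1), e1, e2, e3, e4, hV'0, hV'0, hV'π, hV'π, e5]
        simp only [arcPotential, div_eq_mul_inv]
        rw [disc, ← hSd, ← hCd] at hc
        linear_combination μ ^ (j - 1) * χ j * S⁻¹ * ((μ ^ 2 + 1) * e7 + 2 * hc - 2 * μ * C * e6) +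
          α * μ ^ (j - 1) * χ j * μ * mul_inv_cancel₀ hS
      · have h1 : χ j = 0 := hχ0 j (by omega)
        have h2 : χ (j - 1) = 0 := hχ0 (j - 1) (by omega)
        simp [hφ, hφ₁, h1, h2])
  refine ⟨f, h, ?_, ?_, ?_⟩
  · rw [chainHamiltonian_graph]
    exact ⟨u, u', w, H⟩
  · have hle : ∀ j ∈ Finset.Icc (4 : ℤ) (N + 3),
        ‖toArc (V Arc.upper) (hVc Arc.upper)‖ ^ 2 ≤ ‖f (j, Arc.upper)‖ ^ 2 := by
      intro j hj
      rw [Finset.mem_Icc] at hj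
      refine pow_le_pow_left₀ (norm_nonneg _) (Lp.norm_le_norm_of_ae_le ?_) 2
      filter_upwards [hf j Arc.upper, coeFn_toArc _ (hVc Arc.upper)] with x h1 h2
      have e : φ j x = 1 := by
        simp [hφ, hχ1 j hj.1 (by omega), hχ1 (j + 1) (by omega) (by omega)]
      rw [h1, h2, e, one_mul, norm_mul, norm_mul, norm_gauge, hμz, one_mul, one_mul]
    have h1 := Finset.sum_le_sum hle
    rw [Finset.sum_const, Int.card_Icc, nsmul_eq_mul] at h1
    have h2 : ∑ p ∈ (Finset.Icc (4 : ℤ) (N + 3)).map ⟨fun j => (j, Arc.upper), fun i j h => by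
        simpa using h⟩, ‖f p‖ ^ 2 ≤ ‖f‖ ^ 2 :=
      sum_le_hasSum _ (fun _ _ => by positivity) (lp_hasSum_sq f)
    rw [Finset.sum_map] at h2
    refine le_trans (le_of_eq ?_) (h1.trans h2)
    rw [show (N : ℤ) + 3 + 1 - 4 = N by ring, Int.toNat_natCast]
  · have h0 : ∀ p ∉ ({3, (N : ℤ) + 4} : Finset ℤ) ×ˢ (Finset.univ : Finset Arc), ‖h p‖ ^ 2 = 0 := by
      rintro ⟨j, s⟩ hp
      simp only [Finset.mem_product, Finset.mem_insert, Finset.mem_singleton, Finset.mem_univ,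
        and_true, not_or] at hp
      have hχ : χ (j + 1) = χ j := by
        by_cases hj : 4 ≤ j ∧ j ≤ N + 3
        · rw [hχ1 j hj.1 (by omega), hχ1 (j + 1) (by omega) (by omega)]
        · rw [hχ0 j (by omega), hχ0 (j + 1) (by omega)]
      have : h (j, s) = 0 := by
        rw [Lp.eq_zero_iff_ae_eq_zero]
        filter_upwards [hh j s] with x hx
        rw [hx]
        simp only [hφ₁, hφ₂, hχ, Pi.zero_apply]
        ring
      rw [this, norm_zero]
      norm_num
    rw [(lp_hasSum_sq h).unique (hasSum_sum_of_ne_finset_zero h0)]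
    have hle : ∀ p ∈ ({3, (N : ℤ) + 4} : Finset ℤ) ×ˢ (Finset.univ : Finset Arc),
        ‖h p‖ ^ 2 ≤ (2 * (2 * B)) ^ 2 := by
      rintro ⟨j, s⟩ -
      refine pow_le_pow_left₀ (norm_nonneg _) (norm_le_of_ae_bound ?_ ?_) 2
      · have := (norm_nonneg _).trans (hB Arc.upper 0 ⟨le_rfl, Real.pi_pos.le⟩).1
        positivity
      · filter_upwards [hh j s, ae_restrict_mem measurableSet_Ioo] with x hx hxm
        obtain ⟨b1, b2⟩ := hB s x (Ioo_subset_Icc_self hxm)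
        have e : -(gauge (-arcPotential (A j) s) x * (μ ^ j * ((φ₂ j x * V s x + φ₁ j x * V' s x) +
            (φ₁ j x * V' s x + φ j x * (-k ^ 2 * V s x))) + k ^ 2 * (μ ^ j * (φ j x * V s x)))) =
            gauge (-arcPotential (A j) s) x * μ ^ j *
              (-(χ (j + 1) - χ j) * (Real.cos x / 2 * V s x + Real.sin x * V' s x)) := by
          simp only [hφ₁, hφ₂]
          ring
        rw [hx, e, norm_mul, norm_mul, norm_gauge, hμz, one_mul, one_mul, norm_mul, norm_neg]
        have hs : ‖(Real.sin x : ℂ)‖ ≤ 1 := by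
          rw [Complex.norm_real]
          exact Real.abs_sin_le_one x
        have hcx : ‖(Real.cos x / 2 : ℂ)‖ ≤ 1 := by
          rw [norm_div, Complex.norm_real, Complex.norm_ofNat]
          have := Real.abs_cos_le_one x
          rw [Real.norm_eq_abs]
          linarith
        have hB0 : 0 ≤ B := (norm_nonneg _).trans b1
        calc _ ≤ 1 * (1 * B + 1 * B) := by
              refine mul_le_mul (hχn j) ((norm_add_le _ _).trans (add_le_add ?_ ?_))
                (norm_nonneg _) zero_le_one
              · rw [norm_mul]
                exact mul_le_mul hcx b1 (norm_nonneg _) zero_le_one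
              · rw [norm_mul]
                exact mul_le_mul hs b2 (norm_nonneg _) zero_le_one
          _ = 2 * B := by ring
    refine (Finset.sum_le_card_nsmul _ _ _ hle).trans ?_
    rw [nsmul_eq_mul]
    refine mul_le_mul_of_nonneg_right ?_ (by positivity)
    rw [Finset.card_product]
    have h1 := Finset.card_le_two (a := (3 : ℤ)) (b := N + 4)
    have h2 : (Finset.univ : Finset Arc).card = 2 := rfl
    rw [h2]
    have : (({3, (N : ℤ) + 4} : Finset ℤ).card * 2 : ℕ) ≤ 4 := by omega
    exact_mod_cast this

/-- The bands belong to the spectrum. -/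
theorem mem_spectrum_of_band {α : ℝ} {A : ℤ → ℝ} {a : ℝ} (hA : ∀ j, 3 ≤ j → A j = a) {k : ℂ}
    (hS : sn k Real.pi ≠ 0) {ξ : ℝ} (hd : disc α k = ξ) (hξ : |ξ| ≤ |Real.cos (a * Real.pi)|) :
    k ^ 2 ∈ UnboundedOp.spectrum (chainHamiltonian α A) := by
  intro hres
  obtain ⟨M, hM⟩ := UnboundedOp.exists_bound_of_mem_resolventSet _ hres
  obtain ⟨μ, hμ, hc⟩ := exists_multiplier hξ
  rw [← hd] at hc
  obtain ⟨δ, K, hδ, hN⟩ := exists_truncated_bloch (α := α) hA hS hμ hc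
  -- A bounded resolvent would give `N δ ≤ ‖f‖² ≤ M² K` for every `N`.
  obtain ⟨N, hN'⟩ := exists_nat_gt (M ^ 2 * K / δ)
  obtain ⟨f, h, hfh, h1, h2⟩ := hN N
  have h3 := hM f h hfh
  have h4 : ‖f‖ ^ 2 ≤ M ^ 2 * ‖h‖ ^ 2 := by
    rw [← mul_pow]
    exact pow_le_pow_left₀ (norm_nonneg _) h3 2
  rw [div_lt_iff₀ hδ] at hN'
  have := mul_le_mul_of_nonneg_left h2 (sq_nonneg M)
  linarith

/-! ### Eigenfunctions and solutions of the Jacobi equation -/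

lemma exists_eigenfunction {k : ℂ} (hS : sn k Real.pi ≠ 0) {α : ℝ} {A : ℤ → ℝ} {y : VertexL2}
    (hy : ∀ j, jacobi (ringCos A) y j = 2 * disc α k * y j) :
    ∃ f u u' w, f ∈ UnboundedOp.eigenspace (chainHamiltonian α A) (k ^ 2) ∧
      ActsAs α A f (0 + k ^ 2 • f) u u' w ∧ (∀ j s, u j s 0 = y j) ∧
      ∀ j s, y j = 0 → y (j + 1) = 0 → f (j, s) = 0 := by
  obtain ⟨M, hM, h⟩ := exists_chain_solution k hS α
  obtain ⟨e, -, he, hex⟩ := h A 0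
  obtain ⟨f, u, u', w, H, hu, hf, -⟩ := hex y fun j => by
    rw [hy, he rfl, sub_self]
    rfl
  refine ⟨f, u, u', w, ?_, H, hu, fun j s h0 h1 => ?_⟩
  · rw [UnboundedOp.mem_eigenspace_iff, chainHamiltonian_graph]
    rw [zero_add] at H
    exact ⟨u, u', w, H⟩
  · have := hf j s
    rw [h0, h1] at this
    have e : (0 : ChainL2) (j, s) = 0 := rfl
    rw [e] at this
    simpa using this

/-- The vertex values of an eigenfunction form a square-summable solution of the Jacobi equation. -/
lemma exists_vertex_values {k : ℂ} (hS : sn k Real.pi ≠ 0) {α : ℝ} {A : ℤ → ℝ} {f : ChainL2}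
    (hf : f ∈ UnboundedOp.eigenspace (chainHamiltonian α A) (k ^ 2)) :
    ∃ (u u' : ℤ → Arc → ℝ → ℂ) (w : ℤ → Arc → ArcL2) (y : VertexL2),
      ActsAs α A f (0 + k ^ 2 • f) u u' w ∧ (∀ j, y j = u j Arc.upper 0) ∧
      (∀ j, jacobi (ringCos A) y j = 2 * disc α k * y j) ∧ (y = 0 → f = 0) := by
  rw [UnboundedOp.mem_eigenspace_iff, chainHamiltonian_graph] at hf
  obtain ⟨u, u', w, H⟩ := hf
  have H' : ActsAs α A f (0 + k ^ 2 • f) u u' w := by rwa [zero_add]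
  obtain ⟨h1, h2, h3⟩ := H'.vertex_kernel hS
  obtain ⟨y, hy, -⟩ := exists_lp_of_hasSum (F := fun j => u j Arc.upper 0)
    (Real.sqrt_nonneg _) h1.hasSum (Real.sq_sqrt (tsum_nonneg fun _ => by positivity)).ge
  refine ⟨u, u', w, y, H', hy, fun j => ?_, fun h0 => h3 fun j => by rw [← hy, h0]; rfl⟩
  have := h2 j
  simp only [jacobi] at this ⊢
  rw [hy, hy, hy]
  exact this

lemma not_isEigenvalue_of_kernel {k : ℂ} (hS : sn k Real.pi ≠ 0) {α : ℝ} {A : ℤ → ℝ}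
    (h : ∀ y : VertexL2, (∀ j, jacobi (ringCos A) y j = 2 * disc α k * y j) → y = 0) :
    ¬ UnboundedOp.IsEigenvalue (chainHamiltonian α A) (k ^ 2) := fun hE => hE <| by
  rw [Submodule.eq_bot_iff]
  intro f hf
  obtain ⟨u, u', w, y, -, -, hy, h0⟩ := exists_vertex_values hS hf
  exact h0 (h y hy)

/-- The value at vertex `i` is a linear functional on the eigenspace; it has trivial kernel by the
last hypothesis and takes the value `1`. -/
lemma isSimpleEigenvalue_of_kernel {k : ℂ} (hS : sn k Real.pi ≠ 0) {α : ℝ} {A : ℤ → ℝ} (i : ℤ)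
    {y₀ : VertexL2} (hy₀ : ∀ j, jacobi (ringCos A) y₀ j = 2 * disc α k * y₀ j) (h1 : y₀ i = 1)
    (h : ∀ y : VertexL2, (∀ j, jacobi (ringCos A) y j = 2 * disc α k * y j) → y i = 0 → y = 0) :
    UnboundedOp.IsSimpleEigenvalue (chainHamiltonian α A) (k ^ 2) := by
  obtain ⟨f, u, u', w, hf, H, hu, -⟩ := exists_eigenfunction hS hy₀
  rw [UnboundedOp.IsSimpleEigenvalue, finrank_eq_one_iff']
  refine ⟨⟨f, hf⟩, fun h0 => ?_, ?_⟩
  · have hs := H.sobolev i Arc.upper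
    have h2 : f = 0 := congrArg Subtype.val h0
    rw [h2] at hs
    have := hs.eq_zero.1 0 ⟨le_rfl, Real.pi_pos.le⟩
    rw [hu, h1] at this
    exact one_ne_zero this
  · rintro ⟨g, hg⟩
    obtain ⟨u₁, u₁', w₁, y₁, H₁, hy₁, -, -⟩ := exists_vertex_values hS hg
    refine ⟨y₁ i, Subtype.ext ?_⟩
    change y₁ i • f = g
    have hd := Submodule.sub_mem _ hg (Submodule.smul_mem _ (y₁ i) hf)
    obtain ⟨u₂, u₂', w₂, y₂, H₂, hy₂, hj₂, h₂⟩ := exists_vertex_values hS hd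
    -- The continuous representatives are chosen separately for `f`, `g` and `g - y₁ i • f`. A
    -- combination representing zero vanishes at every point, which shows that the vertex values
    -- depend linearly on the function.
    have hs : IsH2 ((g - y₁ i • f) (i, Arc.upper) +
        ((y₁ i • f (i, Arc.upper)) + (-1 : ℂ) • g (i, Arc.upper))) _ _ _ :=
      (H₂.sobolev i Arc.upper).add (((H.sobolev i Arc.upper).smul (y₁ i)).add
        ((H₁.sobolev i Arc.upper).smul (-1)))
    have h3 : (g - y₁ i • f) (i, Arc.upper) +
        ((y₁ i • f (i, Arc.upper)) + (-1 : ℂ) • g (i, Arc.upper)) = 0 := by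
      have : (g - y₁ i • f) (i, Arc.upper) = g (i, Arc.upper) - y₁ i • f (i, Arc.upper) := rfl
      rw [this, neg_one_smul]
      abel
    rw [h3] at hs
    have h4 := hs.eq_zero.1 0 ⟨le_rfl, Real.pi_pos.le⟩
    simp only [Pi.add_apply, Pi.smul_apply, smul_eq_mul, hu, h1, ← hy₁, ← hy₂] at h4
    exact (sub_eq_zero.1 (h₂ (h _ hj₂ (by linear_combination h4)))).symm

/-- When the coupling between the rings vanishes, the bands degenerate to points, which are
eigenvalues of infinite multiplicity. -/
theorem not_finiteDimensional_of_decoupled {k : ℂ} (hS : sn k Real.pi ≠ 0) {α : ℝ} {A : ℤ → ℝ}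
    (hA : ∀ j, 3 ≤ j → ringCos A j = 0) (hd : disc α k = 0) :
    ¬ FiniteDimensional ℂ (UnboundedOp.eigenspace (chainHamiltonian α A) (k ^ 2)) := by
  have hfam : ∀ i : ℤ, 4 ≤ i → ∃ f : ChainL2,
      f ∈ UnboundedOp.eigenspace (chainHamiltonian α A) (k ^ 2) ∧ f (i, Arc.upper) ≠ 0 ∧
      ∀ j, j ≠ i → j + 1 ≠ i → f (j, Arc.upper) = 0 := by
    intro i hi
    -- Both edges at vertex `i ≥ 4` have coefficient zero, so the unit vector there solves the
    -- Jacobi equation at `ξ = 0`.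
    obtain ⟨y, hy, -⟩ := exists_lp_of_finite_support (E := fun _ : ℤ => ℂ)
      (F := fun j => if j = i then 1 else 0) {i} fun j hj => if_neg (by simpa using hj)
    have hy1 : y i = 1 := (hy i).trans (if_pos rfl)
    have hy0 : ∀ j, j ≠ i → y j = 0 := fun j hj => (hy j).trans (if_neg hj)
    obtain ⟨f, u, u', w, hf, H, hu, h0⟩ := exists_eigenfunction (α := α) (A := A) (y := y) hS
      fun j => by
        rw [hd, mul_zero, zero_mul, jacobi]
        have e1 : (ringCos A j : ℂ) * y (j + 1) = 0 := by
          by_cases h : j + 1 = i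
          · rw [hA j (by omega), Complex.ofReal_zero, zero_mul]
          · rw [hy0 _ h, mul_zero]
        have e2 : (ringCos A (j - 1) : ℂ) * y (j - 1) = 0 := by
          by_cases h : j - 1 = i
          · rw [hA (j - 1) (by omega), Complex.ofReal_zero, zero_mul]
          · rw [hy0 _ h, mul_zero]
        rw [e1, e2, add_zero]
    refine ⟨f, hf, fun hz => ?_, fun j h1 h2 => h0 j _ (hy0 j h1) (hy0 _ h2)⟩
    have hs := H.sobolev i Arc.upper
    rw [hz] at hs
    have := hs.eq_zero.1 0 ⟨le_rfl, Real.pi_pos.le⟩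
    rw [hu, hy1] at this
    exact one_ne_zero this
  choose f hf1 hf2 hf3 using fun m : ℕ => hfam (2 * m + 4) (by omega)
  exact not_finiteDimensional_of_separated (p := fun m : ℕ => (2 * (m : ℤ) + 4, Arc.upper)) hf1 hf2
    fun m n hmn => hf3 n _ (by omega) (by omega)

lemma mem_resolventSet_of_jacobiInvertible {k : ℂ} (hS : sn k Real.pi ≠ 0) {α : ℝ} {A : ℤ → ℝ}
    (h : JacobiInvertible (ringCos A) (2 * disc α k)) :
    k ^ 2 ∈ UnboundedOp.resolventSet (chainHamiltonian α A) := by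
  obtain ⟨⟨D, hD⟩, hinj⟩ := h
  exact mem_resolventSet_of_jacobi hS D hD hinj

lemma im_sq_eq_zero_of_sn {k : ℂ} (hS : sn k Real.pi = 0) : (k ^ 2).im = 0 := by
  have h := mul_sn k Real.pi
  rw [hS, mul_zero] at h
  obtain ⟨n, hn⟩ := Complex.sin_eq_zero_iff.1 h.symm
  have hk : k = ((n : ℝ) : ℂ) := by
    rw [Complex.ofReal_intCast]
    exact mul_right_cancel₀ (Complex.ofReal_ne_zero.2 Real.pi_ne_zero) hn
  rw [hk, ← Complex.ofReal_pow, Complex.ofReal_im]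

/-- The spectrum is real. -/
theorem im_eq_zero_of_mem_spectrum {α : ℝ} {A : ℤ → ℝ} {z : ℂ}
    (hz : z ∈ UnboundedOp.spectrum (chainHamiltonian α A)) : z.im = 0 := by
  obtain ⟨k, rfl⟩ := IsAlgClosed.exists_pow_nat_eq z two_pos
  by_contra him
  have hS : sn k Real.pi ≠ 0 := fun h => him (im_sq_eq_zero_of_sn h)
  -- All coefficients are cosines, so the obstruction is `2ξ ∈ [-2, 2]`, excluded at non-real
  -- energies by `im_sq_eq_zero_of_disc`.
  refine hz (mem_resolventSet_of_jacobiInvertible hS (jacobiInvertible_of_off_interval (B := 1)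
    (fun j => Real.abs_cos_le_one _) fun t ht h => him ?_))
  refine im_sq_eq_zero_of_disc (α := α) (t := t / 2) hS ?_ ?_
  · rw [abs_div, abs_two]
    linarith
  · push_cast
    linear_combination h / 2

end RingChain

namespace UnboundedOp

variable {H : Type*} [NormedAddCommGroup H] [NormedSpace ℂ H]

lemma IsEigenvalue.mem_spectrum {T : H →ₗ.[ℂ] H} {z : ℂ} (h : IsEigenvalue T z) :
    z ∈ spectrum T := by
  obtain ⟨f, hf, h0⟩ := Submodule.exists_mem_ne_zero_of_ne_bot h
  exact mem_spectrum_of_mem_eigenspace T z hf h0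

lemma IsSimpleEigenvalue.isEigenvalue {T : H →ₗ.[ℂ] H} {z : ℂ} (h : IsSimpleEigenvalue T z) :
    IsEigenvalue T z := fun h0 => by
  rw [IsSimpleEigenvalue, h0, finrank_bot] at h
  exact zero_ne_one h

lemma IsSimpleEigenvalue.finiteDimensional {T : H →ₗ.[ℂ] H} {z : ℂ}
    (h : IsSimpleEigenvalue T z) : FiniteDimensional ℂ (eigenspace T z) :=
  FiniteDimensional.of_finrank_pos (by rw [h]; exact zero_lt_one)

end UnboundedOp

/-! ### Bands and bound-state energies of the perturbed chain -/

namespace RingChain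

/-- The energies in the bands, including the flat ones. -/
def bands (α c : ℝ) : Set ℝ := {E | snE E = 0 ∨ |discE α E| ≤ |c|}

/-- The modulus of the discriminant at the bound states produced by a ring with the cosine `c₁`. -/
def boundLevel (c c₁ : ℝ) : ℝ := (c ^ 2 + c₁ ^ 2) / (2 * |c₁|)

/-- The strict inequality of means, `c² + c₁² - 2|c||c₁| = (|c₁| - |c|)² > 0`. -/
lemma lt_boundLevel {c c₁ : ℝ} (h : |c| < |c₁|) : |c| < boundLevel c c₁ := by
  have h1 : 0 < |c₁| := (abs_nonneg c).trans_lt h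
  rw [boundLevel, lt_div_iff₀ (by positivity), ← sq_abs c, ← sq_abs c₁]
  nlinarith [mul_pos (sub_pos.2 h) (sub_pos.2 h)]

/-- From `c² < c₁²` and `c₁² ≤ |c₁|`. A level below `1` is what makes the discriminant reach it in
every gap. -/
lemma boundLevel_lt_one {c c₁ : ℝ} (h : |c| < |c₁|) (h1 : |c₁| ≤ 1) : boundLevel c c₁ < 1 := by
  have h0 : 0 < |c₁| := (abs_nonneg c).trans_lt h
  rw [boundLevel, div_lt_one (by positivity), ← sq_abs c, ← sq_abs c₁]
  nlinarith [abs_nonneg c]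

lemma sn_momentum_ne_zero {α c E : ℝ} (hE : E ∉ bands α c) : sn (momentum E) Real.pi ≠ 0 := by
  rw [sn_momentum]
  exact Complex.ofReal_ne_zero.2 fun h => hE (Or.inl h)

section

variable {α a : ℝ} {A : ℤ → ℝ}

theorem mem_spectrum_of_mem_bands (hA : ∀ j, j ≠ 1 → A j = a) {E : ℝ}
    (hE : E ∈ bands α (Real.cos (a * Real.pi))) :
    (E : ℂ) ∈ UnboundedOp.spectrum (chainHamiltonian α A) := by
  have hA3 : ∀ j, 3 ≤ j → A j = a := fun j hj => hA j (by omega)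
  rw [← momentum_sq]
  by_cases hS : snE E = 0
  · refine (flat_band hA3 ?_).1
    rw [sn_momentum, hS, Complex.ofReal_zero]
  · refine mem_spectrum_of_band hA3 ?_ (disc_momentum α E) (hE.resolve_left hS)
    rw [sn_momentum]
    exact Complex.ofReal_ne_zero.2 hS

/-- Flat bands, and bands shrunk to points when `cos aπ = 0`, have infinite multiplicity; elsewhere
in the bands there are no `ℓ²` solutions, hence no eigenvalue. -/
lemma not_mem_discreteSpectrum_of_mem_bands (hA : ∀ j, j ≠ 1 → A j = a) {E : ℝ}
    (hE : E ∈ bands α (Real.cos (a * Real.pi))) :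
    (E : ℂ) ∉ UnboundedOp.discreteSpectrum (chainHamiltonian α A) := by
  rintro ⟨-, -, he, hf⟩
  rw [← momentum_sq] at he hf
  by_cases hS : snE E = 0
  · refine (flat_band (fun j (hj : 3 ≤ j) => hA j (by omega)) ?_).2 hf
    rw [sn_momentum, hS, Complex.ofReal_zero]
  · have hS' : sn (momentum E) Real.pi ≠ 0 := by
      rw [sn_momentum]
      exact Complex.ofReal_ne_zero.2 hS
    have hE' := hE.resolve_left hS
    have hb : ∀ j, j ≠ 1 → ringCos A j = Real.cos (a * Real.pi) := fun j hj => by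
      rw [ringCos, hA j hj]
    by_cases hc : Real.cos (a * Real.pi) = 0
    · refine not_finiteDimensional_of_decoupled hS' (fun j hj => ?_) ?_ hf
      · rw [hb j (by omega), hc]
      · rw [hc, abs_zero] at hE'
        rw [disc_momentum, abs_nonpos_iff.1 hE', Complex.ofReal_zero]
    · refine not_isEigenvalue_of_kernel hS' (fun y hy => ?_) he
      rw [disc_momentum] at hy
      exact jacobi_kernel_band hb hy hc hE'

/-- Every coefficient is at most `|c|` in modulus, so `J - 2ξ` is invertible as soon as `|ξ| > |c|`.
-/
lemma not_mem_spectrum_of_abs_le (hA : ∀ j, j ≠ 1 → A j = a)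
    (h1 : |ringCos A 1| ≤ |Real.cos (a * Real.pi)|) {E : ℝ}
    (hE : E ∉ bands α (Real.cos (a * Real.pi))) :
    (E : ℂ) ∉ UnboundedOp.spectrum (chainHamiltonian α A) := by
  rw [← momentum_sq]
  refine not_not.2 (mem_resolventSet_of_jacobiInvertible (sn_momentum_ne_zero hE)
    (jacobiInvertible_of_off_interval (B := |Real.cos (a * Real.pi)|) (fun j => ?_) fun t ht h => ?_))
  · by_cases hj : j = 1
    · rwa [hj]
    · rw [ringCos, hA j hj]
  · rw [disc_momentum] at h
    have h2 : 2 * discE α E = t := by exact_mod_cast h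
    refine hE (Or.inr ?_)
    rw [← h2, abs_mul, abs_two] at ht
    linarith

lemma abs_discE_of_mem_spectrum (hA : ∀ j, j ≠ 1 → A j = a)
    (h1 : |Real.cos (a * Real.pi)| < |ringCos A 1|) {E : ℝ}
    (hE : E ∉ bands α (Real.cos (a * Real.pi)))
    (hs : (E : ℂ) ∈ UnboundedOp.spectrum (chainHamiltonian α A)) :
    |discE α E| = boundLevel (Real.cos (a * Real.pi)) (ringCos A 1) := by
  set c := Real.cos (a * Real.pi) with hc
  set c₁ := ringCos A 1 with hc₁
  set ξ := discE α E with hξ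
  have hξc : |c| < |ξ| := not_le.1 fun h => hE (Or.inr h)
  have hb : ∀ j, j ≠ 1 → ringCos A j = c := fun j hj => by rw [ringCos, hA j hj]
  have hsq : 0 ≤ ξ ^ 2 - c ^ 2 := sub_nonneg.2 (sq_le_sq.2 hξc.le)
  set r := Real.sqrt (ξ ^ 2 - c ^ 2) with hr
  have hr2 : r ^ 2 = ξ ^ 2 - c ^ 2 := Real.sq_sqrt hsq
  -- The roots are `ξ ± √(ξ² - c²)` with product `c²`; the sign of the square root follows that of
  -- `ξ` to give the one of larger modulus.
  obtain ⟨ν, hν, hν2⟩ : ∃ ν, |c| < |ν| ∧ ν ^ 2 + c ^ 2 = 2 * ξ * ν := by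
    rcases le_total 0 ξ with h | h
    · refine ⟨ξ + r, hξc.trans_le ?_, by linear_combination hr2⟩
      rw [abs_of_nonneg h, abs_of_nonneg (by positivity)]
      exact le_add_of_nonneg_right (Real.sqrt_nonneg _)
    · refine ⟨ξ - r, hξc.trans_le ?_, by linear_combination hr2⟩
      have h0 : 0 ≤ r := Real.sqrt_nonneg _
      rw [abs_of_nonpos h, abs_of_nonpos (by linarith)]
      linarith
  have h1ν : c₁ ^ 2 = ν ^ 2 := by
    by_contra hne
    rw [← momentum_sq] at hs
    refine hs (mem_resolventSet_of_jacobiInvertible (sn_momentum_ne_zero hE)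
      (jacobiInvertible_of_injective hb ?_ fun y hy => ?_))
    · rw [disc_momentum, norm_mul, Complex.norm_real, Complex.norm_ofNat]
      exact mul_lt_mul_of_pos_left hξc two_pos
    · rw [disc_momentum] at hy
      obtain ⟨e1, e2, e3⟩ := jacobi_kernel_gap hb hy hν hν2
      -- Eliminating `y 2` from the two matching relations: a nonzero state requires `c₁² = ν²`.
      refine e3 ((mul_eq_zero.1 (?_ : ((c₁ : ℂ) ^ 2 - (ν : ℂ) ^ 2) * y 1 = 0)).resolve_left ?_)
      · linear_combination (c₁ : ℂ) * e1 + ν * e2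
      · intro h0
        exact hne (by exact_mod_cast sub_eq_zero.1 h0)
  have hc0 : 0 < |c₁| := (abs_nonneg c).trans_lt h1
  have e : |ξ| * (2 * |c₁|) = c ^ 2 + c₁ ^ 2 := by
    have h2 := congrArg abs hν2
    rw [abs_of_nonneg (by positivity), abs_mul, abs_mul, abs_two, ← (sq_eq_sq_iff_abs_eq_abs _ _).1 h1ν,
      ← h1ν] at h2
    linarith
  rw [boundLevel, eq_div_iff (by positivity), e]

lemma isSimpleEigenvalue_of_abs_discE (hA : ∀ j, j ≠ 1 → A j = a)
    (h1 : |Real.cos (a * Real.pi)| < |ringCos A 1|) {E : ℝ}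
    (hE : E ∉ bands α (Real.cos (a * Real.pi)))
    (hξ : |discE α E| = boundLevel (Real.cos (a * Real.pi)) (ringCos A 1)) :
    UnboundedOp.IsSimpleEigenvalue (chainHamiltonian α A) (E : ℂ) := by
  set c := Real.cos (a * Real.pi) with hc
  set c₁ := ringCos A 1 with hc₁
  have hb : ∀ j, j ≠ 1 → ringCos A j = c := fun j hj => by rw [ringCos, hA j hj]
  have hc0 : 0 < |c₁| := (abs_nonneg c).trans_lt h1
  rw [boundLevel, eq_div_iff (by positivity)] at hξ
  -- At this level `ν = ±|c₁|` solves the quadratic, with the sign of the discriminant.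
  obtain ⟨ν, hν, hν2⟩ : ∃ ν, |ν| = |c₁| ∧ ν ^ 2 + c ^ 2 = 2 * discE α E * ν := by
    rcases le_total 0 (discE α E) with h | h
    · refine ⟨|c₁|, abs_abs _, ?_⟩
      rw [abs_of_nonneg h] at hξ
      rw [sq_abs]
      linarith
    · refine ⟨-|c₁|, by rw [abs_neg, abs_abs], ?_⟩
      rw [abs_of_nonpos h] at hξ
      rw [neg_sq, sq_abs]
      linarith
  have hνc : |c| < |ν| := by rwa [hν]
  obtain ⟨y, hy, hy1⟩ := exists_jacobi_bound_state hb hνc hν2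
    ((sq_eq_sq_iff_abs_eq_abs _ _).2 hν.symm)
  rw [← momentum_sq]
  refine isSimpleEigenvalue_of_kernel (sn_momentum_ne_zero hE) 1 (y₀ := y) ?_ hy1 fun y' hy' => ?_
  · rwa [disc_momentum]
  · rw [disc_momentum] at hy'
    exact (jacobi_kernel_gap hb hy' hνc hν2).2.2

end

/-! ### The gaps and the eigenvalue in each of them -/

/-- The components of the complement of the bands. -/
def gapSet (α c : ℝ) (n : ℕ) (τ : ℝ) : Set ℝ := {E | E ∈ energyInterval n ∧ |c| < τ * discE α E}

lemma exists_mem_energyInterval {E : ℝ} (hE : snE E ≠ 0) : ∃ n, E ∈ energyInterval n := by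
  rcases lt_or_ge E 1 with h | h
  · exact ⟨0, Or.inl rfl, by simpa using h⟩
  · have h0 : 0 ≤ E := by linarith
    refine ⟨⌊Real.sqrt E⌋₊, Or.inr ?_, ?_⟩
    · refine lt_of_le_of_ne ((Real.le_sqrt (Nat.cast_nonneg _) h0).1
        (Nat.floor_le (Real.sqrt_nonneg E))) fun h1 => hE ?_
      rw [← h1]
      refine snE_sq_nat (Nat.floor_pos.2 ?_).ne'
      exact Real.one_le_sqrt.2 h
    · exact (Real.sqrt_lt' (by positivity)).1 (Nat.lt_floor_add_one _)

lemma exists_mem_gapSet {α c E : ℝ} (hE : E ∉ bands α c) :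
    ∃ n τ, (τ = 1 ∨ τ = -1) ∧ E ∈ gapSet α c n τ := by
  obtain ⟨n, hn⟩ := exists_mem_energyInterval fun h => hE (Or.inl h)
  have h : |c| < |discE α E| := not_le.1 fun h => hE (Or.inr h)
  rcases lt_abs.1 h with h | h
  · exact ⟨n, 1, Or.inl rfl, hn, by rwa [one_mul]⟩
  · exact ⟨n, -1, Or.inr rfl, hn, by rwa [neg_one_mul]⟩

lemma abs_discE_of_mem_gapSet {α c τ E : ℝ} {n : ℕ} (hτ : τ = 1 ∨ τ = -1)
    (hE : E ∈ gapSet α c n τ) : |discE α E| = τ * discE α E := by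
  have h := (abs_nonneg c).trans_lt hE.2
  have : |τ| = 1 := by rcases hτ with rfl | rfl <;> simp
  rw [← abs_of_pos h, abs_mul, this, one_mul]

lemma not_mem_bands_of_mem_gapSet {α c τ E : ℝ} {n : ℕ} (hτ : τ = 1 ∨ τ = -1)
    (hE : E ∈ gapSet α c n τ) : E ∉ bands α c := by
  rintro (h | h)
  · exact snE_ne_zero hE.1 h
  · rw [abs_discE_of_mem_gapSet hτ hE] at h
    exact absurd hE.2 h.not_gt

lemma isOpen_gapSet (α c : ℝ) (n : ℕ) (τ : ℝ) : IsOpen (gapSet α c n τ) := by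
  have h1 : IsOpen {E : ℝ | n = 0 ∨ (n : ℝ) ^ 2 < E} := by
    by_cases hn : n = 0
    · simp [hn]
    · simp only [hn, false_or]
      exact isOpen_Ioi
  have h2 : IsOpen {E : ℝ | E < ((n : ℝ) + 1) ^ 2} := isOpen_Iio
  have h3 : IsOpen {E : ℝ | |c| < τ * discE α E} :=
    isOpen_lt continuous_const (continuous_const.mul (continuous_discE α))
  exact (h1.inter h2).inter h3

/-- The level `τ|c|` is crossed once in the interval, so the gap is the part of the interval on one
side of the crossing. -/
lemma ordConnected_gapSet {α c τ : ℝ} (hτ : τ = 1 ∨ τ = -1) (hc : |c| < 1) (n : ℕ) :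
    (gapSet α c n τ).OrdConnected := by
  have hτ2 : τ * τ = 1 := by rcases hτ with rfl | rfl <;> norm_num
  obtain ⟨E₀, -, -, h⟩ := exists_crossing α n (t := τ * |c|) (by
    have : |τ| = 1 := by rcases hτ with rfl | rfl <;> simp
    rwa [abs_mul, this, one_mul, abs_abs])
  have hiff : ∀ E, |c| < τ * discE α E ↔ 0 < τ * (discE α E - τ * |c|) := fun E => by
    rw [mul_sub, ← mul_assoc, hτ2, one_mul, sub_pos]
  -- The discriminant runs from `(-1)^n` to `-(-1)^n`, so the gap lies to the left of the crossing
  -- when `(-1)^n = τ` and to the right otherwise.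
  have hs : ((-1 : ℝ) ^ n = τ) ∨ ((-1 : ℝ) ^ n = -τ) := by
    rcases neg_one_pow_eq_or ℝ n with e | e <;> rcases hτ with rfl | rfl <;> simp [e]
  refine ⟨fun E₁ h₁ E₂ h₂ E hE => ?_⟩
  have hI : E ∈ energyInterval n :=
    ⟨h₁.1.1.imp_right fun h => h.trans_le hE.1, hE.2.trans_lt h₂.1.2⟩
  refine ⟨hI, (hiff E).2 ?_⟩
  have g₁ := (hiff E₁).1 h₁.2
  have g₂ := (hiff E₂).1 h₂.2
  rcases hs with e | e
  · rw [e] at h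
    rcases lt_trichotomy E E₀ with hlt | heq | hgt
    · exact (h E hI).1 hlt
    · rcases hE.2.eq_or_lt with h2 | h2
      · rwa [h2]
      · exact absurd g₂ ((h E₂ h₂.1).2 (heq ▸ h2)).not_gt
    · exact absurd g₂ ((h E₂ h₂.1).2 (hgt.trans_le hE.2)).not_gt
  · rw [e] at h
    have hneg : ∀ E ∈ energyInterval n, E < E₀ → τ * (discE α E - τ * |c|) < 0 := fun E hE hl => by
      have := (h E hE).1 hl
      linarith
    rcases lt_trichotomy E E₀ with hlt | heq | hgt
    · exact absurd g₁ (hneg E₁ h₁.1 (hE.1.trans_lt hlt)).not_gt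
    · rcases hE.1.eq_or_lt with h2 | h2
      · rwa [← h2]
      · exact absurd g₁ (hneg E₁ h₁.1 (heq ▸ h2)).not_gt
    · have := (h E hI).2 hgt
      linarith

/-- A limit point violating a strict inequality would be one of the points `n ^ 2` or a point with
`|discE| = |c|`, and both kinds belong to the bands. -/
lemma closure_gapSet_inter {α c τ : ℝ} (hτ : τ = 1 ∨ τ = -1) (n : ℕ) :
    closure (gapSet α c n τ) ∩ (bands α c)ᶜ ⊆ gapSet α c n τ := by
  have hcl : IsClosed {E : ℝ | ((n = 0 ∨ (n : ℝ) ^ 2 ≤ E) ∧ E ≤ ((n : ℝ) + 1) ^ 2) ∧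
      |c| ≤ τ * discE α E} := by
    have h1 : IsClosed {E : ℝ | n = 0 ∨ (n : ℝ) ^ 2 ≤ E} := by
      by_cases hn : n = 0
      · simp [hn]
      · simp only [hn, false_or]
        exact isClosed_Ici
    have h2 : IsClosed {E : ℝ | E ≤ ((n : ℝ) + 1) ^ 2} := isClosed_Iic
    have h3 : IsClosed {E : ℝ | |c| ≤ τ * discE α E} :=
      isClosed_le continuous_const (continuous_const.mul (continuous_discE α))
    exact (h1.inter h2).inter h3
  rintro E ⟨hE, hEb⟩
  have hsub : gapSet α c n τ ⊆ {E : ℝ | ((n = 0 ∨ (n : ℝ) ^ 2 ≤ E) ∧ E ≤ ((n : ℝ) + 1) ^ 2) ∧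
      |c| ≤ τ * discE α E} := fun E hE =>
    ⟨⟨hE.1.1.imp_right le_of_lt, hE.1.2.le⟩, hE.2.le⟩
  obtain ⟨⟨h1, h2⟩, h3⟩ := closure_minimal hsub hcl hE
  have hS : snE E ≠ 0 := fun h => hEb (Or.inl h)
  refine ⟨⟨?_, lt_of_le_of_ne h2 fun h => hS ?_⟩, lt_of_le_of_ne h3 fun h => hEb (Or.inr ?_)⟩
  · rcases Nat.eq_zero_or_pos n with hn | hn
    · exact Or.inl hn
    · refine h1.imp_right fun h1 => lt_of_le_of_ne h1 fun h => hS ?_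
      rw [← h]
      exact snE_sq_nat hn.ne'
  · rw [h]
    exact_mod_cast snE_sq_nat n.succ_ne_zero
  · rcases hτ with rfl | rfl
    · rw [one_mul] at h
      rw [← h, abs_abs]
    · rw [neg_one_mul] at h
      rw [← abs_neg, ← h, abs_abs]

/-- The gap is open, relatively closed in the complement of the bands, and connected. -/
lemma connectedComponentIn_bands_compl {α c τ E : ℝ} (hτ : τ = 1 ∨ τ = -1) (hc : |c| < 1) {n : ℕ}
    (hE : E ∈ gapSet α c n τ) : connectedComponentIn (bands α c)ᶜ E = gapSet α c n τ := by
  have hEb : E ∈ (bands α c)ᶜ := not_mem_bands_of_mem_gapSet hτ hE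
  apply Subset.antisymm
  · refine isPreconnected_connectedComponentIn.subset_of_closure_inter_subset
      (isOpen_gapSet α c n τ) ⟨E, mem_connectedComponentIn hEb, hE⟩ ?_
    exact (inter_subset_inter_right _ (connectedComponentIn_subset _ _)).trans
      (closure_gapSet_inter hτ n)
  · exact (ordConnected_gapSet hτ hc n).isPreconnected.subset_connectedComponentIn hE
      fun _ h => not_mem_bands_of_mem_gapSet hτ h

/-- In each gap the modulus of the discriminant takes each value between `|c|` and `1` once. -/
lemma existsUnique_mem_gapSet {α c m τ : ℝ} (hτ : τ = 1 ∨ τ = -1) (hcm : |c| < m) (hm : m < 1)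
    (n : ℕ) : ∃! E, E ∈ gapSet α c n τ ∧ |discE α E| = m := by
  have hτ2 : τ * τ = 1 := by rcases hτ with rfl | rfl <;> norm_num
  have hm0 : 0 ≤ m := (abs_nonneg c).trans hcm.le
  obtain ⟨E₀, hE₀, hd, h⟩ := exists_crossing α n (t := τ * m) (by
    have : |τ| = 1 := by rcases hτ with rfl | rfl <;> simp
    rwa [abs_mul, this, one_mul, abs_of_nonneg hm0])
  have hG : E₀ ∈ gapSet α c n τ := ⟨hE₀, by rwa [hd, ← mul_assoc, hτ2, one_mul]⟩
  refine ⟨E₀, ⟨hG, ?_⟩, fun E hE => ?_⟩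
  · rw [abs_discE_of_mem_gapSet hτ hG, hd, ← mul_assoc, hτ2, one_mul]
  · obtain ⟨hE, hEm⟩ := hE
    rw [abs_discE_of_mem_gapSet hτ hE] at hEm
    have hd' : discE α E - τ * m = 0 := by
      rw [← hEm, ← mul_assoc, hτ2, one_mul, sub_self]
    rcases lt_trichotomy E E₀ with hl | he | hg
    · have := (h E hE.1).1 hl
      rw [hd', mul_zero] at this
      exact absurd this (lt_irrefl _)
    · exact he
    · have := (h E hE.1).2 hg
      rw [hd', mul_zero] at this
      exact absurd this (lt_irrefl _)

theorem spectrum_eq_bands {α a : ℝ} {A : ℤ → ℝ} (hA : ∀ j, j ≠ 1 → A j = a)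
    (h1 : |ringCos A 1| ≤ |Real.cos (a * Real.pi)|) :
    UnboundedOp.spectrum (chainHamiltonian α A) =
      Complex.ofReal '' bands α (Real.cos (a * Real.pi)) := by
  ext z
  constructor
  · intro hz
    obtain ⟨E, rfl⟩ : ∃ E : ℝ, (E : ℂ) = z :=
      ⟨z.re, Complex.ext rfl (im_eq_zero_of_mem_spectrum hz).symm⟩
    exact ⟨E, by_contra fun h => not_mem_spectrum_of_abs_le hA h1 h hz, rfl⟩
  · rintro ⟨E, hE, rfl⟩
    exact mem_spectrum_of_mem_bands hA hE

theorem essentialSpectrum_eq_bands {α a : ℝ} {A : ℤ → ℝ} (hA : ∀ j, j ≠ 1 → A j = a)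
    (h1 : |Real.cos (a * Real.pi)| < |ringCos A 1|) :
    UnboundedOp.essentialSpectrum (chainHamiltonian α A) =
      Complex.ofReal '' bands α (Real.cos (a * Real.pi)) := by
  ext z
  constructor
  · rintro ⟨hz, hd⟩
    obtain ⟨E, rfl⟩ : ∃ E : ℝ, (E : ℂ) = z :=
      ⟨z.re, Complex.ext rfl (im_eq_zero_of_mem_spectrum hz).symm⟩
    -- Off the bands a spectral point is discrete: in the open gap around it all spectral points
    -- share the same `|discE|`, a value attained once, so it is isolated; and it is a simple
    -- eigenvalue.
    refine ⟨E, by_contra fun h => hd ⟨hz, ?_, ?_⟩, rfl⟩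
    · obtain ⟨n, τ, hτ, hE⟩ := exists_mem_gapSet h
      obtain ⟨ε, hε, hball⟩ := Metric.isOpen_iff.1 (isOpen_gapSet _ _ n τ) E hE
      refine ⟨ε, hε, fun z' hz' hdist => ?_⟩
      obtain ⟨E', rfl⟩ : ∃ E' : ℝ, (E' : ℂ) = z' :=
        ⟨z'.re, Complex.ext rfl (im_eq_zero_of_mem_spectrum hz').symm⟩
      rw [Complex.isometry_ofReal.dist_eq] at hdist
      have hE' := hball hdist
      have hu := existsUnique_mem_gapSet (α := α) hτ (lt_boundLevel h1)
        (boundLevel_lt_one h1 (Real.abs_cos_le_one _)) n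
      rw [hu.unique ⟨hE', abs_discE_of_mem_spectrum hA h1 (not_mem_bands_of_mem_gapSet hτ hE') hz'⟩
        ⟨hE, abs_discE_of_mem_spectrum hA h1 h hz⟩]
    · have hs := isSimpleEigenvalue_of_abs_discE hA h1 h (abs_discE_of_mem_spectrum hA h1 h hz)
      exact ⟨hs.isEigenvalue, hs.finiteDimensional⟩
  · rintro ⟨E, hE, rfl⟩
    exact ⟨mem_spectrum_of_mem_bands hA hE, not_mem_discreteSpectrum_of_mem_bands hA hE⟩

theorem exists_unique_eigenvalue_in_gap {α a : ℝ} {A : ℤ → ℝ} (hA : ∀ j, j ≠ 1 → A j = a)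
    (h1 : |Real.cos (a * Real.pi)| < |ringCos A 1|) {G : Set ℝ}
    (hG : UnboundedOp.IsEssentialGap (chainHamiltonian α A) G) :
    ∃ E ∈ G, UnboundedOp.IsSimpleEigenvalue (chainHamiltonian α A) (E : ℂ) ∧
      ∀ E' ∈ G, UnboundedOp.IsEigenvalue (chainHamiltonian α A) (E' : ℂ) → E' = E := by
  have hc₁ : |ringCos A 1| ≤ 1 := Real.abs_cos_le_one _
  obtain ⟨E₀, hE₀, rfl⟩ := hG
  have hiff : ∀ E : ℝ, (E : ℂ) ∉ UnboundedOp.essentialSpectrum (chainHamiltonian α A) ↔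
      E ∈ (bands α (Real.cos (a * Real.pi)))ᶜ := fun E => by
    rw [essentialSpectrum_eq_bands hA h1, Complex.ofReal_injective.mem_set_image, mem_compl_iff]
  simp only [hiff] at hE₀ ⊢
  obtain ⟨n, τ, hτ, hE⟩ := exists_mem_gapSet hE₀
  have hset : {E | E ∈ (bands α (Real.cos (a * Real.pi)))ᶜ} =
    (bands α (Real.cos (a * Real.pi)))ᶜ := rfl
  rw [hset, connectedComponentIn_bands_compl hτ (h1.trans_le hc₁) hE]
  have hu := existsUnique_mem_gapSet (α := α) hτ (lt_boundLevel h1) (boundLevel_lt_one h1 hc₁) n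
  obtain ⟨E, ⟨hEG, hEm⟩, -⟩ := id hu
  refine ⟨E, hEG, isSimpleEigenvalue_of_abs_discE hA h1 (not_mem_bands_of_mem_gapSet hτ hEG) hEm,
    fun E' hE' he => ?_⟩
  exact hu.unique ⟨hE', abs_discE_of_mem_spectrum hA h1 (not_mem_bands_of_mem_gapSet hτ hE')
    he.mem_spectrum⟩ ⟨hEG, hEm⟩

end RingChain

end

/-! ### The theorem for a single perturbed ring -/

theorem mainTheorem10 (α A A₁ : ℝ) (hA : ∀ n : ℤ, A ≠ n) :
    (¬ |Real.cos (A₁ * Real.pi)| > |Real.cos (A * Real.pi)| →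
      UnboundedOp.spectrum (RingChain.oneRingHamiltonian α A A₁) =
        UnboundedOp.spectrum (RingChain.periodicHamiltonian α A)) ∧
    (|Real.cos (A₁ * Real.pi)| > |Real.cos (A * Real.pi)| →
      UnboundedOp.essentialSpectrum (RingChain.oneRingHamiltonian α A A₁) =
        UnboundedOp.spectrum (RingChain.periodicHamiltonian α A) ∧
      ∀ G : Set ℝ, UnboundedOp.IsEssentialGap (RingChain.oneRingHamiltonian α A A₁) G →
        ∃ E ∈ G, UnboundedOp.IsSimpleEigenvalue (RingChain.oneRingHamiltonian α A A₁) (E : ℂ) ∧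
          ∀ E' ∈ G, UnboundedOp.IsEigenvalue (RingChain.oneRingHamiltonian α A A₁) (E' : ℂ) →
            E' = E) := by
  have h₁ : ∀ j : ℤ, j ≠ 1 → (if j = 1 then A₁ else if j = 2 then A else A) = A := fun j hj => by
    rw [if_neg hj, ite_self]
  -- The periodic chain is the case of equality `|c₁| = |c|`, so its spectrum is exactly the bands.
  have hp : UnboundedOp.spectrum (RingChain.periodicHamiltonian α A) =
      Complex.ofReal '' RingChain.bands α (Real.cos (A * Real.pi)) :=
    RingChain.spectrum_eq_bands (fun _ _ => rfl) le_rfl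
  refine ⟨fun h => ?_, fun h => ⟨?_, fun G hG => ?_⟩⟩
  · rw [hp]
    exact RingChain.spectrum_eq_bands h₁ (not_lt.1 h)
  · rw [hp]
    exact RingChain.essentialSpectrum_eq_bands h₁ h
  · exact RingChain.exists_unique_eigenvalue_in_gap h₁ h hG
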